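/- **Setting.** Let $\varphi:\mathbb R\to[0,1]$ be $C^\infty$ with $\varphi(\xi)=1$ for $|\xi|\le\frac12$ and $\varphi(\xi)=0$ for $|\xi|>1$, and let $a:\mathbb R\to\mathbb R$ be an even $C^\infty$ function with $a^2(\xi)=\varphi(\xi/2)-\varphi(\xi)$. For $N=2^{j+2}$, $j\in\mathbb N=\{0,1,2,\dots\}$, put $\tau=2\pi/N$ and $$\psi_N(t)=\frac1{\sqrt N}\sum_{l\in\mathbb Z}a\big(\tfrac{4l}N\big)e^{ilt},\qquad \psi_{Nk}(t)=\psi_N(t-k\tau).$$ Let $X(\vartheta)=\sum_{l\in\mathbb Z}w_le^{il\vartheta}$ be a real random field on the torus (the series converging in $L^2(P)$ for every $\vartheta$), with $w_0=0$, $w_{-l}=\overline{w_l}$, $E w_l=0$, $E|w_l|^2=C_{|l|}$, $E[w_l\overline{w_m}]=0$ for $l\ne m$ and $\sum_l C_l<\infty$. From the samples $X(2\pi m/M)$, $0\le m<M$, form $$\widetilde\beta_{Nk}=\frac1M\sum_{m=0}^{M-1}X\big(\tfrac{2\pi m}M\big)\psi_{Nk}\big(\tfrac{2\pi m}M\big),$$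 and set $\sigma_N^2=\frac1N\sum_{l}C_{|l|}a^2(\frac{4l}N)$ and $$\widetilde S_N=\frac1{\sqrt N}\sum_{k=1}^N\Big(\frac{\widetilde\beta_{Nk}}{\sigma_N}\Big)^3,\qquad \widetilde U_N=\frac1{\sqrt N}\sum_{k=1}^N\Big\{\Big(\frac{\widetilde\beta_{Nk}}{\sigma_N}\Big)^4-3\Big\}.$$ With $K_N(t)=\frac1{2\pi N}\big|\sum_{k=1}^Ne^{itk}\big|^2$ and $f_l=C_{|l|}a^2(\frac{4l}N)$, let $$\sigma_{S_N}^2=\frac{12\pi}{\sigma_N^6N^3}\sum_{l_1,l_2,l_3}f_{l_1}f_{l_2}f_{l_3}K_N((l_1+l_2+l_3)\tau),$$ $$\sigma_{U_N}^2=\frac{72}{\sigma_N^4}\frac{2\pi}{N^2}\sum_{l_1,l_2}f_{l_1}f_{l_2}K_N((l_1+l_2)\tau)+\frac{24}{\sigma_N^8}\frac{2\pi}{N^4}\sum_{l_1,\dots,l_4}f_{l_1}f_{l_2}f_{l_3}f_{l_4}K_N((l_1+\dots+l_4)\tau),$$ all sums running over $\mathbb Z$. **Assumptions.** Let $\alpha>1$.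 (A1) $C_l=g(l)l^{-\alpha}$ for all $l\ge1$, where $0<c_1\le g\le c_2<\infty$. (B) $X$ is a Gaussian process. (C) $C_l=L(l)l^{-\alpha}$ for all large $l$, where $L$ is slowly varying at infinity, bounded and bounded away from zero. (D) $N=N_n$ (of the form $2^{j+2}$) and $M=M_n$ run through sequences (for example $M_n=n$) with $M_n\to\infty$ and $\frac1{N}+\frac{N}{M^{\alpha/(\alpha+1)}}\to0$ as $n\to\infty$. **Proposition.** Under A1, B, C and D, for all integers $p_1,p_2\ge0$ the moments below are finite for every $n$, and, as $n\to\infty$, $$E\Big[\Big(\frac{\widetilde S_N}{\sigma_{S_N}}\Big)^{p_1}\Big(\frac{\widetilde U_N}{\sigma_{U_N}}\Big)^{p_2}\Big]\longrightarrow\begin{cases}(p_1-1)!!\,(p_2-1)!!&\text{if }p_1,p_2\text{ are both even},\\0&\text{otherwise}\end{cases}$$ (with $(-1)!!=1$; ratios with a zero denominator, possible only for finitely many $n$, are read as $0$), and $$\Big(\frac{\widetilde S_N}{\sigma_{S_N}},\frac{\widetilde U_N}{\sigma_{U_N}}\Big)\xrightarrow{\ \mathcal D\ }N(0,I_2).$$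 -/

import Mathlib

open MeasureTheory ProbabilityTheory Filter Topology

namespace TorusNeedlet

noncomputable section

/-- `a` is a needlet window: a smooth even real function with `a²(ξ) = φ(ξ/2) - φ(ξ)` for a smooth
`φ` with values in `[0, 1]`, equal to `1` on `|ξ| ≤ 1/2` and vanishing outside `|ξ| ≤ 1`.
In particular `a` vanishes unless `1/2 < |ξ| < 2`. -/
def IsWindow (a : ℝ → ℝ) : Prop :=
  ContDiff ℝ (⊤ : ℕ∞) a ∧ (∀ x, a (-x) = a x) ∧
    ∃ φ : ℝ → ℝ, ContDiff ℝ (⊤ : ℕ∞) φ ∧ (∀ x, 0 ≤ φ x ∧ φ x ≤ 1) ∧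
      (∀ x, |x| ≤ 1 / 2 → φ x = 1) ∧ (∀ x, 1 < |x| → φ x = 0) ∧
      ∀ x, a x ^ 2 = φ (x / 2) - φ x

/-- `X(ϑ) = ∑_{l ∈ ℤ} w_l e^{ilϑ}` is a real random field on the torus with spectral
coefficients `w_l` and angular power spectrum `C`, where `E|w_l|² = C_{|l|}`: the coefficients are
centred, square integrable, pairwise uncorrelated, `w_{-l}` is the conjugate of `w_l`, `w_0 = 0`,
`C` is summable, and the series converges in `L²(P)` for every `ϑ`. -/
structure IsSpectralField {Ω : Type*} [MeasurableSpace Ω] (P : Measure Ω) (C : ℕ → ℝ)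
    (w : ℤ → Ω → ℂ) (X : ℝ → Ω → ℝ) : Prop where
  aemeasurable : ∀ ϑ, AEMeasurable (X ϑ) P
  memLp : ∀ l, MemLp (w l) 2 P
  zero : w 0 =ᵐ[P] 0
  conj : ∀ l, w (-l) =ᵐ[P] fun ω => (starRingEnd ℂ) (w l ω)
  mean : ∀ l, ∫ ω, w l ω ∂P = 0
  power : ∀ l, ∫ ω, ‖w l ω‖ ^ 2 ∂P = C l.natAbs
  uncorrelated : ∀ l m, l ≠ m → ∫ ω, w l ω * (starRingEnd ℂ) (w m ω) ∂P = 0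
  summable : Summable C
  series : ∀ ϑ : ℝ, Tendsto (fun n : ℕ =>
    eLpNorm (fun ω => (X ϑ ω : ℂ) -
      ∑ l ∈ Finset.Icc (-(n : ℤ)) n, w l ω * Complex.exp (Complex.I * l * ϑ)) 2 P) atTop (𝓝 0)

/-- `C_l = g(l) l^{-α}` for `l ≥ 1`, with `g` bounded and bounded away from zero. -/
def IsRegularSpectrum (C : ℕ → ℝ) (α : ℝ) : Prop :=
  1 < α ∧ ∃ (g : ℕ → ℝ) (c₁ c₂ : ℝ), 0 < c₁ ∧ (∀ l, c₁ ≤ g l ∧ g l ≤ c₂) ∧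
    ∀ l : ℕ, 1 ≤ l → C l = g l * (l : ℝ) ^ (-α)

/-- Slow variation at infinity (only the values of `L` near infinity matter). -/
def IsSlowlyVarying (L : ℝ → ℝ) : Prop :=
  Measurable L ∧ (∀ᶠ x in atTop, 0 < L x) ∧
    ∀ r : ℝ, 0 < r → Tendsto (fun x => L (r * x) / L x) atTop (𝓝 1)

/-- `C_l = L(l) l^{-α}` for large `l`, with `L` slowly varying, bounded and bounded away from
zero. -/
def IsRegularlyVaryingSpectrum (C : ℕ → ℝ) (α : ℝ) : Prop :=
  1 < α ∧ ∃ (L : ℝ → ℝ) (c₁ c₂ : ℝ), IsSlowlyVarying L ∧ 0 < c₁ ∧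
    (∀ᶠ x in atTop, c₁ ≤ L x ∧ L x ≤ c₂) ∧
    ∀ᶠ l : ℕ in atTop, C l = L l * (l : ℝ) ^ (-α)

/-- A finite range of frequencies containing every `l` with `a(4l/N) ≠ 0`. -/
def freq (N : ℕ) : Finset ℤ := Finset.Icc (-(N : ℤ)) N

/-- `ψ_N(t) = N^{-1/2} ∑_l a(4l/N) e^{ilt}`, as a complex number. -/
def psiC (a : ℝ → ℝ) (N : ℕ) (t : ℝ) : ℂ :=
  (1 / Real.sqrt N : ℝ) *
    ∑ l ∈ freq N, (a (4 * l / N) : ℂ) * Complex.exp (Complex.I * l * t)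

/-- The real number `ψ_N(t)`; see `ofReal_psi`. -/
def psi (a : ℝ → ℝ) (N : ℕ) (t : ℝ) : ℝ := (psiC a N t).re

/-- The sampled wavelet coefficient
`β̃_{Nk} = M⁻¹ ∑_{m=0}^{M-1} X(2πm/M) ψ_N(2πm/M - kτ)`, with `τ = 2π/N`. -/
def sampledCoeff {Ω : Type*} (a : ℝ → ℝ) (X : ℝ → Ω → ℝ) (M N k : ℕ) (ω : Ω) : ℝ :=
  (1 / M : ℝ) * ∑ m ∈ Finset.range M,
    X (2 * Real.pi * m / M) ω * psi a N (2 * Real.pi * m / M - k * (2 * Real.pi / N))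

/-- `C_{|l|} a²(4l/N)`. -/
def specWeight (a : ℝ → ℝ) (C : ℕ → ℝ) (N : ℕ) (l : ℤ) : ℝ :=
  C l.natAbs * a (4 * l / N) ^ 2

/-- `σ_N² = N⁻¹ ∑_l C_{|l|} a²(4l/N)`. -/
def sigmaSq (a : ℝ → ℝ) (C : ℕ → ℝ) (N : ℕ) : ℝ :=
  (1 / N : ℝ) * ∑ l ∈ freq N, specWeight a C N l

/-- `σ_N`. -/
def sigma (a : ℝ → ℝ) (C : ℕ → ℝ) (N : ℕ) : ℝ := Real.sqrt (sigmaSq a C N)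

/-- Fejér's kernel `K_N(t) = (2πN)⁻¹ |∑_{k=1}^N e^{itk}|²`. -/
def fejer (N : ℕ) (t : ℝ) : ℝ :=
  1 / (2 * Real.pi * N) * ‖∑ k ∈ Finset.Icc 1 N, Complex.exp (Complex.I * t * k)‖ ^ 2

/-- `σ_{S_N}²`. -/
def sigmaSSq (a : ℝ → ℝ) (C : ℕ → ℝ) (N : ℕ) : ℝ :=
  12 * Real.pi / sigma a C N ^ 6 * (1 / (N : ℝ) ^ 3) *
    ∑ l₁ ∈ freq N, ∑ l₂ ∈ freq N, ∑ l₃ ∈ freq N,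
      specWeight a C N l₁ * specWeight a C N l₂ * specWeight a C N l₃ *
        fejer N ((l₁ + l₂ + l₃) * (2 * Real.pi / N))

/-- `σ_{1U_N}²`. -/
def sigmaU1Sq (a : ℝ → ℝ) (C : ℕ → ℝ) (N : ℕ) : ℝ :=
  72 / sigma a C N ^ 4 * (2 * Real.pi / (N : ℝ) ^ 2) *
    ∑ l₁ ∈ freq N, ∑ l₂ ∈ freq N,
      specWeight a C N l₁ * specWeight a C N l₂ * fejer N ((l₁ + l₂) * (2 * Real.pi / N))

/-- `σ_{2U_N}²`. -/
def sigmaU2Sq (a : ℝ → ℝ) (C : ℕ → ℝ) (N : ℕ) : ℝ :=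
  24 / sigma a C N ^ 8 * (2 * Real.pi / (N : ℝ) ^ 4) *
    ∑ l₁ ∈ freq N, ∑ l₂ ∈ freq N, ∑ l₃ ∈ freq N, ∑ l₄ ∈ freq N,
      specWeight a C N l₁ * specWeight a C N l₂ * specWeight a C N l₃ * specWeight a C N l₄ *
        fejer N ((l₁ + l₂ + l₃ + l₄) * (2 * Real.pi / N))

/-- `σ_{S_N}`. -/
def sigmaS (a : ℝ → ℝ) (C : ℕ → ℝ) (N : ℕ) : ℝ := Real.sqrt (sigmaSSq a C N)

/-- `σ_{U_N}`, where `σ_{U_N}² = σ_{1U_N}² + σ_{2U_N}²`. -/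
def sigmaU (a : ℝ → ℝ) (C : ℕ → ℝ) (N : ℕ) : ℝ :=
  Real.sqrt (sigmaU1Sq a C N + sigmaU2Sq a C N)

/-- Skewness `N^{-1/2} ∑_{k=1}^N (b_k/σ)³` of coefficients `b_1, …, b_N` with scale `σ`. -/
def skewness {Ω : Type*} (N : ℕ) (σ : ℝ) (b : ℕ → Ω → ℝ) (ω : Ω) : ℝ :=
  1 / Real.sqrt N * ∑ k ∈ Finset.Icc 1 N, (b k ω / σ) ^ 3

/-- Kurtosis `N^{-1/2} ∑_{k=1}^N ((b_k/σ)⁴ - 3)` of coefficients `b_1, …, b_N` with scale `σ`. -/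
def kurtosis {Ω : Type*} (N : ℕ) (σ : ℝ) (b : ℕ → Ω → ℝ) (ω : Ω) : ℝ :=
  1 / Real.sqrt N * ∑ k ∈ Finset.Icc 1 N, ((b k ω / σ) ^ 4 - 3)

/-- `S̃_N / σ_{S_N}`: the normalized skewness of the sampled coefficients. -/
def normSkewness {Ω : Type*} (a : ℝ → ℝ) (C : ℕ → ℝ) (X : ℝ → Ω → ℝ) (M N : ℕ) (ω : Ω) : ℝ :=
  skewness N (sigma a C N) (sampledCoeff a X M N) ω / sigmaS a C N

/-- `Ũ_N / σ_{U_N}`: the normalized kurtosis of the sampled coefficients. -/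
def normKurtosis {Ω : Type*} (a : ℝ → ℝ) (C : ℕ → ℝ) (X : ℝ → Ω → ℝ) (M N : ℕ) (ω : Ω) : ℝ :=
  kurtosis N (sigma a C N) (sampledCoeff a X M N) ω / sigmaU a C N

/-- The moments of the standard normal law: `(p - 1)!!` for even `p` (`1` for `p = 0`), `0` for
odd `p`. -/
def normalMoment (p : ℕ) : ℝ := if Even p then (Nat.doubleFactorial (p - 1) : ℝ) else 0

lemma ofReal_psi {a : ℝ → ℝ} (ha : ∀ x, a (-x) = a x) (N : ℕ) (t : ℝ) :
    (psi a N t : ℂ) = psiC a N t := by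
  unfold psi
  apply Complex.conj_eq_iff_re.mp
  unfold psiC freq
  rw [map_mul, Complex.conj_ofReal, map_sum]
  congr 1
  refine Finset.sum_bij' (fun l _ => -l) (fun l _ => -l) ?_ ?_ ?_ ?_ ?_
  · intro l hl
    simp only [Finset.mem_Icc] at hl ⊢
    omega
  · intro l hl
    simp only [Finset.mem_Icc] at hl ⊢
    omega
  · intro l _
    simp
  · intro l _
    simp
  · intro l _
    have h : (4 * ((-l : ℤ) : ℝ) / N) = -(4 * (l : ℝ) / N) := by
      push_cast
      ring
    rw [map_mul, Complex.conj_ofReal, ← Complex.exp_conj, h, ha]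
    congr 2
    simp

lemma IsWindow.eq_zero {a : ℝ → ℝ} (h : IsWindow a) {x : ℝ} (hx : |x| ≤ 1 / 2 ∨ 2 < |x|) :
    a x = 0 := by
  obtain ⟨-, -, φ, -, -, h1, h0, hφ⟩ := h
  have hx2 : |x / 2| = |x| / 2 := by rw [abs_div, abs_two]
  have h2 : a x ^ 2 = 0 := by
    rw [hφ]
    rcases hx with hx | hx
    · rw [h1 x hx, h1 (x / 2) (by rw [hx2]; linarith [abs_nonneg x]), sub_self]
    · rw [h0 x (by linarith), h0 (x / 2) (by rw [hx2]; linarith), sub_self]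
  exact pow_eq_zero_iff two_ne_zero |>.mp h2

end

end TorusNeedlet

open TorusNeedlet

/-! Let `v` be the common variance of the sampled coefficients and put `x_k = β̃_{Nk} / √v`. Under
Gaussianity the vector `x` has a centred Gaussian law with unit variances and some covariance matrix
`R`. Everything rests on two properties of `R`. Its rows sum to zero, because the coefficients sum
to zero: summing the shifted needlets over `k` keeps only frequencies divisible by `N`, where the
window vanishes. Its quadratic form is bounded by a constant `Λ` independent of `n`, because the
spectral weights `C_{|l|} a²(4l/N)` and `σ_N²` are both of order `N^{-α}`.

The normalized statistics are `s = c₁ ∑ x_k³` and `u = c₂ ∑ (x_k⁴ - 3) + δ`, with `c₁²` and `c₂²` of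
order at most `1/N`. Gaussian integration by parts (`integral_coord_mul_eval`) and the zero row sums
give, for every polynomial `p`, `E[∑ x_k³ p] = E[∑_j (∑_k R_{jk} x_k²) ∂_j p]` and `E[∑ (x_k⁴ - 3)
p] = E[∑_j (∑_k R_{jk} (x_k³ + 3 x_k)) ∂_j p]`. For `p = s^a u^b` this is the moment recursion of
two independent standard normal variables, except that its coefficients are random: they are the
bilinear statistics `3c₁² ∑ R x_k² x_j²`, `4c₁c₂ ∑ R x_k³ x_j²` and `4c₂² ∑ R x_k³ (x_j³ + 3x_j)`.
Their means tend to `1`, `0` and `1`; the first and third means are exactly what `σ_{S_N}²` and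
`σ_{U_N}²` compute once the Fejér sums are rewritten as sums of powers of covariances.

Their fluctuations vanish by concentration. Pisier's inequality (`integral_sub_integral_pow_le`)
bounds the central moments of a Gaussian polynomial by those of its gradient. It gives bounded
moments for `s` and `u`, and a variance `O(N)` for the unscaled bilinear statistics
(`variance_bilStat_le`), hence `O(1/N)` after scaling. Cauchy–Schwarz then closes the recursion
(`tendsto_polyMean_pow`), and the method of moments turns the limit into convergence in
distribution.

Sampling replaces `C_{|l|}` by a folded spectrum. Since `2N < M` eventually, each residue class
modulo `M` meets `[-N, N]` at most once, so the sampled coefficients remain stationary, and each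
covariance changes by `O(M^{-α})`. Relative to `σ_N²` this is `ε = O((N/M)^α)`. All perturbation
terms are bounded by a multiple of `N ε`, and the rate condition says that `N^{α+1} / M^α` tends to
`0`. -/

namespace TorusNeedlet

/-! ### Gaussian integration by parts for polynomials -/

section GaussianCalculus

/-- `f s z` grows at most polynomially in `‖z‖`, uniformly in `s`. -/
def PolyGrowth {S E : Type*} [Norm E] (f : S → E → ℝ) : Prop :=
  ∃ (K : ℝ) (m : ℕ), 0 ≤ K ∧ ∀ s z, |f s z| ≤ K * (1 + ‖z‖) ^ m

namespace PolyGrowth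

variable {S E : Type*} [NormedAddCommGroup E] {f g : S → E → ℝ}

lemma const (c : ℝ) : PolyGrowth (fun (_ : S) (_ : E) => c) :=
  ⟨|c|, 0, abs_nonneg c, by simp⟩

lemma add (hf : PolyGrowth f) (hg : PolyGrowth g) : PolyGrowth (fun s z => f s z + g s z) := by
  obtain ⟨K, m, hK, hf⟩ := hf
  obtain ⟨L, l, hL, hg⟩ := hg
  refine ⟨K + L, max m l, by positivity, fun s z => ?_⟩
  have h1 : (1 : ℝ) ≤ 1 + ‖z‖ := by linarith [norm_nonneg z]
  calc |f s z + g s z| ≤ |f s z| + |g s z| := abs_add_le _ _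
    _ ≤ K * (1 + ‖z‖) ^ m + L * (1 + ‖z‖) ^ l := add_le_add (hf s z) (hg s z)
    _ ≤ K * (1 + ‖z‖) ^ max m l + L * (1 + ‖z‖) ^ max m l := by
      gcongr
      · exact le_max_left _ _
      · exact le_max_right _ _
    _ = _ := by ring

lemma mul (hf : PolyGrowth f) (hg : PolyGrowth g) : PolyGrowth (fun s z => f s z * g s z) := by
  obtain ⟨K, m, hK, hf⟩ := hf
  obtain ⟨L, l, hL, hg⟩ := hg
  refine ⟨K * L, m + l, by positivity, fun s z => ?_⟩
  rw [abs_mul]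
  calc |f s z| * |g s z| ≤ (K * (1 + ‖z‖) ^ m) * (L * (1 + ‖z‖) ^ l) :=
        mul_le_mul (hf s z) (hg s z) (abs_nonneg _) (by positivity)
    _ = _ := by ring

lemma pow (hf : PolyGrowth f) (n : ℕ) : PolyGrowth (fun s z => f s z ^ n) := by
  induction n with
  | zero => simpa using const 1
  | succ n ih => simpa only [pow_succ] using ih.mul hf

lemma sum {ι : Type*} (t : Finset ι) {F : ι → S → E → ℝ} (hF : ∀ i ∈ t, PolyGrowth (F i)) :
    PolyGrowth (fun s z => ∑ i ∈ t, F i s z) := by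
  classical
  induction t using Finset.induction_on with
  | empty => simpa using const 0
  | insert a t ha ih =>
    simp only [Finset.sum_insert ha]
    exact (hF a (by simp)).add (ih fun i hi => hF i (by simp [hi]))

lemma eval {ι : Type*} (p : MvPolynomial ι ℝ) {c : S → E → ι → ℝ}
    (hc : ∀ i, PolyGrowth (fun s z => c s z i)) :
    PolyGrowth (fun s z => MvPolynomial.eval (c s z) p) := by
  induction p using MvPolynomial.induction_on with
  | C a => simpa using const a
  | add p q hp hq => simpa using hp.add hq
  | mul_X p i hp => simpa using hp.mul (hc i)

lemma of_le (c : ℝ) (h : ∀ s z, |f s z| ≤ c * ‖z‖) : PolyGrowth f := by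
  refine ⟨|c|, 1, abs_nonneg c, fun s z => (h s z).trans ?_⟩
  rw [pow_one]
  exact mul_le_mul (le_abs_self c) (by linarith) (norm_nonneg z) (abs_nonneg c)

end PolyGrowth

lemma integrable_one_add_norm_pow {E : Type*} [NormedAddCommGroup E] [NormedSpace ℝ E]
    [MeasurableSpace E] [BorelSpace E] [CompleteSpace E] [SecondCountableTopology E]
    (ν : Measure E) [IsGaussian ν] (m : ℕ) : Integrable (fun z : E => (1 + ‖z‖) ^ m) ν := by
  have h := (IsGaussian.memLp_id ν m (by simp)).integrable_norm_pow'
  refine (((integrable_const (1 : ℝ)).add h).const_mul (2 ^ (m - 1))).mono'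
    (by fun_prop) (ae_of_all _ fun z => ?_)
  rw [Real.norm_of_nonneg (by positivity)]
  simpa using add_pow_le zero_le_one (norm_nonneg z) m

lemma PolyGrowth.integrable {S E : Type*} [NormedAddCommGroup E] [NormedSpace ℝ E]
    [MeasurableSpace E] [BorelSpace E] [CompleteSpace E] [SecondCountableTopology E]
    {ν : Measure E} [IsGaussian ν] {f : S → E → ℝ} (hf : PolyGrowth f) (s : S)
    (hm : AEStronglyMeasurable (f s) ν) : Integrable (f s) ν := by
  obtain ⟨K, m, -, hf⟩ := hf
  exact ((integrable_one_add_norm_pow ν m).const_mul K).mono' hm (ae_of_all _ fun z => hf s z)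

lemma hasDerivAt_eval {ι : Type*} [Fintype ι] (p : MvPolynomial ι ℝ) {c : ℝ → ι → ℝ}
    {c' : ι → ℝ} {t : ℝ} (hc : ∀ i, HasDerivAt (fun t => c t i) (c' i) t) :
    HasDerivAt (fun t => MvPolynomial.eval (c t) p)
      (∑ i, MvPolynomial.eval (c t) (MvPolynomial.pderiv i p) * c' i) t := by
  classical
  induction p using MvPolynomial.induction_on with
  | C a => simpa using hasDerivAt_const t a
  | add p q hp hq =>
    simp only [map_add, add_mul, Finset.sum_add_distrib]
    exact hp.add hq
  | mul_X p i hp =>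
    have h := hp.mul (hc i)
    simp only [map_mul, MvPolynomial.eval_X]
    refine h.congr_deriv ?_
    simp only [Derivation.leibniz, MvPolynomial.pderiv_X, smul_eq_mul, map_add, map_mul,
      MvPolynomial.eval_X, add_mul, Finset.sum_add_distrib]
    rw [add_comm]
    congr 1
    · rw [Finset.sum_eq_single i]
      · simp
      · intro j _ hj
        simp [hj.symm]
      · simp
    · rw [Finset.sum_mul]
      exact Finset.sum_congr rfl fun j _ => by ring

variable {ι : Type*} [Fintype ι] (μ : Measure (ι → ℝ)) [IsGaussian μ]

lemma integrable_eval (p : MvPolynomial ι ℝ) : Integrable (fun x => MvPolynomial.eval x p) μ :=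
  (PolyGrowth.eval (S := Unit) (E := ι → ℝ) (c := fun _ x => x) p fun i =>
    PolyGrowth.of_le 1 fun _ z => by simpa using norm_le_pi_norm z i).integrable ()
      (MvPolynomial.continuous_eval p).aestronglyMeasurable

variable {μ} in
lemma integrable_of_eval {f : (ι → ℝ) → ℝ} (p : MvPolynomial ι ℝ)
    (h : ∀ x, MvPolynomial.eval x p = f x) : Integrable f μ :=
  (integrable_eval μ p).congr (ae_of_all _ h)

/-- The first component of a pair of vectors rotated by the angle `θ`. -/
noncomputable def rotFst {ι : Type*} (θ : ℝ) (z : (ι → ℝ) × (ι → ℝ)) (i : ι) : ℝ :=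
  Real.cos θ * z.1 i + Real.sin θ * z.2 i

/-- The second component of a pair of vectors rotated by the angle `θ`. -/
noncomputable def rotSnd {ι : Type*} (θ : ℝ) (z : (ι → ℝ) × (ι → ℝ)) (i : ι) : ℝ :=
  -Real.sin θ * z.1 i + Real.cos θ * z.2 i

lemma hasDerivAt_rotFst {ι : Type*} (θ : ℝ) (z : (ι → ℝ) × (ι → ℝ)) (i : ι) :
    HasDerivAt (fun θ => rotFst θ z i) (rotSnd θ z i) θ :=
  ((Real.hasDerivAt_cos θ).mul_const _).add ((Real.hasDerivAt_sin θ).mul_const _)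

lemma hasDerivAt_rotSnd {ι : Type*} (θ : ℝ) (z : (ι → ℝ) × (ι → ℝ)) (i : ι) :
    HasDerivAt (fun θ => rotSnd θ z i) (-rotFst θ z i) θ := by
  refine (((Real.hasDerivAt_sin θ).neg.mul_const _).add
    ((Real.hasDerivAt_cos θ).mul_const _)).congr_deriv ?_
  simp only [rotFst]
  ring

lemma polyGrowth_rotFst (i : ι) :
    PolyGrowth (fun (θ : ℝ) (z : (ι → ℝ) × (ι → ℝ)) => rotFst θ z i) := by
  refine PolyGrowth.of_le 2 fun θ z => ?_
  have h1 := (norm_le_pi_norm z.1 i).trans (norm_fst_le z)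
  have h2 := (norm_le_pi_norm z.2 i).trans (norm_snd_le z)
  rw [Real.norm_eq_abs] at h1 h2
  refine (abs_add_le _ _).trans ?_
  rw [abs_mul, abs_mul]
  nlinarith [Real.abs_cos_le_one θ, Real.abs_sin_le_one θ, abs_nonneg (z.1 i), abs_nonneg (z.2 i)]

lemma polyGrowth_rotSnd (i : ι) :
    PolyGrowth (fun (θ : ℝ) (z : (ι → ℝ) × (ι → ℝ)) => rotSnd θ z i) := by
  refine PolyGrowth.of_le 2 fun θ z => ?_
  have h1 := (norm_le_pi_norm z.1 i).trans (norm_fst_le z)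
  have h2 := (norm_le_pi_norm z.2 i).trans (norm_snd_le z)
  rw [Real.norm_eq_abs] at h1 h2
  refine (abs_add_le _ _).trans ?_
  rw [abs_mul, abs_mul, abs_neg]
  nlinarith [Real.abs_cos_le_one θ, Real.abs_sin_le_one θ, abs_nonneg (z.1 i), abs_nonneg (z.2 i)]

lemma continuous_eval_comp {ι E : Type*} [TopologicalSpace E] (p : MvPolynomial ι ℝ)
    {c : E → ι → ℝ} (hc : ∀ i, Continuous fun z => c z i) :
    Continuous fun z => MvPolynomial.eval (c z) p :=
  (MvPolynomial.continuous_eval p).comp (continuous_pi hc)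

lemma continuous_rotFst {ι : Type*} (i : ι) :
    Continuous fun w : ℝ × ((ι → ℝ) × (ι → ℝ)) => rotFst w.1 w.2 i := by
  unfold rotFst; fun_prop

lemma continuous_rotSnd {ι : Type*} (i : ι) :
    Continuous fun w : ℝ × ((ι → ℝ) × (ι → ℝ)) => rotSnd w.1 w.2 i := by
  unfold rotSnd; fun_prop

/-- Two independent copies of a centred Gaussian vector have a rotation-invariant joint law. -/
lemma integral_rotation {μ : Measure (ι → ℝ)} [IsGaussian μ] (h0 : ∫ x, x ∂μ = 0) (θ : ℝ)
    {f : (ι → ℝ) × (ι → ℝ) → ℝ} (hf : Continuous f) :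
    ∫ z, f (rotFst θ z, rotSnd θ z) ∂(μ.prod μ) = ∫ z, f z ∂(μ.prod μ) := by
  have h := IsGaussian.map_rotation_eq_self (μ := μ) (by simpa using h0) θ
  conv_rhs => rw [← h]
  rw [integral_map (by fun_prop) hf.aestronglyMeasurable]
  refine integral_congr_ae (ae_of_all _ fun z => ?_)
  simp only [ContinuousLinearMap.rotation_apply]
  rfl

/-- Gaussian integration by parts. -/
theorem integral_coord_mul_eval {μ : Measure (ι → ℝ)} [IsGaussian μ] (h0 : ∫ x, x ∂μ = 0)
    (i : ι) (p : MvPolynomial ι ℝ) :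
    ∫ x, x i * MvPolynomial.eval x p ∂μ =
      ∑ j, (∫ x, x i * x j ∂μ) * ∫ x, MvPolynomial.eval x (MvPolynomial.pderiv j p) ∂μ := by
  -- The mean of `G θ` does not depend on `θ` by rotation invariance. At `θ = 0` its derivative is
  -- the difference of the two sides of the formula, so that difference is zero.
  set G : ℝ → (ι → ℝ) × (ι → ℝ) → ℝ := fun θ z =>
    rotSnd θ z i * MvPolynomial.eval (rotFst θ z) p with hG
  set G' : ℝ → (ι → ℝ) × (ι → ℝ) → ℝ := fun θ z =>
    -rotFst θ z i * MvPolynomial.eval (rotFst θ z) p + rotSnd θ z i *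
      ∑ j, MvPolynomial.eval (rotFst θ z) (MvPolynomial.pderiv j p) * rotSnd θ z j with hG'
  have cF : ∀ θ j, Continuous fun z : (ι → ℝ) × (ι → ℝ) => rotFst θ z j := fun θ j => by
    unfold rotFst; fun_prop
  have cS : ∀ θ j, Continuous fun z : (ι → ℝ) × (ι → ℝ) => rotSnd θ z j := fun θ j => by
    unfold rotSnd; fun_prop
  have cG : ∀ θ, Continuous (G θ) := fun θ =>
    (cS θ i).mul (continuous_eval_comp p (cF θ))
  have cG' : ∀ θ, Continuous (G' θ) := fun θ =>
    ((cF θ i).neg.mul (continuous_eval_comp p (cF θ))).add ((cS θ i).mul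
      (continuous_finsetSum _ fun j _ => (continuous_eval_comp _ (cF θ)).mul (cS θ j)))
  have gG : PolyGrowth G := (polyGrowth_rotSnd i).mul (PolyGrowth.eval p polyGrowth_rotFst)
  have gG' : PolyGrowth G' := by
    have := (((PolyGrowth.const (-1)).mul (polyGrowth_rotFst i)).mul
      (PolyGrowth.eval p polyGrowth_rotFst)).add ((polyGrowth_rotSnd i).mul
      (PolyGrowth.sum Finset.univ fun j _ => (PolyGrowth.eval (MvPolynomial.pderiv j p)
        polyGrowth_rotFst).mul (polyGrowth_rotSnd j)))
    simpa only [hG', neg_one_mul] using this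
  have hconst : ∀ θ, ∫ z, G θ z ∂(μ.prod μ) = ∫ z, z.2 i * MvPolynomial.eval z.1 p ∂(μ.prod μ) :=
    fun θ => integral_rotation h0 θ (f := fun z => z.2 i * MvPolynomial.eval z.1 p)
      (by have := MvPolynomial.continuous_eval p; fun_prop)
  have hder : HasDerivAt (fun θ => ∫ z, G θ z ∂(μ.prod μ)) (∫ z, G' 0 z ∂(μ.prod μ)) 0 := by
    -- A polynomial bound uniform in the angle is the dominating function for differentiation under
    -- the integral.
    obtain ⟨K, m, -, hK⟩ := id gG'
    refine (hasDerivAt_integral_of_dominated_loc_of_deriv_le (s := Set.univ)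
      (bound := fun z => K * (1 + ‖z‖) ^ m) univ_mem
      (Eventually.of_forall fun θ => (cG θ).aestronglyMeasurable)
      (gG.integrable 0 (cG 0).aestronglyMeasurable) (cG' 0).aestronglyMeasurable
      (ae_of_all _ fun z θ _ => hK θ z) ((integrable_one_add_norm_pow _ m).const_mul K)
      (ae_of_all _ fun z θ _ => ?_)).2
    exact (hasDerivAt_rotSnd θ z i).mul (hasDerivAt_eval p (hasDerivAt_rotFst θ z))
  have hzero : ∫ z, G' 0 z ∂(μ.prod μ) = 0 := by
    simp only [hconst] at hder
    exact hder.unique (hasDerivAt_const _ _)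
  have hint : ∀ j, Integrable (fun z : (ι → ℝ) × (ι → ℝ) =>
      MvPolynomial.eval z.1 (MvPolynomial.pderiv j p) * (z.2 i * z.2 j)) (μ.prod μ) := fun j =>
    Integrable.mul_prod (g := fun y : ι → ℝ => y i * y j)
      (integrable_eval μ (MvPolynomial.pderiv j p)) 
      (integrable_of_eval (MvPolynomial.X i * MvPolynomial.X j) fun x => by simp)
  have hint0 : Integrable (fun z : (ι → ℝ) × (ι → ℝ) =>
      (z.1 i * MvPolynomial.eval z.1 p) * (fun _ => (1 : ℝ)) z.2) (μ.prod μ) :=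
    Integrable.mul_prod (f := fun x : ι → ℝ => x i * MvPolynomial.eval x p)
      (integrable_of_eval (MvPolynomial.X i * p) fun x => by simp) (integrable_const 1)
  have hsplit : ∀ z, G' 0 z = (∑ j, MvPolynomial.eval z.1 (MvPolynomial.pderiv j p) *
      (z.2 i * z.2 j)) - (z.1 i * MvPolynomial.eval z.1 p) * (fun _ => (1 : ℝ)) z.2 := by
    intro z
    have h1 : rotFst 0 z = z.1 := by ext j; simp [rotFst]
    have h2 : rotSnd 0 z = z.2 := by ext j; simp [rotSnd]
    simp only [hG', h1, h2, Finset.mul_sum]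
    rw [add_comm, sub_eq_add_neg]
    congr 1
    · exact Finset.sum_congr rfl fun j _ => by ring
    · ring
  simp only [hsplit] at hzero
  rw [integral_sub (integrable_finsetSum _ fun j _ => hint j) hint0,
    integral_finsetSum _ fun j _ => hint j, sub_eq_zero,
    integral_prod_mul (f := fun x : ι → ℝ => x i * MvPolynomial.eval x p)
      (g := fun _ => (1 : ℝ))] at hzero
  simp only [integral_const, probReal_univ, smul_eq_mul, mul_one] at hzero
  rw [← hzero]
  refine Finset.sum_congr rfl fun j _ => ?_
  rw [integral_prod_mul (f := fun x : ι → ℝ => MvPolynomial.eval x (MvPolynomial.pderiv j p))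
    (g := fun y : ι → ℝ => y i * y j), mul_comm]

end GaussianCalculus

end TorusNeedlet

namespace TorusNeedlet

/-! ### Pisier's inequality and concentration of Gaussian polynomials -/

section Concentration

variable {ι : Type*} [Fintype ι]

/-- The absolute moment of order `2 m` of the standard normal law. -/
noncomputable def evenMoment (m : ℕ) : ℝ := ∫ t, t ^ (2 * m) ∂(gaussianReal 0 1)

lemma evenMoment_nonneg (m : ℕ) : 0 ≤ evenMoment m :=
  integral_nonneg fun t => (even_two_mul m).pow_nonneg t

lemma evenMoment_one : evenMoment 1 = 1 := by
  have h := variance_fun_id_gaussianReal (μ := 0) (v := 1)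
  rw [variance_of_integral_eq_zero (by fun_prop) (by simp)] at h
  simpa [evenMoment] using h

lemma integral_pow_gaussianReal (v : NNReal) (m : ℕ) :
    ∫ t, t ^ (2 * m) ∂(gaussianReal 0 v) = (v : ℝ) ^ m * evenMoment m := by
  have h : gaussianReal 0 v = (gaussianReal 0 1).map (fun t => Real.sqrt v * t) := by
    rw [gaussianReal_map_const_mul]
    congr 1
    · simp
    · ext
      simp [Real.sq_sqrt]
  rw [h, integral_map (by fun_prop) (by fun_prop), evenMoment, ← integral_const_mul]
  refine integral_congr_ae (ae_of_all _ fun t => ?_)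
  beta_reduce
  rw [mul_pow, pow_mul (Real.sqrt v), Real.sq_sqrt v.coe_nonneg]

/-- A linear functional of the vector is a one-dimensional centred Gaussian, whose variance is the
covariance form at `v`. -/
lemma integral_linear_pow {μ : Measure (ι → ℝ)} [IsGaussian μ] (h0 : ∫ x, x ∂μ = 0)
    (v : ι → ℝ) (m : ℕ) :
    ∫ y, (∑ j, v j * y j) ^ (2 * m) ∂μ =
      (∑ i, ∑ j, (∫ x, x i * x j ∂μ) * v i * v j) ^ m * evenMoment m := by
  let L : (ι → ℝ) →L[ℝ] ℝ := ∑ j, v j • ContinuousLinearMap.proj (R := ℝ) (φ := fun _ => ℝ) j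
  have hL : ∀ y, L y = ∑ j, v j * y j := fun y => by
    simp [L]
  have hmean : ∫ y, L y ∂μ = 0 := by
    rw [L.integral_comp_comm (φ := fun y => y) (IsGaussian.integrable_id (μ := μ)), h0, map_zero]
  have hvar : Var[L; μ] = ∑ i, ∑ j, (∫ x, x i * x j ∂μ) * v i * v j := by
    rw [variance_of_integral_eq_zero (by fun_prop) hmean]
    have : ∀ y, L y ^ 2 = ∑ i, ∑ j, (v i * v j) * (y i * y j) := fun y => by
      rw [hL, sq, Finset.sum_mul_sum]
      exact Finset.sum_congr rfl fun i _ => Finset.sum_congr rfl fun j _ => by ring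
    have hi : ∀ i j, Integrable (fun y : ι → ℝ => (v i * v j) * (y i * y j)) μ := fun i j =>
      (integrable_of_eval (MvPolynomial.X i * MvPolynomial.X j) fun x => by simp).const_mul _
    simp only [this]
    rw [integral_finsetSum _ fun i _ => integrable_finsetSum _ fun j _ => hi i j]
    refine Finset.sum_congr rfl fun i _ => ?_
    rw [integral_finsetSum _ fun j _ => hi i j]
    refine Finset.sum_congr rfl fun j _ => ?_
    rw [integral_const_mul]
    ring
  have hlaw := IsGaussian.map_eq_gaussianReal (μ := μ) L
  rw [hmean] at hlaw
  calc ∫ y, (∑ j, v j * y j) ^ (2 * m) ∂μ = ∫ t, t ^ (2 * m) ∂(μ.map L) := by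
        rw [integral_map (by fun_prop) (by fun_prop)]
        simp only [hL]
    _ = _ := by
        rw [hlaw, integral_pow_gaussianReal, Real.coe_toNNReal _ (variance_nonneg _ _), hvar]

/-- Jensen's inequality for the uniform probability on `(0, b]`. -/
lemma pow_intervalIntegral_le {f : ℝ → ℝ} (hf : Continuous f) {b : ℝ} (hb : 0 < b) (m : ℕ) :
    (∫ t in (0 : ℝ)..b, f t) ^ (2 * m) ≤
      b ^ (2 * m) * (b⁻¹ * ∫ t in (0 : ℝ)..b, f t ^ (2 * m)) := by
  have hv : (volume (Set.Ioc (0 : ℝ) b)) ≠ 0 := by simp [hb]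
  have hv' : (volume (Set.Ioc (0 : ℝ) b)) ≠ ⊤ := by simp
  have h := ConvexOn.map_set_average_le (μ := volume) (t := Set.Ioc (0 : ℝ) b) (f := f)
    (g := fun x => x ^ (2 * m)) (even_two_mul m).convexOn_pow (by fun_prop) isClosed_univ hv hv'
    (by simp) (hf.integrableOn_Ioc) ((hf.pow _).integrableOn_Ioc)
  rw [setAverage_eq, setAverage_eq] at h
  have hr : volume.real (Set.Ioc (0 : ℝ) b) = b := by simp [hb.le]
  simp only [hr, smul_eq_mul] at h
  rw [intervalIntegral.integral_of_le hb.le, intervalIntegral.integral_of_le hb.le]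
  rw [mul_pow] at h
  calc _ = b ^ (2 * m) * (b⁻¹ ^ (2 * m) * (∫ t in Set.Ioc 0 b, f t) ^ (2 * m)) := by
        rw [← mul_assoc, ← mul_pow, mul_inv_cancel₀ hb.ne', one_pow, one_mul]
    _ ≤ _ := by gcongr

/-- Derivative of `p` at the first rotated vector, in the direction of the second. -/
noncomputable def dirDeriv (p : MvPolynomial ι ℝ) (z : (ι → ℝ) × (ι → ℝ)) : ℝ :=
  ∑ j, MvPolynomial.eval z.1 (MvPolynomial.pderiv j p) * z.2 j

lemma continuous_dirDeriv (p : MvPolynomial ι ℝ) : Continuous (dirDeriv p) := by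
  have := fun j => MvPolynomial.continuous_eval (MvPolynomial.pderiv j p)
  unfold dirDeriv
  fun_prop

lemma continuous_dirDeriv_rot (p : MvPolynomial ι ℝ) :
    Continuous fun w : ℝ × ((ι → ℝ) × (ι → ℝ)) => dirDeriv p (rotFst w.1 w.2, rotSnd w.1 w.2) :=
  (continuous_dirDeriv p).comp
    ((continuous_pi continuous_rotFst).prodMk (continuous_pi continuous_rotSnd))

/-- Pisier's inequality for an even power. -/
theorem integral_sub_pow_le {μ : Measure (ι → ℝ)} [IsGaussian μ] (h0 : ∫ x, x ∂μ = 0)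
    (p : MvPolynomial ι ℝ) (m : ℕ) :
    ∫ z, (MvPolynomial.eval z.2 p - MvPolynomial.eval z.1 p) ^ (2 * m) ∂(μ.prod μ) ≤
      (Real.pi / 2) ^ (2 * m) * ∫ z, dirDeriv p z ^ (2 * m) ∂(μ.prod μ) := by
  set b := Real.pi / 2 with hb
  have hb0 : 0 < b := by positivity
  set h : ℝ → (ι → ℝ) × (ι → ℝ) → ℝ := fun θ z => dirDeriv p (rotFst θ z, rotSnd θ z) with hh
  have ch : Continuous fun w : ℝ × ((ι → ℝ) × (ι → ℝ)) => h w.1 w.2 := continuous_dirDeriv_rot p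
  have gh : PolyGrowth (fun θ z => h θ z ^ (2 * m)) :=
    (PolyGrowth.sum Finset.univ fun j _ => (PolyGrowth.eval (MvPolynomial.pderiv j p)
        polyGrowth_rotFst).mul (polyGrowth_rotSnd j)).pow _
  -- A quarter turn carries the first vector to the second, and the derivative along the way is the
  -- directional derivative at the rotated pair, which has the law of the original pair.
  have hpath : ∀ z : (ι → ℝ) × (ι → ℝ), MvPolynomial.eval z.2 p - MvPolynomial.eval z.1 p =
      ∫ θ in (0 : ℝ)..b, h θ z := by
    intro z
    have h1 : rotFst 0 z = z.1 := by ext j; simp [rotFst]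
    have h2 : rotFst b z = z.2 := by ext j; simp [rotFst, hb]
    rw [intervalIntegral.integral_eq_sub_of_hasDerivAt
      (f := fun θ => MvPolynomial.eval (rotFst θ z) p)
      (f' := fun θ => h θ z) (fun θ _ => hasDerivAt_eval p (hasDerivAt_rotFst θ z)), h1, h2]
    exact (ch.comp (by fun_prop : Continuous fun θ : ℝ => (θ, z))).intervalIntegrable _ _
  have hint : Integrable (Function.uncurry fun θ z => h θ z ^ (2 * m))
      ((volume.restrict (Set.Ioc 0 b)).prod (μ.prod μ)) := by
    obtain ⟨K, k, -, hK⟩ := gh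
    refine (((integrable_one_add_norm_pow (μ.prod μ) k).const_mul K).comp_snd
      (volume.restrict (Set.Ioc 0 b))).mono' (ch.pow _).aestronglyMeasurable
      (ae_of_all _ fun w => hK w.1 w.2)
  calc ∫ z, (MvPolynomial.eval z.2 p - MvPolynomial.eval z.1 p) ^ (2 * m) ∂(μ.prod μ)
      ≤ ∫ z, b ^ (2 * m) * (b⁻¹ * ∫ θ in (0 : ℝ)..b, h θ z ^ (2 * m)) ∂(μ.prod μ) := by
        refine integral_mono_of_nonneg (ae_of_all _ fun z => (even_two_mul m).pow_nonneg _) ?_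
          (ae_of_all _ fun z => ?_)
        · simp only [intervalIntegral.integral_of_le hb0.le]
          exact (hint.integral_prod_right.const_mul _).const_mul _
        · simp only [hpath z]
          exact pow_intervalIntegral_le
            (ch.comp (by fun_prop : Continuous fun θ : ℝ => (θ, z))) hb0 m
    _ = b ^ (2 * m) * (b⁻¹ * ∫ θ in (0 : ℝ)..b, ∫ z, h θ z ^ (2 * m) ∂(μ.prod μ)) := by
        rw [integral_const_mul, integral_const_mul]
        simp only [intervalIntegral.integral_of_le hb0.le]
        rw [integral_integral_swap hint]
    _ = _ := by
        have : ∀ θ, ∫ z, h θ z ^ (2 * m) ∂(μ.prod μ) = ∫ z, dirDeriv p z ^ (2 * m) ∂(μ.prod μ) :=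
          fun θ => integral_rotation h0 θ (f := fun z => dirDeriv p z ^ (2 * m))
            ((continuous_dirDeriv p).pow _)
        simp only [this, intervalIntegral.integral_const, sub_zero, smul_eq_mul]
        rw [inv_mul_cancel_left₀ hb0.ne']

/-- Concentration of a polynomial of a Gaussian vector whose covariance is at most `Λ`. -/
theorem integral_sub_integral_pow_le {μ : Measure (ι → ℝ)} [IsGaussian μ] (h0 : ∫ x, x ∂μ = 0)
    {Λ : ℝ} (hΛ : ∀ v : ι → ℝ, ∑ i, ∑ j, (∫ x, x i * x j ∂μ) * v i * v j ≤ Λ * ∑ i, v i ^ 2)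
    (p : MvPolynomial ι ℝ) (m : ℕ) :
    ∫ x, (MvPolynomial.eval x p - ∫ y, MvPolynomial.eval y p ∂μ) ^ (2 * m) ∂μ ≤
      (Real.pi / 2) ^ (2 * m) * evenMoment m * Λ ^ m *
        ∫ x, (∑ j, MvPolynomial.eval x (MvPolynomial.pderiv j p) ^ 2) ^ m ∂μ := by
  have gdiff : PolyGrowth (fun (_ : Unit) (z : (ι → ℝ) × (ι → ℝ)) =>
      (MvPolynomial.eval z.2 p - MvPolynomial.eval z.1 p) ^ (2 * m)) := by
    have h1 : PolyGrowth (fun (_ : Unit) (z : (ι → ℝ) × (ι → ℝ)) => MvPolynomial.eval z.1 p) :=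
      PolyGrowth.eval p fun i => PolyGrowth.of_le 1 fun _ z => by
        simpa using (norm_le_pi_norm z.1 i).trans (norm_fst_le z)
    have h2 : PolyGrowth (fun (_ : Unit) (z : (ι → ℝ) × (ι → ℝ)) => MvPolynomial.eval z.2 p) :=
      PolyGrowth.eval p fun i => PolyGrowth.of_le 1 fun _ z => by
        simpa using (norm_le_pi_norm z.2 i).trans (norm_snd_le z)
    have := (h2.add ((PolyGrowth.const (-1)).mul h1)).pow (2 * m)
    simpa only [neg_one_mul, ← sub_eq_add_neg] using this
  have gdir : PolyGrowth (fun (_ : Unit) (z : (ι → ℝ) × (ι → ℝ)) => dirDeriv p z ^ (2 * m)) :=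
    (PolyGrowth.sum Finset.univ fun j _ => (PolyGrowth.eval (MvPolynomial.pderiv j p)
      fun i => PolyGrowth.of_le 1 fun _ z => by
        simpa using (norm_le_pi_norm z.1 i).trans (norm_fst_le z)).mul
      (PolyGrowth.of_le 1 fun _ z => by
        simpa using (norm_le_pi_norm z.2 j).trans (norm_snd_le z))).pow _
  have cp := MvPolynomial.continuous_eval p
  have idiff := gdiff.integrable (ν := μ.prod μ) ()
    (by fun_prop : Continuous _).aestronglyMeasurable
  have idir := gdir.integrable (ν := μ.prod μ) ()
    ((continuous_dirDeriv p).pow _).aestronglyMeasurable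
  have hpi : ∀ q : MvPolynomial ι ℝ, Integrable (fun x => MvPolynomial.eval x q) μ :=
    integrable_eval μ
  calc ∫ x, (MvPolynomial.eval x p - ∫ y, MvPolynomial.eval y p ∂μ) ^ (2 * m) ∂μ
      ≤ ∫ x, ∫ y, (MvPolynomial.eval y p - MvPolynomial.eval x p) ^ (2 * m) ∂μ ∂μ := by
        refine integral_mono_of_nonneg (ae_of_all _ fun x => (even_two_mul m).pow_nonneg _)
          idiff.integral_prod_left (ae_of_all _ fun x => ?_)
        -- Jensen in the independent copy `y`: the centring constant is replaced by an independent
        -- value of the polynomial.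
        have h := ConvexOn.map_integral_le (μ := μ)
          (f := fun y => MvPolynomial.eval y p - MvPolynomial.eval x p)
          (g := fun t : ℝ => t ^ (2 * m)) (even_two_mul m).convexOn_pow (by fun_prop)
          isClosed_univ (by simp) ((hpi p).sub (integrable_const _))
          (integrable_of_eval ((p - MvPolynomial.C (MvPolynomial.eval x p)) ^ (2 * m)) fun y => by
            simp)
        rw [integral_sub (hpi p) (integrable_const _)] at h
        simp only [integral_const, probReal_univ, smul_eq_mul, one_mul] at h
        beta_reduce
        rw [← (even_two_mul m).neg_pow, neg_sub]
        exact h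
    _ = ∫ z, (MvPolynomial.eval z.2 p - MvPolynomial.eval z.1 p) ^ (2 * m) ∂(μ.prod μ) :=
        (integral_prod _ idiff).symm
    _ ≤ (Real.pi / 2) ^ (2 * m) * ∫ z, dirDeriv p z ^ (2 * m) ∂(μ.prod μ) :=
        integral_sub_pow_le h0 p m
    _ = (Real.pi / 2) ^ (2 * m) * ∫ x, ∫ y, dirDeriv p (x, y) ^ (2 * m) ∂μ ∂μ := by
        rw [integral_prod _ idir]
    _ ≤ (Real.pi / 2) ^ (2 * m) * ∫ x, evenMoment m * Λ ^ m *
          (∑ j, MvPolynomial.eval x (MvPolynomial.pderiv j p) ^ 2) ^ m ∂μ := by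
        refine mul_le_mul_of_nonneg_left ?_ (by positivity)
        refine integral_mono_of_nonneg
          (ae_of_all _ fun x => (integral_nonneg fun y => (even_two_mul m).pow_nonneg _ :
            0 ≤ ∫ y, dirDeriv p (x, y) ^ (2 * m) ∂μ)) ?_
          (ae_of_all _ fun x => ?_)
        · exact (integrable_of_eval ((∑ j, MvPolynomial.pderiv j p ^ 2) ^ m) fun y => by
            simp).const_mul _
        · simp only [dirDeriv]
          -- For fixed `x` the directional derivative is linear in the independent vector `y`, so
          -- its moment is a power of the covariance form at the gradient.
          rw [integral_linear_pow h0, mul_comm, mul_assoc, ← mul_pow]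
          refine mul_le_mul_of_nonneg_left (pow_le_pow_left₀ ?_ (hΛ _) m) (evenMoment_nonneg m)
          -- Raising the bound by `Λ` to the power `m` needs the covariance form to be nonnegative;
          -- it is a second moment.
          have := integral_linear_pow h0
            (fun j => MvPolynomial.eval x (MvPolynomial.pderiv j p)) 1
          have hpos : 0 < evenMoment 1 := by
            rw [evenMoment_one]; exact one_pos
          have h2 : 0 ≤ (∑ i, ∑ j, (∫ x, x i * x j ∂μ) *
              MvPolynomial.eval x (MvPolynomial.pderiv i p) *
              MvPolynomial.eval x (MvPolynomial.pderiv j p)) ^ 1 * evenMoment 1 := by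
            rw [← this]
            exact integral_nonneg fun y => (even_two_mul 1).pow_nonneg _
          rw [pow_one] at h2
          exact nonneg_of_mul_nonneg_left h2 hpos
    _ = _ := by
        rw [integral_const_mul]
        ring

end Concentration

end TorusNeedlet

namespace TorusNeedlet

/-! ### Linear and bilinear statistics of a Gaussian vector with bounded covariance form -/

section UnitGaussian

open MvPolynomial (X C pderiv)

variable {ι : Type*}

lemma eval_aeval_X (x : ι → ℝ) (i : ι) (q : Polynomial ℝ) :
    MvPolynomial.eval x (Polynomial.aeval (X i) q) = q.eval (x i) := by
  rw [Polynomial.aeval_def, Polynomial.hom_eval₂, MvPolynomial.eval_X, ← Polynomial.eval₂_id]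
  congr 1
  ext r
  simp

lemma pderiv_aeval_X [DecidableEq ι] (i j : ι) (q : Polynomial ℝ) :
    pderiv (R := ℝ) j (Polynomial.aeval (X i) q) =
      if i = j then Polynomial.aeval (X i) q.derivative else 0 := by
  rw [Derivation.map_aeval, MvPolynomial.pderiv_X]
  by_cases h : i = j
  · subst h; simp
  · simp [h]

/-- The covariance matrix of a centred measure. -/
noncomputable def covMat (μ : Measure (ι → ℝ)) (i j : ι) : ℝ := ∫ x, x i * x j ∂μ

lemma covMat_symm (μ : Measure (ι → ℝ)) (i j : ι) : covMat μ i j = covMat μ j i := by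
  simp only [covMat, mul_comm]

variable [Fintype ι]

/-- A centred Gaussian vector with unit variances, whose covariance matrix has zero row sums and
is bounded by `Λ` as a quadratic form. -/
structure IsUnitGaussian (μ : Measure (ι → ℝ)) (Λ : ℝ) : Prop where
  gaussian : IsGaussian μ
  mean : ∫ x, x ∂μ = 0
  unit : ∀ i, covMat μ i i = 1
  row : ∀ i, ∑ j, covMat μ i j = 0
  nonneg : 0 ≤ Λ
  bound : ∀ v : ι → ℝ, ∑ i, ∑ j, covMat μ i j * v i * v j ≤ Λ * ∑ i, v i ^ 2

/-- Expectation of a polynomial under the standard normal law. -/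
noncomputable def gaussMean (q : Polynomial ℝ) : ℝ := ∫ t, q.eval t ∂(gaussianReal 0 1)

/-- The linear statistic `∑_j c_j q(x_j)`. -/
noncomputable def linStat (c : ι → ℝ) (q : Polynomial ℝ) : MvPolynomial ι ℝ :=
  ∑ j, C (c j) * Polynomial.aeval (X j) q

/-- The bilinear statistic `∑_{k,j} R_{kj} p(x_k) q(x_j)`. -/
noncomputable def bilStat (R : ι → ι → ℝ) (p q : Polynomial ℝ) : MvPolynomial ι ℝ :=
  ∑ k, ∑ j, C (R k j) * (Polynomial.aeval (X k) p * Polynomial.aeval (X j) q)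

lemma eval_linStat (x : ι → ℝ) (c : ι → ℝ) (q : Polynomial ℝ) :
    MvPolynomial.eval x (linStat c q) = ∑ j, c j * q.eval (x j) := by
  simp [linStat, eval_aeval_X]

lemma pderiv_linStat (i : ι) (c : ι → ℝ) (q : Polynomial ℝ) :
    pderiv i (linStat c q) = C (c i) * Polynomial.aeval (X i) q.derivative := by
  classical
  simp only [linStat, map_sum, MvPolynomial.pderiv_C_mul, pderiv_aeval_X]
  simp

lemma pderiv_bilStat (R : ι → ι → ℝ) (i : ι) (p q : Polynomial ℝ) :
    pderiv i (bilStat R p q) =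
      Polynomial.aeval (X i) p.derivative * linStat (fun j => R i j) q +
      Polynomial.aeval (X i) q.derivative * linStat (fun k => R k i) p := by
  classical
  have key : ∀ (r : ℝ) (a b : MvPolynomial ι ℝ),
      pderiv i (C r * (a * b)) = C r * (a * pderiv i b) + C r * (b * pderiv i a) := fun r a b => by
    rw [MvPolynomial.pderiv_C_mul, Derivation.leibniz, smul_eq_mul, smul_eq_mul, mul_add]
  simp only [bilStat, map_sum, key, pderiv_aeval_X, Finset.sum_add_distrib]
  rw [add_comm]
  congr 1
  · rw [Finset.sum_eq_single i]
    · simp only [if_true, linStat, Finset.mul_sum]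
      exact Finset.sum_congr rfl fun j _ => by ring
    · intro k _ hk
      simp [hk]
    · simp
  · simp only [mul_ite, mul_zero, Finset.sum_ite_eq', Finset.mem_univ, if_true, linStat,
      Finset.mul_sum]
    exact Finset.sum_congr rfl fun j _ => by ring

namespace IsUnitGaussian

variable {μ : Measure (ι → ℝ)} {Λ : ℝ}

lemma map_coord (h : IsUnitGaussian μ Λ) (i : ι) :
    μ.map (fun x => x i) = gaussianReal 0 1 := by
  have := h.gaussian
  have hlaw := IsGaussian.map_eq_gaussianReal (μ := μ)
    (ContinuousLinearMap.proj (R := ℝ) (φ := fun _ : ι => ℝ) i)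
  have hmean : ∫ y, (ContinuousLinearMap.proj (R := ℝ) (φ := fun _ : ι => ℝ) i) y ∂μ = 0 := by
    rw [ContinuousLinearMap.integral_comp_comm (φ := fun y => y) _
      (IsGaussian.integrable_id (μ := μ)), h.mean, map_zero]
  rw [hmean, variance_of_integral_eq_zero (by fun_prop) hmean] at hlaw
  have hu := h.unit i
  simp only [covMat, ← sq] at hu
  simp only [ContinuousLinearMap.proj_apply, hu, Real.toNNReal_one] at hlaw
  exact hlaw

lemma integral_coord (h : IsUnitGaussian μ Λ) (i : ι) (q : Polynomial ℝ) :
    ∫ x, q.eval (x i) ∂μ = gaussMean q := by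
  rw [gaussMean, ← h.map_coord i, integral_map (measurable_pi_apply i).aemeasurable
    (q.continuous.aestronglyMeasurable)]

lemma integral_linStat (h : IsUnitGaussian μ Λ) (c : ι → ℝ) (q : Polynomial ℝ) :
    ∫ x, MvPolynomial.eval x (linStat c q) ∂μ = (∑ j, c j) * gaussMean q := by
  have := h.gaussian
  simp only [eval_linStat]
  rw [integral_finsetSum _ fun j _ =>
    (integrable_of_eval (Polynomial.aeval (X j) q) fun x => eval_aeval_X x j q).const_mul _]
  simp only [integral_const_mul, h.integral_coord, Finset.sum_mul]

/-- Cauchy–Schwarz between `y_i` and `W = ∑_j R_{ij} y_j`: with `S` the sum in question, `E[y_i W] =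
S`, `E[y_i²] = 1` and `E[W²] ≤ Λ S`, so `S² ≤ Λ S`. In matrix terms, `(R²)_{ii} ≤ ‖R‖ R_{ii}`. -/
lemma sum_sq_row_le (h : IsUnitGaussian μ Λ) (i : ι) : ∑ j, covMat μ i j ^ 2 ≤ Λ := by
  have := h.gaussian
  set S := ∑ j, covMat μ i j ^ 2 with hS
  have hS0 : 0 ≤ S := Finset.sum_nonneg fun j _ => sq_nonneg _
  have hq : ∫ y, (∑ j, covMat μ i j * y j) ^ 2 ∂μ ≤ Λ * S := by
    have h1 := integral_linear_pow h.mean (fun j => covMat μ i j) 1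
    rw [evenMoment_one, mul_one, pow_one, mul_one] at h1
    rw [h1]
    exact h.bound _
  have hc : ∫ y, y i * (∑ j, covMat μ i j * y j) ∂μ = S := by
    have h1 : ∀ y : ι → ℝ, y i * (∑ j, covMat μ i j * y j) =
        ∑ j, covMat μ i j * (y i * y j) := fun y => by
      rw [Finset.mul_sum]
      exact Finset.sum_congr rfl fun j _ => by ring
    simp only [h1]
    rw [integral_finsetSum _ fun j _ => (integrable_of_eval (X i * X j) fun x => by
      simp).const_mul _]
    refine Finset.sum_congr rfl fun j _ => ?_
    rw [integral_const_mul, sq]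
    rfl
  have h0 : 0 ≤ ∫ y, (S * y i - ∑ j, covMat μ i j * y j) ^ 2 ∂μ :=
    integral_nonneg fun y => sq_nonneg _
  have hexp : ∀ y : ι → ℝ, (S * y i - ∑ j, covMat μ i j * y j) ^ 2 =
      S ^ 2 * (y i * y i) - 2 * S * (y i * ∑ j, covMat μ i j * y j) +
        (∑ j, covMat μ i j * y j) ^ 2 := fun y => by ring
  simp only [hexp] at h0
  have hW : ∀ x : ι → ℝ, MvPolynomial.eval x (∑ j, C (covMat μ i j) * X j) =
      ∑ j, covMat μ i j * x j := fun x => by simp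
  rw [integral_add, integral_sub, integral_const_mul, integral_const_mul, hc] at h0
  · have hu := h.unit i
    simp only [covMat] at hu
    rw [hu] at h0
    rcases hS0.eq_or_lt with h1 | h1
    · rw [← h1]; exact h.nonneg
    · by_contra hlt
      push Not at hlt
      nlinarith
  · exact (integrable_of_eval (X i * X i) fun x => by simp).const_mul _
  · exact (integrable_of_eval (X i * ∑ j, C (covMat μ i j) * X j) fun x => by
      rw [map_mul, hW, MvPolynomial.eval_X]).const_mul _
  · exact ((integrable_of_eval (X i * X i) fun x => by simp).const_mul _).sub
      ((integrable_of_eval (X i * ∑ j, C (covMat μ i j) * X j) fun x => by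
        rw [map_mul, hW, MvPolynomial.eval_X]).const_mul _)
  · exact integrable_of_eval ((∑ j, C (covMat μ i j) * X j) ^ 2) fun x => by
      rw [map_pow, hW]

end IsUnitGaussian

/-- The power mean inequality with weights proportional to `w`. If the total weight is zero, all
weights vanish and both sides are zero. -/
lemma sum_mul_pow_le {w z : ι → ℝ} (hw : ∀ i, 0 ≤ w i) (hz : ∀ i, 0 ≤ z i) {m : ℕ} (hm : m ≠ 0) :
    (∑ i, w i * z i) ^ m ≤ (∑ i, w i) ^ m * ∑ i, w i / (∑ i, w i) * z i ^ m := by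
  rcases (Finset.sum_nonneg fun i (_ : i ∈ Finset.univ) => hw i).eq_or_lt with h | h
  · have h0 : ∀ i, w i = 0 := fun i =>
      (Finset.sum_eq_zero_iff_of_nonneg fun i _ => hw i).mp h.symm i (Finset.mem_univ i)
    simp [h0, hm]
  · have h1 := Real.pow_arith_mean_le_arith_mean_pow Finset.univ (fun i => w i / ∑ i, w i) z
      (fun i _ => div_nonneg (hw i) h.le)
      (by rw [← Finset.sum_div, div_self h.ne']) (fun i _ => hz i) m
    calc (∑ i, w i * z i) ^ m = (∑ i, w i) ^ m * (∑ i, w i / (∑ i, w i) * z i) ^ m := by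
          rw [← mul_pow, Finset.mul_sum]
          congr 1
          exact Finset.sum_congr rfl fun i _ => by field_simp
      _ ≤ _ := by gcongr

/-- The constant in the concentration inequality for moments of order `2 m`. -/
noncomputable def concConst (m : ℕ) (Λ : ℝ) : ℝ :=
  (Real.pi / 2) ^ (2 * m) * evenMoment m * Λ ^ m

lemma concConst_nonneg (m : ℕ) {Λ : ℝ} (h : 0 ≤ Λ) : 0 ≤ concConst m Λ := by
  have := evenMoment_nonneg m
  unfold concConst
  positivity

namespace IsUnitGaussian

variable {μ : Measure (ι → ℝ)} {Λ : ℝ}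

/-- The squared gradient is `∑ c_j² q'(x_j)²`; convexity with weights `c_j²` reduces its `m`-th
moment to a single standard normal coordinate. -/
lemma integral_linStat_sub_pow_le (h : IsUnitGaussian μ Λ) (c : ι → ℝ) (q : Polynomial ℝ)
    {m : ℕ} (hm : m ≠ 0) :
    ∫ x, (MvPolynomial.eval x (linStat c q) - (∑ j, c j) * gaussMean q) ^ (2 * m) ∂μ ≤
      concConst m Λ * ((∑ j, c j ^ 2) ^ m * gaussMean (q.derivative ^ (2 * m))) := by
  have := h.gaussian
  have h1 := integral_sub_integral_pow_le h.mean h.bound (linStat c q) m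
  rw [h.integral_linStat] at h1
  refine h1.trans (mul_le_mul_of_nonneg_left ?_ (concConst_nonneg m h.nonneg))
  have hi : ∀ j, Integrable (fun x : ι → ℝ => (q.derivative.eval (x j) ^ 2) ^ m) μ := fun j =>
    integrable_of_eval ((Polynomial.aeval (X j) q.derivative ^ 2) ^ m) fun x => by
      rw [map_pow, map_pow, eval_aeval_X]
  have hmom : ∀ j, ∫ x, (q.derivative.eval (x j) ^ 2) ^ m ∂μ =
      gaussMean (q.derivative ^ (2 * m)) := fun j => by
    rw [← h.integral_coord j]
    simp only [Polynomial.eval_pow, pow_mul]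
  calc ∫ x, (∑ j, MvPolynomial.eval x (pderiv j (linStat c q)) ^ 2) ^ m ∂μ
      ≤ ∫ x, (∑ j, c j ^ 2) ^ m * ∑ j, c j ^ 2 / (∑ j, c j ^ 2) *
          (q.derivative.eval (x j) ^ 2) ^ m ∂μ := by
        refine integral_mono_of_nonneg (ae_of_all _ fun x =>
          pow_nonneg (Finset.sum_nonneg fun j _ => sq_nonneg _) m)
          ((integrable_finsetSum _ fun j _ => (hi j).const_mul _).const_mul _)
          (ae_of_all _ fun x => ?_)
        simp only [pderiv_linStat, map_mul, MvPolynomial.eval_C, eval_aeval_X, mul_pow]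
        exact sum_mul_pow_le (fun i => sq_nonneg _) (fun i => sq_nonneg _) hm
    _ = (∑ j, c j ^ 2) ^ m * ((∑ j, c j ^ 2 / (∑ j, c j ^ 2)) *
          gaussMean (q.derivative ^ (2 * m))) := by
        rw [integral_const_mul, integral_finsetSum _ fun j _ => (hi j).const_mul _]
        simp only [integral_const_mul, hmom, Finset.sum_mul]
    _ ≤ _ := by
        have hg : 0 ≤ gaussMean (q.derivative ^ (2 * m)) := integral_nonneg fun t => by
          simpa using (even_two_mul m).pow_nonneg _
        -- The normalized weights sum to `1`, or to `0` when every `c_j` vanishes.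
        rw [← Finset.sum_div]
        refine mul_le_mul_of_nonneg_left (mul_le_of_le_one_left hg (div_self_le_one _))
          (pow_nonneg (Finset.sum_nonneg fun j _ => sq_nonneg _) m)

end IsUnitGaussian

/-- A bound for the variance, per coordinate, of a bilinear statistic. -/
noncomputable def bilConst (Λ : ℝ) (p q : Polynomial ℝ) : ℝ :=
  concConst 1 Λ * ((1 + concConst 2 Λ * Λ ^ 2) *
    (gaussMean (p.derivative ^ 4) + gaussMean (q.derivative ^ 4)))

namespace IsUnitGaussian

variable {μ : Measure (ι → ℝ)} {Λ : ℝ}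

/-- A row of the covariance matrix, used as coefficients, yields a statistic that is already centred
because the row sums to zero, and whose coefficients have square sum at most `Λ`. The bound is
therefore independent of the dimension. -/
lemma integral_row_pow_four_le (h : IsUnitGaussian μ Λ) (i : ι) (q : Polynomial ℝ) :
    ∫ x, MvPolynomial.eval x (linStat (fun j => covMat μ i j) q) ^ 4 ∂μ ≤
      concConst 2 Λ * Λ ^ 2 * gaussMean (q.derivative ^ 4) := by
  have h1 := h.integral_linStat_sub_pow_le (fun j => covMat μ i j) q (m := 2) two_ne_zero
  simp only [h.row, zero_mul, sub_zero] at h1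
  refine h1.trans ?_
  rw [mul_assoc]
  refine mul_le_mul_of_nonneg_left (mul_le_mul_of_nonneg_right (pow_le_pow_left₀
    (Finset.sum_nonneg fun j _ => sq_nonneg _) (h.sum_sq_row_le i) 2) ?_)
    (concConst_nonneg 2 h.nonneg)
  exact integral_nonneg fun t => by simpa using (even_two_mul 2).pow_nonneg _

/-- The `i`-th partial derivative pairs `p'(x_i)` and `q'(x_i)` with row statistics whose fourth
moments are bounded independently of the dimension. Concentration with `m = 1` then gives a variance
linear in the dimension, although the double sum has quadratically many terms. -/
lemma variance_bilStat_le (h : IsUnitGaussian μ Λ) (p q : Polynomial ℝ) :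
    ∫ x, (MvPolynomial.eval x (bilStat (covMat μ) p q) -
      ∫ y, MvPolynomial.eval y (bilStat (covMat μ) p q) ∂μ) ^ 2 ∂μ ≤
      Fintype.card ι * bilConst Λ p q := by
  have := h.gaussian
  have h1 := integral_sub_integral_pow_le h.mean h.bound (bilStat (covMat μ) p q) 1
  refine h1.trans ?_
  set W : Polynomial ℝ → ι → MvPolynomial ι ℝ := fun q i => linStat (fun j => covMat μ i j) q
  have hi : ∀ r : MvPolynomial ι ℝ, Integrable (fun x => MvPolynomial.eval x r ^ 4) μ := fun r =>
    integrable_of_eval (r ^ 4) fun x => by rw [map_pow]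
  have hW : ∀ q i, ∫ x, MvPolynomial.eval x (W q i) ^ 4 ∂μ ≤
      concConst 2 Λ * Λ ^ 2 * gaussMean (q.derivative ^ 4) := fun q i =>
    h.integral_row_pow_four_le i q
  have hD : ∀ (q : Polynomial ℝ) i,
      ∫ x, MvPolynomial.eval x (Polynomial.aeval (X i) q.derivative) ^ 4 ∂μ =
      gaussMean (q.derivative ^ 4) := fun q i => by
    rw [← h.integral_coord i]
    simp only [Polynomial.eval_pow, eval_aeval_X]
  unfold bilConst
  rw [mul_left_comm]
  refine mul_le_mul_of_nonneg_left ?_ (concConst_nonneg 1 h.nonneg)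
  have hpt : ∀ x i, MvPolynomial.eval x (pderiv i (bilStat (covMat μ) p q)) ^ 2 ≤
      (MvPolynomial.eval x (Polynomial.aeval (X i) p.derivative) ^ 4 +
        MvPolynomial.eval x (W q i) ^ 4) +
      (MvPolynomial.eval x (Polynomial.aeval (X i) q.derivative) ^ 4 +
        MvPolynomial.eval x (W p i) ^ 4) := by
    intro x i
    rw [pderiv_bilStat]
    have : linStat (fun k => covMat μ k i) p = W p i := by
      simp only [W]
      congr 1
      ext k
      exact covMat_symm μ k i
    rw [this]
    simp only [map_add, map_mul]
    set a := MvPolynomial.eval x (Polynomial.aeval (X i) p.derivative)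
    set b := MvPolynomial.eval x (W q i)
    set c := MvPolynomial.eval x (Polynomial.aeval (X i) q.derivative)
    set d := MvPolynomial.eval x (W p i)
    change (a * b + c * d) ^ 2 ≤ _
    -- `(ab + cd)² ≤ 2a²b² + 2c²d² ≤ a⁴ + b⁴ + c⁴ + d⁴`.
    nlinarith [sq_nonneg (a * b - c * d), sq_nonneg (a ^ 2 - b ^ 2), sq_nonneg (c ^ 2 - d ^ 2)]
  have hI₂ : ∀ r s : MvPolynomial ι ℝ, Integrable (fun x =>
      MvPolynomial.eval x r ^ 4 + MvPolynomial.eval x s ^ 4) μ := fun r s => (hi r).add (hi s)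
  have hI : ∀ i, Integrable (fun x =>
      (MvPolynomial.eval x (Polynomial.aeval (X i) p.derivative) ^ 4 +
        MvPolynomial.eval x (W q i) ^ 4) +
      (MvPolynomial.eval x (Polynomial.aeval (X i) q.derivative) ^ 4 +
        MvPolynomial.eval x (W p i) ^ 4)) μ := fun i =>
    (hI₂ _ _).add (hI₂ _ _)
  calc ∫ x, (∑ j, MvPolynomial.eval x (pderiv j (bilStat (covMat μ) p q)) ^ 2) ^ 1 ∂μ
      ≤ ∫ x, ∑ i, ((MvPolynomial.eval x (Polynomial.aeval (X i) p.derivative) ^ 4 +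
        MvPolynomial.eval x (W q i) ^ 4) +
      (MvPolynomial.eval x (Polynomial.aeval (X i) q.derivative) ^ 4 +
        MvPolynomial.eval x (W p i) ^ 4)) ∂μ := by
        refine integral_mono_of_nonneg (ae_of_all _ fun x =>
          pow_nonneg (Finset.sum_nonneg fun j _ => sq_nonneg _) 1)
          (integrable_finsetSum _ fun i _ => hI i) (ae_of_all _ fun x => ?_)
        beta_reduce
        rw [pow_one]
        exact Finset.sum_le_sum fun i _ => hpt x i
    _ ≤ ∑ i : ι, (1 + concConst 2 Λ * Λ ^ 2) *
        (gaussMean (p.derivative ^ 4) + gaussMean (q.derivative ^ 4)) := by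
        rw [integral_finsetSum _ fun i _ => hI i]
        refine Finset.sum_le_sum fun i _ => ?_
        rw [integral_add (hI₂ _ _) (hI₂ _ _), integral_add (hi _) (hi _),
          integral_add (hi _) (hi _), hD, hD]
        linarith [hW p i, hW q i]
    _ = _ := by simp

/-- Integration by parts against a function of one coordinate. -/
lemma integral_coord_mul (h : IsUnitGaussian μ Λ) (k : ι) (q : Polynomial ℝ)
    (p : MvPolynomial ι ℝ) :
    ∫ x, x k * (q.eval (x k) * MvPolynomial.eval x p) ∂μ =
      ∫ x, q.derivative.eval (x k) * MvPolynomial.eval x p ∂μ +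
      ∑ j, covMat μ k j * ∫ x, q.eval (x k) * MvPolynomial.eval x (pderiv j p) ∂μ := by
  classical
  have := h.gaussian
  have h1 := integral_coord_mul_eval h.mean k (Polynomial.aeval (X k) q * p)
  simp only [map_mul, eval_aeval_X] at h1
  rw [h1]
  have hI : ∀ (r : Polynomial ℝ) (s : MvPolynomial ι ℝ),
      Integrable (fun x => r.eval (x k) * MvPolynomial.eval x s) μ := fun r s =>
    integrable_of_eval (Polynomial.aeval (X k) r * s) fun x => by rw [map_mul, eval_aeval_X]
  have h2 : ∀ j, ∫ x, MvPolynomial.eval x (pderiv j (Polynomial.aeval (X k) q * p)) ∂μ =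
      ∫ x, q.eval (x k) * MvPolynomial.eval x (pderiv j p) ∂μ +
      (if k = j then ∫ x, q.derivative.eval (x k) * MvPolynomial.eval x p ∂μ else 0) := by
    intro j
    simp only [Derivation.leibniz, pderiv_aeval_X, smul_eq_mul, map_add, map_mul, eval_aeval_X]
    by_cases hkj : k = j
    · simp only [hkj, if_true, eval_aeval_X]
      subst hkj
      rw [← integral_add (hI _ _) (hI _ _)]
      exact integral_congr_ae (ae_of_all _ fun x => by ring)
    · simp [hkj]
  simp only [h2, mul_add, Finset.sum_add_distrib, mul_ite, mul_zero, Finset.sum_ite_eq,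
    Finset.mem_univ, if_true]
  have hu := h.unit k
  simp only [covMat] at hu
  rw [hu, one_mul, add_comm]
  rfl

end IsUnitGaussian

end UnitGaussian

end TorusNeedlet

namespace TorusNeedlet

/-! ### Approximate Gaussian moment recursions and their limits -/

section MomentConvergence

open MvPolynomial (X C pderiv)

lemma normalMoment_zero : normalMoment 0 = 1 := by simp [normalMoment]

lemma normalMoment_one : normalMoment 1 = 0 := by simp [normalMoment]

lemma normalMoment_add_two (p : ℕ) : normalMoment (p + 2) = (p + 1) * normalMoment p := by
  unfold normalMoment
  by_cases h : Even p
  · have h2 : Even (p + 2) := h.add even_two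
    rw [if_pos h, if_pos h2]
    rcases p with _ | p
    · simp
    · rw [show p + 1 + 2 - 1 = p + 2 from rfl, Nat.doubleFactorial_add_two,
        show p + 1 - 1 = p from rfl]
      push_cast
      ring
  · have h2 : ¬Even (p + 2) := by simpa [Nat.even_add] using h
    rw [if_neg h, if_neg h2, mul_zero]

lemma pderiv_pow_mul_pow {ι : Type*} (j : ι) (s u : MvPolynomial ι ℝ) (a b : ℕ) :
    pderiv j (s ^ a * u ^ b) = C (a : ℝ) * (s ^ (a - 1) * u ^ b * pderiv j s) +
      C (b : ℝ) * (s ^ a * u ^ (b - 1) * pderiv j u) := by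
  rw [Derivation.leibniz, Derivation.leibniz_pow, Derivation.leibniz_pow]
  simp only [smul_eq_mul, nsmul_eq_mul, map_natCast]
  ring

/-- Expectation of a polynomial. -/
noncomputable def polyMean {ι : Type*} (μ : Measure (ι → ℝ)) (p : MvPolynomial ι ℝ) : ℝ :=
  ∫ x, MvPolynomial.eval x p ∂μ

section PolyMean

variable {ι : Type*} [Fintype ι] (μ : Measure (ι → ℝ)) [IsGaussian μ]

lemma polyMean_add (p q : MvPolynomial ι ℝ) : polyMean μ (p + q) = polyMean μ p + polyMean μ q := by
  simp only [polyMean, map_add]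
  exact integral_add (integrable_eval μ p) (integrable_eval μ q)

lemma polyMean_sub (p q : MvPolynomial ι ℝ) : polyMean μ (p - q) = polyMean μ p - polyMean μ q := by
  simp only [polyMean, map_sub]
  exact integral_sub (integrable_eval μ p) (integrable_eval μ q)

lemma polyMean_sum {κ : Type*} (t : Finset κ) (p : κ → MvPolynomial ι ℝ) :
    polyMean μ (∑ k ∈ t, p k) = ∑ k ∈ t, polyMean μ (p k) := by
  simp only [polyMean, map_sum]
  exact integral_finsetSum _ fun k _ => integrable_eval μ (p k)

omit [Fintype ι] [IsGaussian μ] in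
lemma polyMean_C_mul (c : ℝ) (p : MvPolynomial ι ℝ) :
    polyMean μ (C c * p) = c * polyMean μ p := by
  simp only [polyMean, map_mul, MvPolynomial.eval_C, integral_const_mul]

omit [Fintype ι] [IsGaussian μ] in
lemma polyMean_C [IsProbabilityMeasure μ] (c : ℝ) :
    polyMean μ (C c : MvPolynomial ι ℝ) = c := by
  simp [polyMean]

omit [Fintype ι] [IsGaussian μ] in
lemma polyMean_even_pow_nonneg (p : MvPolynomial ι ℝ) {m : ℕ} (hm : Even m) :
    0 ≤ polyMean μ (p ^ m) :=
  integral_nonneg fun x => by simpa using hm.pow_nonneg _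

lemma polyMean_mono {p q : MvPolynomial ι ℝ}
    (h : ∀ x, MvPolynomial.eval x p ≤ MvPolynomial.eval x q) : polyMean μ p ≤ polyMean μ q :=
  integral_mono (integrable_eval μ p) (integrable_eval μ q) h

/-- Cauchy–Schwarz, from the discriminant of the nonnegative quadratic `t ↦ E[(t p + q)²]`. -/
lemma polyMean_mul_sq_le (p q : MvPolynomial ι ℝ) :
    polyMean μ (p * q) ^ 2 ≤ polyMean μ (p ^ 2) * polyMean μ (q ^ 2) := by
  have h : ∀ t : ℝ, 0 ≤ polyMean μ (p ^ 2) * (t * t) + 2 * polyMean μ (p * q) * t +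
      polyMean μ (q ^ 2) := fun t => by
    have h0 := polyMean_even_pow_nonneg μ (C t * p + q) even_two
    have : (C t * p + q) ^ 2 = C (t * t) * p ^ 2 + C (2 * t) * (p * q) + q ^ 2 := by
      simp only [map_mul, map_ofNat]
      ring
    rw [this, polyMean_add, polyMean_add, polyMean_C_mul, polyMean_C_mul] at h0
    linarith
  have := discrim_le_zero h
  unfold discrim at this
  nlinarith

end PolyMean

section Abstract

variable {ι : ℕ → Type*} [∀ n, Fintype (ι n)] {μ : ∀ n, Measure (ι n → ℝ)}
  [∀ n, IsGaussian (μ n)]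

/-- This discards the error terms of the recursion: by Cauchy–Schwarz, a factor tending to zero in
`L²` kills any factor bounded in `L²`. -/
lemma tendsto_polyMean_mul {Z Q : ∀ n, MvPolynomial (ι n) ℝ}
    (hZ : Tendsto (fun n => polyMean (μ n) (Z n ^ 2)) atTop (𝓝 0))
    (hQ : ∃ K, ∀ n, polyMean (μ n) (Q n ^ 2) ≤ K) :
    Tendsto (fun n => polyMean (μ n) (Z n * Q n)) atTop (𝓝 0) := by
  obtain ⟨K, hK⟩ := hQ
  have h : Tendsto (fun n => polyMean (μ n) (Z n * Q n) ^ 2) atTop (𝓝 0) := by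
    refine squeeze_zero (fun n => sq_nonneg _) (fun n => (polyMean_mul_sq_le _ _ _).trans
      (mul_le_mul_of_nonneg_left (hK n) (polyMean_even_pow_nonneg _ _ even_two)))
      (by simpa using hZ.mul_const K)
  have h2 := (Real.continuous_sqrt.tendsto 0).comp h
  simp only [Real.sqrt_zero, Function.comp_def, Real.sqrt_sq_eq_abs] at h2
  exact (tendsto_zero_iff_abs_tendsto_zero _).mpr h2

lemma tendsto_polyMean_mul_of_sub {Z Q : ∀ n, MvPolynomial (ι n) ℝ} {l : ℝ}
    (hZ : Tendsto (fun n => polyMean (μ n) ((Z n - 1) ^ 2)) atTop (𝓝 0))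
    (hQ : ∃ K, ∀ n, polyMean (μ n) (Q n ^ 2) ≤ K)
    (hl : Tendsto (fun n => polyMean (μ n) (Q n)) atTop (𝓝 l)) :
    Tendsto (fun n => polyMean (μ n) (Z n * Q n)) atTop (𝓝 l) := by
  have h := (tendsto_polyMean_mul hZ hQ).add hl
  rw [zero_add] at h
  refine h.congr fun n => ?_
  rw [← polyMean_add]
  congr 1
  ring

/-- Joint moments of two sequences of polynomials that satisfy an approximate Gaussian recursion
converge to the moments of two independent standard normal variables. -/
theorem tendsto_polyMean_pow {s u A B D : ∀ n, MvPolynomial (ι n) ℝ} {δ : ℕ → ℝ}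
    (hs : ∀ (n a b : ℕ), polyMean (μ n) (s n ^ (a + 1) * u n ^ b) =
      a * polyMean (μ n) (A n * (s n ^ (a - 1) * u n ^ b)) +
      b * polyMean (μ n) (B n * (s n ^ a * u n ^ (b - 1))))
    (hu : ∀ (n b : ℕ), polyMean (μ n) (u n ^ (b + 1)) =
      b * polyMean (μ n) (D n * u n ^ (b - 1)) + δ n * polyMean (μ n) (u n ^ b))
    (ms : ∀ m, ∃ K, ∀ n, polyMean (μ n) (s n ^ (2 * m)) ≤ K)
    (mu : ∀ m, ∃ K, ∀ n, polyMean (μ n) (u n ^ (2 * m)) ≤ K)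
    (hA : Tendsto (fun n => polyMean (μ n) ((A n - 1) ^ 2)) atTop (𝓝 0))
    (hB : Tendsto (fun n => polyMean (μ n) (B n ^ 2)) atTop (𝓝 0))
    (hD : Tendsto (fun n => polyMean (μ n) ((D n - 1) ^ 2)) atTop (𝓝 0))
    (hδ : Tendsto δ atTop (𝓝 0)) (a b : ℕ) :
    Tendsto (fun n => polyMean (μ n) (s n ^ a * u n ^ b)) atTop
      (𝓝 (normalMoment a * normalMoment b)) := by
  -- All mixed monomials are bounded in `L²`, so the random coefficients of the recursion may be
  -- replaced by their limits.
  have hbd : ∀ a b, ∃ K, ∀ n, polyMean (μ n) ((s n ^ a * u n ^ b) ^ 2) ≤ K := by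
    intro a b
    obtain ⟨K, hK⟩ := ms (2 * a)
    obtain ⟨L, hL⟩ := mu (2 * b)
    refine ⟨K + L, fun n => ?_⟩
    refine le_trans ?_ (add_le_add (hK n) (hL n))
    rw [← polyMean_add]
    refine polyMean_mono _ fun x => ?_
    simp only [map_pow, map_mul, map_add]
    generalize MvPolynomial.eval x (s n) = y
    generalize MvPolynomial.eval x (u n) = z
    have e1 : y ^ (2 * (2 * a)) = (y ^ a) ^ 4 := by rw [← pow_mul]; congr 1; ring
    have e2 : z ^ (2 * (2 * b)) = (z ^ b) ^ 4 := by rw [← pow_mul]; congr 1; ring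
    rw [e1, e2]
    nlinarith [sq_nonneg ((y ^ a) ^ 2 - (z ^ b) ^ 2), sq_nonneg ((y ^ a) ^ 2),
      sq_nonneg ((z ^ b) ^ 2)]
  have hub : ∀ b, ∃ K, ∀ n, polyMean (μ n) ((u n ^ b) ^ 2) ≤ K := fun b => by
    simpa using hbd 0 b
  -- The recursion reaches back two orders, so two consecutive orders are carried through the
  -- induction. Where an exponent `b - 1` or `a - 1` is truncated at zero, its prefactor vanishes.
  have hu0 : ∀ b, Tendsto (fun n => polyMean (μ n) (u n ^ b)) atTop (𝓝 (normalMoment b)) ∧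
      Tendsto (fun n => polyMean (μ n) (u n ^ (b + 1))) atTop (𝓝 (normalMoment (b + 1))) := by
    intro b
    induction b with
    | zero =>
      have h0 : ∀ n, polyMean (μ n) (1 : MvPolynomial (ι n) ℝ) = 1 := fun n => by
        simpa using polyMean_C (μ n) 1
      constructor
      · simp only [pow_zero, h0, normalMoment_zero]
        exact tendsto_const_nhds
      · simp only [hu, Nat.cast_zero, zero_mul, zero_add, pow_zero, h0, mul_one, normalMoment_one]
        exact hδ
    | succ b ih =>
      refine ⟨ih.2, ?_⟩
      have h1 := tendsto_polyMean_mul_of_sub hD (hub b) ih.1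
      have h2 := (h1.const_mul ((b : ℝ) + 1)).add (hδ.mul ih.2)
      rw [zero_mul, add_zero, ← normalMoment_add_two] at h2
      refine h2.congr fun n => ?_
      rw [hu n (b + 1)]
      push_cast
      rfl
  have key : ∀ a, (∀ b, Tendsto (fun n => polyMean (μ n) (s n ^ a * u n ^ b)) atTop
      (𝓝 (normalMoment a * normalMoment b))) ∧
      (∀ b, Tendsto (fun n => polyMean (μ n) (s n ^ (a + 1) * u n ^ b)) atTop
      (𝓝 (normalMoment (a + 1) * normalMoment b))) := by
    intro a
    induction a with
    | zero =>
      refine ⟨fun b => by simpa [normalMoment_zero] using (hu0 b).1, fun b => ?_⟩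
      have h1 := (tendsto_polyMean_mul hB (hbd 0 (b - 1))).const_mul (b : ℝ)
      rw [mul_zero] at h1
      rw [normalMoment_one, zero_mul]
      refine h1.congr fun n => ?_
      rw [hs n 0 b]
      simp
    | succ a ih =>
      refine ⟨ih.2, fun b => ?_⟩
      have h1 := (tendsto_polyMean_mul hB (hbd (a + 1) (b - 1))).const_mul (b : ℝ)
      have h2 := (tendsto_polyMean_mul_of_sub hA (hbd a b) (ih.1 b)).const_mul ((a : ℝ) + 1)
      have h3 := h2.add h1
      rw [mul_zero, add_zero, ← mul_assoc, ← normalMoment_add_two] at h3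
      refine h3.congr fun n => ?_
      rw [hs n (a + 1) b]
      push_cast
      rfl
  exact (key a).1 b

end Abstract

/-- Mixed moments of two independent standard normal variables. -/
theorem integral_pow_mul_pow_stdGaussian (a b : ℕ) :
    ∫ x : EuclideanSpace ℝ (Fin 2), x 0 ^ a * x 1 ^ b ∂(stdGaussian (EuclideanSpace ℝ (Fin 2))) =
      normalMoment a * normalMoment b := by
  set μ : Measure (Fin 2 → ℝ) := (stdGaussian (EuclideanSpace ℝ (Fin 2))).map
    (EuclideanSpace.equiv (Fin 2) ℝ) with hμ
  have hg : IsGaussian μ := isGaussian_map_equiv _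
  have h0 : ∫ x, x ∂μ = 0 := by
    rw [hμ, integral_map (by fun_prop) (by fun_prop)]
    rw [ContinuousLinearEquiv.integral_comp_comm (φ := fun y => y), integral_id_stdGaussian,
      map_zero]
  have hcov : ∀ i j, ∫ x, x i * x j ∂μ = if i = j then 1 else 0 := by
    intro i j
    have h1 : μ = Measure.pi (fun _ : Fin 2 => gaussianReal 0 1) := by
      rw [hμ, ← map_pi_eq_stdGaussian, Measure.map_map (by fun_prop) (by fun_prop)]
      exact Measure.map_id
    rw [h1]
    have hind := iIndepFun_pi (μ := fun _ : Fin 2 => gaussianReal 0 1) (X := fun _ x => x)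
      (fun _ => by fun_prop)
    have hm : ∀ k, ∫ x : Fin 2 → ℝ, x k ∂(Measure.pi (fun _ : Fin 2 => gaussianReal 0 1)) = 0 := by
      intro k
      rw [integral_comp_eval (μ := fun _ : Fin 2 => gaussianReal 0 1) (f := fun t : ℝ => t)
        (by fun_prop)]
      simp
    by_cases hij : i = j
    · subst hij
      rw [if_pos rfl, integral_comp_eval (μ := fun _ : Fin 2 => gaussianReal 0 1)
        (f := fun t : ℝ => t * t) (by fun_prop)]
      have := evenMoment_one
      simpa [evenMoment, sq] using this
    · rw [if_neg hij]
      have := (hind.indepFun hij).integral_fun_mul_eq_mul_integral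
        (measurable_pi_apply i).aestronglyMeasurable (measurable_pi_apply j).aestronglyMeasurable
      rw [this, hm, zero_mul]
  have ibp : ∀ i (p : MvPolynomial (Fin 2) ℝ), polyMean μ (X i * p) = polyMean μ (pderiv i p) := by
    intro i p
    have := integral_coord_mul_eval h0 i p
    simp only [hcov, ite_mul, one_mul, zero_mul, Finset.sum_ite_eq, Finset.mem_univ, if_true]
      at this
    simpa [polyMean] using this
  -- For a constant sequence with coordinates `X 0`, `X 1` the recursion holds exactly, so the
  -- constant moment equals the limit supplied by the general result.
  have hc := tendsto_polyMean_pow (ι := fun _ => Fin 2) (μ := fun _ => μ) (s := fun _ => X 0)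
    (u := fun _ => X 1) (A := fun _ => 1) (B := fun _ => 0) (D := fun _ => 1) (δ := fun _ => 0)
    (fun n a b => by
      rw [pow_succ', mul_assoc, ibp, pderiv_pow_mul_pow]
      simp [MvPolynomial.pderiv_X, polyMean, integral_const_mul])
    (fun n b => by
      have := pderiv_pow_mul_pow (1 : Fin 2) (X 0) (X 1) 0 b
      simp only [pow_zero, one_mul, Nat.cast_zero, map_zero, zero_mul, zero_add] at this
      rw [pow_succ', ibp, this]
      simp [polyMean, integral_const_mul])
    (fun m => ⟨_, fun n => le_rfl⟩) (fun m => ⟨_, fun n => le_rfl⟩)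
    (by simp [polyMean]) (by simp [polyMean]) (by simp [polyMean]) tendsto_const_nhds a b
  have := tendsto_nhds_unique hc tendsto_const_nhds
  rw [this, polyMean, hμ, integral_map (by fun_prop)
    (MvPolynomial.continuous_eval _).aestronglyMeasurable]
  simp

end MomentConvergence

end TorusNeedlet

namespace TorusNeedlet

/-! ### Sums of cubes and of centred fourth powers -/

section PowerSums

open MvPolynomial (X C pderiv)

variable {ι : Type*} [Fintype ι]

lemma sum_linStat_mul (R : ι → ι → ℝ) (p q : Polynomial ℝ) :
    ∑ j, linStat (fun k => R j k) q * Polynomial.aeval (X j) p = bilStat R p q := by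
  simp only [linStat, bilStat, Finset.sum_mul]
  exact Finset.sum_congr rfl fun j _ => Finset.sum_congr rfl fun k _ => by ring

namespace IsUnitGaussian

variable {μ : Measure (ι → ℝ)} {Λ : ℝ}

/-- Integration by parts for one monomial in two coordinates; the low-order joint moments below all
follow by iterating it. -/
lemma integral_pow_succ_mul_pow (h : IsUnitGaussian μ Λ) (k j : ι) (a b : ℕ) :
    ∫ x, x k ^ (a + 1) * x j ^ b ∂μ = a * ∫ x, x k ^ (a - 1) * x j ^ b ∂μ +
      covMat μ k j * (b * ∫ x, x k ^ a * x j ^ (b - 1) ∂μ) := by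
  classical
  have h1 := h.integral_coord_mul k (Polynomial.X ^ a) (X j ^ b)
  simp only [Polynomial.eval_pow, Polynomial.eval_X, map_pow, MvPolynomial.eval_X,
    Polynomial.derivative_X_pow, Derivation.leibniz_pow, MvPolynomial.pderiv_X, Polynomial.eval_mul,
    Polynomial.eval_natCast, smul_eq_mul, nsmul_eq_mul, map_mul, map_natCast] at h1
  rw [Finset.sum_eq_single j] at h1
  · simp only [Pi.single_eq_same, map_one, mul_one] at h1
    calc ∫ x, x k ^ (a + 1) * x j ^ b ∂μ = ∫ x, x k * (x k ^ a * x j ^ b) ∂μ :=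
          integral_congr_ae (ae_of_all _ fun x => by ring)
      _ = _ := by
          rw [h1, ← integral_const_mul (a : ℝ), ← integral_const_mul (b : ℝ)]
          congr 1
          · exact integral_congr_ae (ae_of_all _ fun x => by ring)
          · congr 1
            exact integral_congr_ae (ae_of_all _ fun x => by ring)
  · intro i _ hi
    simp [hi]
  · simp

lemma integral_pow_succ (h : IsUnitGaussian μ Λ) (k : ι) (a : ℕ) :
    ∫ x, x k ^ (a + 1) ∂μ = a * ∫ x, x k ^ (a - 1) ∂μ := by
  simpa using h.integral_pow_succ_mul_pow k k a 0

lemma integral_one' (h : IsUnitGaussian μ Λ) : ∫ _, (1 : ℝ) ∂μ = 1 := by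
  have := h.gaussian
  simp

lemma integral_pow_one (h : IsUnitGaussian μ Λ) (k : ι) : ∫ x, x k ∂μ = 0 := by
  simpa using h.integral_pow_succ k 0

lemma integral_pow_two (h : IsUnitGaussian μ Λ) (k : ι) : ∫ x, x k ^ 2 ∂μ = 1 := by
  simpa [h.integral_one'] using h.integral_pow_succ k 1

lemma integral_pow_three (h : IsUnitGaussian μ Λ) (k : ι) : ∫ x, x k ^ 3 ∂μ = 0 := by
  simpa [h.integral_pow_one] using h.integral_pow_succ k 2

lemma integral_pow_four (h : IsUnitGaussian μ Λ) (k : ι) : ∫ x, x k ^ 4 ∂μ = 3 := by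
  simpa [h.integral_pow_two] using h.integral_pow_succ k 3

lemma integral_one_two (h : IsUnitGaussian μ Λ) (k j : ι) : ∫ x, x k * x j ^ 2 ∂μ = 0 := by
  simpa [h.integral_pow_one] using h.integral_pow_succ_mul_pow k j 0 2

lemma integral_one_three (h : IsUnitGaussian μ Λ) (k j : ι) :
    ∫ x, x k * x j ^ 3 ∂μ = 3 * covMat μ k j := by
  have := h.integral_pow_succ_mul_pow k j 0 3
  simp [h.integral_pow_two] at this
  rw [this, mul_comm]

lemma integral_two_two (h : IsUnitGaussian μ Λ) (k j : ι) :
    ∫ x, x k ^ 2 * x j ^ 2 ∂μ = 1 + 2 * covMat μ k j ^ 2 := by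
  have := h.integral_pow_succ_mul_pow k j 1 2
  simp [h.integral_pow_two, show ∫ x, x k * x j ∂μ = covMat μ k j from rfl] at this
  rw [this]
  ring

lemma integral_three_two (h : IsUnitGaussian μ Λ) (k j : ι) :
    ∫ x, x k ^ 3 * x j ^ 2 ∂μ = 0 := by
  have h1 := h.integral_pow_succ_mul_pow k j 2 2
  have h2 := h.integral_one_two j k
  simp only [mul_comm (_ : ℝ) (_ ^ 2)] at h2
  simpa [h.integral_one_two, h2] using h1

lemma integral_three_three (h : IsUnitGaussian μ Λ) (k j : ι) :
    ∫ x, x k ^ 3 * x j ^ 3 ∂μ = 9 * covMat μ k j + 6 * covMat μ k j ^ 3 := by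
  have h1 := h.integral_pow_succ_mul_pow k j 2 3
  simp [h.integral_one_three, h.integral_two_two] at h1
  rw [h1]
  ring

lemma polyMean_bilStat (h : IsUnitGaussian μ Λ) (p q : Polynomial ℝ) :
    polyMean μ (bilStat (covMat μ) p q) =
      ∑ k, ∑ j, covMat μ k j * ∫ x, p.eval (x k) * q.eval (x j) ∂μ := by
  have := h.gaussian
  simp only [bilStat, polyMean_sum, polyMean_C_mul]
  simp only [polyMean, map_mul, eval_aeval_X]

/-- Each joint moment is `1 + 2R²`; weighted by `R`, the constant part disappears with the zero row
sums and leaves cubes only. The factor `3c₁²` of the recursion turns `2` into the `6` of the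
skewness variance. -/
lemma polyMean_bilStat_two_two (h : IsUnitGaussian μ Λ) :
    polyMean μ (bilStat (covMat μ) (Polynomial.X ^ 2) (Polynomial.X ^ 2)) =
      2 * ∑ k, ∑ j, covMat μ k j ^ 3 := by
  rw [h.polyMean_bilStat]
  simp only [Polynomial.eval_pow, Polynomial.eval_X, h.integral_two_two, mul_add, mul_one,
    Finset.sum_add_distrib, h.row, zero_add, Finset.mul_sum]
  exact Finset.sum_congr rfl fun j _ => Finset.sum_congr rfl fun k _ => by ring

lemma polyMean_bilStat_three_two (h : IsUnitGaussian μ Λ) :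
    polyMean μ (bilStat (covMat μ) (Polynomial.X ^ 3) (Polynomial.X ^ 2)) = 0 := by
  rw [h.polyMean_bilStat]
  simp [h.integral_three_two]

/-- Each joint moment is `18R + 6R³`. After weighting by `R`, the factor `4c₂²` of the recursion
produces the constants `72` and `24` of the kurtosis variance. -/
lemma polyMean_bilStat_three_three (h : IsUnitGaussian μ Λ) :
    polyMean μ (bilStat (covMat μ) (Polynomial.X ^ 3)
      (Polynomial.X ^ 3 + Polynomial.C 3 * Polynomial.X)) =
      18 * ∑ k, ∑ j, covMat μ k j ^ 2 + 6 * ∑ k, ∑ j, covMat μ k j ^ 4 := by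
  have := h.gaussian
  rw [h.polyMean_bilStat]
  have h1 : ∀ k j, ∫ x : ι → ℝ, x k ^ 3 * (x j ^ 3 + 3 * x j) ∂μ =
      18 * covMat μ k j + 6 * covMat μ k j ^ 3 := by
    intro k j
    have e : ∀ x : ι → ℝ, x k ^ 3 * (x j ^ 3 + 3 * x j) =
        x k ^ 3 * x j ^ 3 + 3 * (x j * x k ^ 3) := fun x => by ring
    simp only [e]
    rw [integral_add (integrable_of_eval (X k ^ 3 * X j ^ 3) fun x => by simp)
      ((integrable_of_eval (X j * X k ^ 3) fun x => by simp).const_mul 3), integral_const_mul,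
      h.integral_three_three, h.integral_one_three, covMat_symm μ j k]
    ring
  simp only [Polynomial.eval_pow, Polynomial.eval_X, Polynomial.eval_add, Polynomial.eval_mul,
    Polynomial.eval_C, h1, Finset.mul_sum, ← Finset.sum_add_distrib]
  exact Finset.sum_congr rfl fun j _ => Finset.sum_congr rfl fun k _ => by ring

lemma integrable_coord_mul (h : IsUnitGaussian μ Λ) (q : Polynomial ℝ) (k : ι)
    (p : MvPolynomial ι ℝ) : Integrable (fun x => q.eval (x k) * MvPolynomial.eval x p) μ := by
  have := h.gaussian
  exact integrable_of_eval (Polynomial.aeval (X k) q * p) fun x => by rw [map_mul, eval_aeval_X]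

lemma polyMean_linStat_mul (h : IsUnitGaussian μ Λ) (c : ι → ℝ) (q : Polynomial ℝ)
    (p : MvPolynomial ι ℝ) :
    polyMean μ (linStat c q * p) =
      ∑ k, c k * ∫ x, q.eval (x k) * MvPolynomial.eval x p ∂μ := by
  have := h.gaussian
  simp only [polyMean, map_mul, eval_linStat, Finset.sum_mul, mul_assoc]
  rw [integral_finsetSum _ fun k _ => (h.integrable_coord_mul q k p).const_mul _]
  simp only [integral_const_mul]

/-- Exchange of the sums in an integration by parts. -/
lemma sum_sum_covMat_integral (h : IsUnitGaussian μ Λ) (q : Polynomial ℝ)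
    (p : ι → MvPolynomial ι ℝ) :
    ∑ k, ∑ j, covMat μ k j * ∫ x, q.eval (x k) * MvPolynomial.eval x (p j) ∂μ =
      polyMean μ (∑ j, linStat (fun k => covMat μ j k) q * p j) := by
  have := h.gaussian
  rw [polyMean_sum, Finset.sum_comm]
  simp only [h.polyMean_linStat_mul]
  exact Finset.sum_congr rfl fun j _ => Finset.sum_congr rfl fun k _ => by rw [covMat_symm]

/-- Integrating `x_k · x_k² p` by parts leaves `2 x_k p` besides the stated term. Summed over `k`,
that remainder has mean zero because the rows of the covariance matrix sum to zero: the component of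
the cubes in the first Wiener chaos vanishes. -/
lemma polyMean_cubes_mul (h : IsUnitGaussian μ Λ) (c : ℝ) (p : MvPolynomial ι ℝ) :
    polyMean μ (linStat (fun _ => c) (Polynomial.X ^ 3) * p) =
      c * polyMean μ (∑ j, linStat (fun k => covMat μ j k) (Polynomial.X ^ 2) * pderiv j p) := by
  have := h.gaussian
  rw [h.polyMean_linStat_mul, ← h.sum_sum_covMat_integral, ← Finset.mul_sum]
  congr 1
  have h1 : ∀ k, ∫ x, (Polynomial.X ^ 3 : Polynomial ℝ).eval (x k) * MvPolynomial.eval x p ∂μ =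
      2 * (∑ j, covMat μ k j * ∫ x, MvPolynomial.eval x (pderiv j p) ∂μ) + ∑ j, covMat μ k j *
        ∫ x, (Polynomial.X ^ 2 : Polynomial ℝ).eval (x k) *
          MvPolynomial.eval x (pderiv j p) ∂μ := by
    intro k
    have e1 := h.integral_coord_mul k (Polynomial.X ^ 2) p
    have e2 := h.integral_coord_mul k 1 p
    simp only [Polynomial.derivative_one, Polynomial.eval_zero, zero_mul, integral_zero, zero_add,
      Polynomial.eval_one, one_mul] at e2
    rw [← e2, ← integral_const_mul]
    convert e1 using 1
    · exact integral_congr_ae (ae_of_all _ fun x => by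
        simp only [Polynomial.eval_pow, Polynomial.eval_X]; ring)
    · congr 1
      exact integral_congr_ae (ae_of_all _ fun x => by
        simp; ring)
  -- The second integration by parts carries `R_{kj}` with no other dependence on `k`, so the column
  -- sums appear.
  have h0 : ∑ k, (∑ j, covMat μ k j * ∫ x, MvPolynomial.eval x (pderiv j p) ∂μ) = 0 := by
    rw [Finset.sum_comm]
    refine Finset.sum_eq_zero fun j _ => ?_
    rw [← Finset.sum_mul]
    simp only [covMat_symm μ _ j, h.row, zero_mul]
  simp only [h1, Finset.sum_add_distrib, ← Finset.mul_sum, h0, mul_zero, zero_add]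

/-- Two integrations by parts: `x_k · x_k³ p` produces `3 x_k² p`, and `x_k · x_k p` produces `p`,
which the centring constant `3` removes. The gradient terms add up to `x_k³ + 3 x_k`. -/
lemma polyMean_quartics_mul (h : IsUnitGaussian μ Λ) (c : ℝ) (p : MvPolynomial ι ℝ) :
    polyMean μ (linStat (fun _ => c) (Polynomial.X ^ 4 - Polynomial.C 3) * p) =
      c * polyMean μ (∑ j, linStat (fun k => covMat μ j k)
        (Polynomial.X ^ 3 + Polynomial.C 3 * Polynomial.X) * pderiv j p) := by
  have := h.gaussian
  rw [h.polyMean_linStat_mul, ← h.sum_sum_covMat_integral, ← Finset.mul_sum]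
  congr 1
  refine Finset.sum_congr rfl fun k _ => ?_
  have e1 := h.integral_coord_mul k (Polynomial.X ^ 3) p
  have e2 := h.integral_coord_mul k Polynomial.X p
  have i := fun q => h.integrable_coord_mul q k p
  have i' := fun q j => h.integrable_coord_mul q k (pderiv j p)
  have e3 : ∫ x, (Polynomial.X ^ 4 - Polynomial.C 3 : Polynomial ℝ).eval (x k) *
      MvPolynomial.eval x p ∂μ =
      ∫ x, x k * ((Polynomial.X ^ 3 : Polynomial ℝ).eval (x k) * MvPolynomial.eval x p) ∂μ -
      3 * ∫ x, (1 : Polynomial ℝ).eval (x k) * MvPolynomial.eval x p ∂μ := by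
    rw [← integral_const_mul, ← integral_sub]
    · exact integral_congr_ae (ae_of_all _ fun x => by simp; ring)
    · exact (i (Polynomial.X ^ 4)).congr (ae_of_all _ fun x => by simp; ring)
    · exact (i 1).const_mul 3
  have e4 : ∫ x, (Polynomial.X ^ 3 : Polynomial ℝ).derivative.eval (x k) *
      MvPolynomial.eval x p ∂μ =
      3 * ∫ x, x k * ((Polynomial.X : Polynomial ℝ).eval (x k) * MvPolynomial.eval x p) ∂μ := by
    rw [← integral_const_mul]
    exact integral_congr_ae (ae_of_all _ fun x => by simp; ring)
  rw [e3, e1, e4, e2, Polynomial.derivative_X]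
  have e5 : ∀ j, ∫ x, (Polynomial.X ^ 3 + Polynomial.C 3 * Polynomial.X : Polynomial ℝ).eval (x k) *
      MvPolynomial.eval x (pderiv j p) ∂μ =
      ∫ x, (Polynomial.X ^ 3 : Polynomial ℝ).eval (x k) * MvPolynomial.eval x (pderiv j p) ∂μ +
      3 * ∫ x, (Polynomial.X : Polynomial ℝ).eval (x k) *
        MvPolynomial.eval x (pderiv j p) ∂μ := by
    intro j
    rw [← integral_const_mul, ← integral_add (i' _ j) ((i' _ j).const_mul 3)]
    exact integral_congr_ae (ae_of_all _ fun x => by simp; ring)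
  simp only [e5, mul_add, Finset.sum_add_distrib]
  simp only [Finset.mul_sum, mul_left_comm (_ : ℝ) 3]
  ring

end IsUnitGaussian

/-- Sum of cubes, scaled by `c`. -/
noncomputable def cubeSum (ι : Type*) [Fintype ι] (c : ℝ) : MvPolynomial ι ℝ :=
  linStat (fun _ => c) (Polynomial.X ^ 3)

/-- Sum of centred fourth powers, scaled by `c` and shifted by `δ`. -/
noncomputable def quartSum (ι : Type*) [Fintype ι] (c δ : ℝ) : MvPolynomial ι ℝ :=
  linStat (fun _ => c) (Polynomial.X ^ 4 - Polynomial.C 3) + C δ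

lemma pderiv_cubeSum (c : ℝ) (j : ι) :
    pderiv j (cubeSum ι c) =
      C (3 * c) * Polynomial.aeval (X j) (Polynomial.X ^ 2 : Polynomial ℝ) := by
  have h2 : (C (2 : ℝ) : MvPolynomial ι ℝ) = 2 := map_ofNat C 2
  have h3 : (C (3 : ℝ) : MvPolynomial ι ℝ) = 3 := map_ofNat C 3
  rw [cubeSum, pderiv_linStat]
  simp [h2, h3]
  ring

lemma pderiv_quartSum (c δ : ℝ) (j : ι) :
    pderiv j (quartSum ι c δ) =
      C (4 * c) * Polynomial.aeval (X j) (Polynomial.X ^ 3 : Polynomial ℝ) := by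
  have h3 : (C (3 : ℝ) : MvPolynomial ι ℝ) = 3 := map_ofNat C 3
  have h4 : (C (4 : ℝ) : MvPolynomial ι ℝ) = 4 := map_ofNat C 4
  rw [quartSum, map_add, pderiv_linStat]
  simp [h3, h4]
  ring

namespace IsUnitGaussian

variable {μ : Measure (ι → ℝ)} {Λ : ℝ}

/-- One factor of the cube sum is integrated by parts. The gradients of the two sums are `3c₁ x_j²`
and `4c₂ x_j³`, so the random coefficients of the recursion are bilinear statistics in the
covariance matrix. -/
lemma polyMean_cubeSum_pow (h : IsUnitGaussian μ Λ) (c₁ c₂ δ : ℝ) (a b : ℕ) :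
    polyMean μ (cubeSum ι c₁ ^ (a + 1) * quartSum ι c₂ δ ^ b) =
      a * polyMean μ ((C (3 * c₁ ^ 2) * bilStat (covMat μ) (Polynomial.X ^ 2) (Polynomial.X ^ 2)) *
        (cubeSum ι c₁ ^ (a - 1) * quartSum ι c₂ δ ^ b)) +
      b * polyMean μ ((C (4 * c₁ * c₂) *
        bilStat (covMat μ) (Polynomial.X ^ 3) (Polynomial.X ^ 2)) *
        (cubeSum ι c₁ ^ a * quartSum ι c₂ δ ^ (b - 1))) := by
  have := h.gaussian
  rw [pow_succ', mul_assoc, cubeSum, h.polyMean_cubes_mul, ← cubeSum, ← polyMean_C_mul,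
    ← polyMean_C_mul, ← polyMean_C_mul, ← polyMean_add]
  congr 1
  simp only [pderiv_pow_mul_pow, pderiv_cubeSum, pderiv_quartSum, ← sum_linStat_mul,
    Finset.mul_sum, Finset.sum_mul, ← Finset.sum_add_distrib]
  refine Finset.sum_congr rfl fun j _ => ?_
  simp only [map_mul, map_pow, map_ofNat]
  ring

lemma polyMean_quartSum_pow (h : IsUnitGaussian μ Λ) (c₂ δ : ℝ) (b : ℕ) :
    polyMean μ (quartSum ι c₂ δ ^ (b + 1)) =
      b * polyMean μ ((C (4 * c₂ ^ 2) * bilStat (covMat μ) (Polynomial.X ^ 3)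
        (Polynomial.X ^ 3 + Polynomial.C 3 * Polynomial.X)) * quartSum ι c₂ δ ^ (b - 1)) +
      δ * polyMean μ (quartSum ι c₂ δ ^ b) := by
  have := h.gaussian
  rw [pow_succ']
  conv_lhs => enter [2, 1]; rw [quartSum]
  rw [add_mul, polyMean_add, polyMean_C_mul, h.polyMean_quartics_mul]
  congr 1
  rw [← polyMean_C_mul, ← polyMean_C_mul]
  congr 1
  have hp : ∀ j, pderiv j (quartSum ι c₂ δ ^ b) =
      C (b : ℝ) * (quartSum ι c₂ δ ^ (b - 1) * pderiv j (quartSum ι c₂ δ)) := fun j => by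
    have := pderiv_pow_mul_pow j 1 (quartSum ι c₂ δ) 0 b
    simpa only [one_pow, one_mul, Nat.cast_zero, map_zero, zero_mul, zero_add] using this
  simp only [hp, pderiv_quartSum, ← sum_linStat_mul, Finset.mul_sum, Finset.sum_mul]
  refine Finset.sum_congr rfl fun j _ => ?_
  simp only [map_mul, map_pow, map_ofNat]
  ring

lemma polyMean_linStat_pow_le (h : IsUnitGaussian μ Λ) (c : ℝ) (q : Polynomial ℝ)
    (hq : ∀ j : ι, ∫ x, q.eval (x j) ∂μ = 0) {m : ℕ} (hm : m ≠ 0) :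
    polyMean μ (linStat (fun _ => c) q ^ (2 * m)) ≤
      concConst m Λ * ((Fintype.card ι * c ^ 2) ^ m * gaussMean (q.derivative ^ (2 * m))) := by
  have h1 := h.integral_linStat_sub_pow_le (fun _ => c) q hm
  have h2 : (∑ _j : ι, c) * gaussMean q = 0 := by
    rw [Finset.sum_mul]
    exact Finset.sum_eq_zero fun j _ => by rw [← h.integral_coord j, hq j, mul_zero]
  simp only [h2] at h1
  simp only [sub_zero, Finset.sum_const, Finset.card_univ, nsmul_eq_mul] at h1
  simpa only [polyMean, map_pow] using h1

lemma integral_quartic (h : IsUnitGaussian μ Λ) (j : ι) :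
    ∫ x, (Polynomial.X ^ 4 - Polynomial.C 3 : Polynomial ℝ).eval (x j) ∂μ = 0 := by
  have := h.gaussian
  simp only [Polynomial.eval_sub, Polynomial.eval_pow, Polynomial.eval_X, Polynomial.eval_C]
  rw [integral_sub (integrable_of_eval (X j ^ 4) fun x => by simp) (integrable_const 3),
    h.integral_pow_four]
  simp

lemma integral_cubic (h : IsUnitGaussian μ Λ) (j : ι) :
    ∫ x, (Polynomial.X ^ 3 : Polynomial ℝ).eval (x j) ∂μ = 0 := by
  simpa using h.integral_pow_three j

/-- Variance plus squared bias; the cross term has mean zero. -/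
lemma polyMean_bilStat_sub_sq_le (h : IsUnitGaussian μ Λ) (t r : ℝ) (p q : Polynomial ℝ) :
    polyMean μ ((C t * bilStat (covMat μ) p q - C r) ^ 2) ≤
      t ^ 2 * (Fintype.card ι * bilConst Λ p q) +
        (t * polyMean μ (bilStat (covMat μ) p q) - r) ^ 2 := by
  have := h.gaussian
  set b := bilStat (covMat μ) p q with hb
  set e := polyMean μ b with he
  have h1 : polyMean μ ((b - C e) ^ 2) ≤ Fintype.card ι * bilConst Λ p q := by
    simp only [polyMean, map_pow, map_sub, MvPolynomial.eval_C]
    exact h.variance_bilStat_le p q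
  have h2 : (C t * b - C r) ^ 2 = C (t ^ 2) * (b - C e) ^ 2 +
      C (2 * t * (t * e - r)) * (b - C e) + C ((t * e - r) ^ 2) := by
    simp only [map_mul, map_pow, map_sub, map_ofNat]
    ring
  have h3 : polyMean μ (b - C e) = 0 := by
    rw [polyMean_sub, polyMean_C, sub_self]
  rw [h2, polyMean_add, polyMean_add, polyMean_C_mul, polyMean_C_mul, h3, polyMean_C, mul_zero,
    add_zero]
  gcongr

end IsUnitGaussian

/-- Joint moment convergence for sums of cubes and fourth powers of Gaussian vectors with bounded
spectrum. -/
theorem tendsto_polyMean_cubeSum_quartSum {ι : ℕ → Type*} [∀ n, Fintype (ι n)]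
    {μ : ∀ n, Measure (ι n → ℝ)} {Λ : ℝ} (h : ∀ n, IsUnitGaussian (μ n) Λ) {c₁ c₂ δ : ℕ → ℝ}
    {K : ℝ} (hc₁ : ∀ n, Fintype.card (ι n) * c₁ n ^ 2 ≤ K)
    (hc₂ : ∀ n, Fintype.card (ι n) * c₂ n ^ 2 ≤ K)
    (hcard : Tendsto (fun n => (Fintype.card (ι n) : ℝ)) atTop atTop)
    (hS : Tendsto (fun n => c₁ n ^ 2 * (6 * ∑ k, ∑ j, covMat (μ n) k j ^ 3)) atTop (𝓝 1))
    (hU : Tendsto (fun n => c₂ n ^ 2 * (72 * ∑ k, ∑ j, covMat (μ n) k j ^ 2 +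
      24 * ∑ k, ∑ j, covMat (μ n) k j ^ 4)) atTop (𝓝 1))
    (hδ : Tendsto δ atTop (𝓝 0)) (a b : ℕ) :
    Tendsto (fun n => polyMean (μ n) (cubeSum (ι n) (c₁ n) ^ a * quartSum (ι n) (c₂ n) (δ n) ^ b))
      atTop (𝓝 (normalMoment a * normalMoment b)) := by
  have hg : ∀ n, IsGaussian (μ n) := fun n => (h n).gaussian
  have hΛ : 0 ≤ Λ := (h 0).nonneg
  have gm0 : ∀ (q : Polynomial ℝ) m, 0 ≤ gaussMean (q ^ (2 * m)) := fun q m =>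
    integral_nonneg fun t => by simpa using (even_two_mul m).pow_nonneg _
  have hvar : ∀ (t : ℕ → ℝ) (r : ℝ) (p q : Polynomial ℝ) (L : ℝ),
      (∀ n, (Fintype.card (ι n) * t n) ^ 2 ≤ L) →
      Tendsto (fun n => t n * polyMean (μ n) (bilStat (covMat (μ n)) p q)) atTop (𝓝 r) →
      Tendsto (fun n => polyMean (μ n) ((C (t n) * bilStat (covMat (μ n)) p q - C r) ^ 2)) atTop
        (𝓝 0) := by
    intro t r p q L hL ht
    -- With `card · t` bounded, the variance term `t² · card` is at most a constant divided by the
    -- dimension; the bias vanishes by convergence of the means.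
    have h1 : Tendsto (fun n => L * |bilConst Λ p q| / (Fintype.card (ι n) : ℝ) +
        (t n * polyMean (μ n) (bilStat (covMat (μ n)) p q) - r) ^ 2) atTop (𝓝 (0 + (r - r) ^ 2)) :=
      (tendsto_const_nhds.div_atTop hcard).add ((ht.sub_const r).pow 2)
    rw [sub_self, zero_pow two_ne_zero, add_zero] at h1
    have hpos : ∀ᶠ n in atTop, (0 : ℝ) < Fintype.card (ι n) := hcard.eventually_gt_atTop 0
    refine squeeze_zero' (Eventually.of_forall fun n => polyMean_even_pow_nonneg _ _ even_two)
      ?_ h1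
    filter_upwards [hpos] with n hn
    refine ((h n).polyMean_bilStat_sub_sq_le (t n) r p q).trans (add_le_add_left ?_ _)
    rw [le_div_iff₀ hn]
    calc t n ^ 2 * (Fintype.card (ι n) * bilConst Λ p q) * Fintype.card (ι n) =
        (Fintype.card (ι n) * t n) ^ 2 * bilConst Λ p q := by ring
      _ ≤ (Fintype.card (ι n) * t n) ^ 2 * |bilConst Λ p q| := by
        gcongr; exact le_abs_self _
      _ ≤ _ := by gcongr; exact hL n
  have hK : 0 ≤ K := (by positivity : 0 ≤ Fintype.card (ι 0) * c₁ 0 ^ 2).trans (hc₁ 0)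
  have hsq : ∀ (k : ℝ) (c d : ℕ → ℝ), (∀ n, Fintype.card (ι n) * c n ^ 2 ≤ K) →
      (∀ n, Fintype.card (ι n) * d n ^ 2 ≤ K) →
      ∀ n, (Fintype.card (ι n) * (k * c n * d n)) ^ 2 ≤ k ^ 2 * K ^ 2 := by
    intro k c d hc hd n
    calc (Fintype.card (ι n) * (k * c n * d n)) ^ 2 =
        k ^ 2 * ((Fintype.card (ι n) * c n ^ 2) * (Fintype.card (ι n) * d n ^ 2)) := by ring
      _ ≤ k ^ 2 * (K * K) := by
        gcongr
        · exact hc n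
        · exact hd n
      _ = _ := by ring
  refine tendsto_polyMean_pow (fun n => (h n).polyMean_cubeSum_pow (c₁ n) (c₂ n) (δ n))
    (fun n => (h n).polyMean_quartSum_pow (c₂ n) (δ n)) ?_ ?_ ?_ ?_ ?_ hδ a b
  · intro m
    rcases eq_or_ne m 0 with rfl | hm
    · exact ⟨1, fun n => by simp [polyMean]⟩
    · refine ⟨concConst m Λ * (K ^ m * gaussMean ((Polynomial.X ^ 3).derivative ^ (2 * m))),
        fun n => ((h n).polyMean_linStat_pow_le _ _ (h n).integral_cubic hm).trans ?_⟩
      exact mul_le_mul_of_nonneg_left (mul_le_mul_of_nonneg_right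
        (pow_le_pow_left₀ (by positivity) (hc₁ n) m) (gm0 _ m)) (concConst_nonneg m hΛ)
  · intro m
    rcases eq_or_ne m 0 with rfl | hm
    · exact ⟨1, fun n => by simp [polyMean]⟩
    · obtain ⟨L, hL⟩ := (hδ.pow (2 * m)).bddAbove_range
      set q : Polynomial ℝ := Polynomial.X ^ 4 - Polynomial.C 3 with hq
      refine ⟨2 ^ (2 * m - 1) * (concConst m Λ * (K ^ m * gaussMean (q.derivative ^ (2 * m))) + L),
        fun n => ?_⟩
      have h1 : polyMean (μ n) (quartSum (ι n) (c₂ n) (δ n) ^ (2 * m)) ≤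
          polyMean (μ n) (C (2 ^ (2 * m - 1)) * (linStat (fun _ => c₂ n) q ^ (2 * m) +
            C (δ n ^ (2 * m)))) := by
        refine polyMean_mono _ fun x => ?_
        simp only [quartSum, map_pow, map_add, map_mul, MvPolynomial.eval_C]
        exact (even_two_mul m).add_pow_le
      refine h1.trans ?_
      rw [polyMean_C_mul, polyMean_add, polyMean_C]
      refine mul_le_mul_of_nonneg_left (add_le_add ?_ (hL ⟨n, rfl⟩)) (by positivity)
      refine ((h n).polyMean_linStat_pow_le _ _ (h n).integral_quartic hm).trans ?_
      exact mul_le_mul_of_nonneg_left (mul_le_mul_of_nonneg_right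
        (pow_le_pow_left₀ (by positivity) (hc₂ n) m) (gm0 _ m)) (concConst_nonneg m hΛ)
  · have := hvar (fun n => 3 * c₁ n ^ 2) 1 (Polynomial.X ^ 2) (Polynomial.X ^ 2) _
      (fun n => by simpa only [mul_assoc, ← sq] using hsq 3 c₁ c₁ hc₁ hc₁ n)
      (hS.congr fun n => by rw [(h n).polyMean_bilStat_two_two]; ring)
    simpa using this
  · have := hvar (fun n => 4 * c₁ n * c₂ n) 0 (Polynomial.X ^ 3) (Polynomial.X ^ 2) _
      (hsq 4 c₁ c₂ hc₁ hc₂) (by simp [(h _).polyMean_bilStat_three_two])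
    simpa using this
  · have := hvar (fun n => 4 * c₂ n ^ 2) 1 (Polynomial.X ^ 3)
      (Polynomial.X ^ 3 + Polynomial.C 3 * Polynomial.X) _
      (fun n => by simpa only [mul_assoc, ← sq] using hsq 4 c₂ c₂ hc₂ hc₂ n)
      (hU.congr fun n => by rw [(h n).polyMean_bilStat_three_three]; ring)
    simpa using this

end PowerSums

end TorusNeedlet

namespace TorusNeedlet

/-! ### The method of moments through characteristic functions -/

section MethodOfMoments

/-- The exponential series at `i x`, truncated. -/
noncomputable def expTrunc (n : ℕ) (x : ℝ) : ℂ :=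
  ∑ k ∈ Finset.range n, (Complex.I * x) ^ k / (k.factorial : ℂ)

lemma continuous_expTrunc (n : ℕ) : Continuous (expTrunc n) := by
  unfold expTrunc; fun_prop

lemma hasDerivAt_expTrunc_succ (n : ℕ) (x : ℝ) :
    HasDerivAt (expTrunc (n + 1)) (Complex.I * expTrunc n x) x := by
  have h1 : ∀ k ∈ Finset.range n, HasDerivAt
      (fun x : ℝ => (Complex.I * x) ^ (k + 1) / ((k + 1).factorial : ℂ))
      (Complex.I * ((Complex.I * x) ^ k / (k.factorial : ℂ))) x := fun k _ => by
    have h2 : HasDerivAt (fun x : ℝ => Complex.I * (x : ℂ)) (Complex.I * 1) x :=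
      (Complex.ofRealCLM.hasDerivAt (x := x)).const_mul Complex.I
    refine ((h2.pow (k + 1)).div_const _).congr_deriv ?_
    have h3 : (k.factorial : ℂ) ≠ 0 := by exact_mod_cast k.factorial_ne_zero
    have h4 : ((k : ℂ) + 1) ≠ 0 := by exact_mod_cast k.succ_ne_zero
    rw [Nat.factorial_succ]
    push_cast
    field_simp
  have h5 := (HasDerivAt.fun_sum h1).add_const (1 : ℂ)
  refine (h5.congr_deriv (by rw [expTrunc, Finset.mul_sum])).congr_of_eventuallyEq
    (Eventually.of_forall fun y => ?_)
  simp [expTrunc, Finset.sum_range_succ']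

/-- Induction on the order: the derivative of the remainder is `i` times the previous remainder,
which is then integrated from zero. -/
lemma norm_exp_sub_expTrunc_le (n : ℕ) : ∀ x : ℝ,
    ‖Complex.exp (Complex.I * x) - expTrunc n x‖ ≤ |x| ^ n / (n.factorial : ℝ) := by
  induction n with
  | zero =>
    intro x
    rw [mul_comm]
    simp [expTrunc, Complex.norm_exp_ofReal_mul_I]
  | succ n ih =>
    intro x
    have hd : ∀ y : ℝ, HasDerivAt (fun y : ℝ => Complex.exp (Complex.I * y) - expTrunc (n + 1) y)
        (Complex.I * (Complex.exp (Complex.I * y) - expTrunc n y)) y := fun y => by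
      have h2 : HasDerivAt (fun x : ℝ => Complex.I * (x : ℂ)) (Complex.I * 1) y :=
        (Complex.ofRealCLM.hasDerivAt (x := y)).const_mul Complex.I
      refine (h2.cexp.sub (hasDerivAt_expTrunc_succ n y)).congr_deriv ?_
      ring
    have hc : Continuous fun y : ℝ => Complex.I * (Complex.exp (Complex.I * y) - expTrunc n y) := by
      have := continuous_expTrunc n
      fun_prop
    have hi := intervalIntegral.integral_eq_sub_of_hasDerivAt (a := 0) (b := x)
      (fun y _ => hd y) (hc.intervalIntegrable _ _)
    have h0 : expTrunc (n + 1) 0 = 1 := by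
      simp [expTrunc, Finset.sum_range_succ']
    simp only [Complex.ofReal_zero, mul_zero, Complex.exp_zero, h0, sub_self, sub_zero] at hi
    rw [← hi]
    have hb : ∀ y : ℝ, ‖Complex.I * (Complex.exp (Complex.I * y) - expTrunc n y)‖ ≤
        |y| ^ n / (n.factorial : ℝ) := fun y => by simpa using ih y
    have hint : ∀ z : ℝ, 0 ≤ z → ∫ y in (0 : ℝ)..z, |y| ^ n / (n.factorial : ℝ) =
        z ^ (n + 1) / ((n + 1).factorial : ℝ) := by
      intro z hz
      have : ∫ y in (0 : ℝ)..z, |y| ^ n / (n.factorial : ℝ) =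
          ∫ y in (0 : ℝ)..z, y ^ n / (n.factorial : ℝ) := by
        refine intervalIntegral.integral_congr fun y hy => ?_
        rw [Set.uIcc_of_le hz] at hy
        simp only [abs_of_nonneg hy.1]
      rw [this, intervalIntegral.integral_div, integral_pow, Nat.factorial_succ]
      have h3 : (n.factorial : ℝ) ≠ 0 := by exact_mod_cast n.factorial_ne_zero
      push_cast
      field_simp
      simp
    have hci : Continuous fun y : ℝ => |y| ^ n / (n.factorial : ℝ) := by fun_prop
    rcases le_total 0 x with hx | hx
    · rw [abs_of_nonneg hx, ← hint x hx]
      exact intervalIntegral.norm_integral_le_of_norm_le hx (ae_of_all _ fun y _ => hb y)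
        (hci.intervalIntegrable _ _)
    · rw [intervalIntegral.integral_symm, norm_neg, abs_of_nonpos hx, ← hint (-x) (by linarith)]
      have h1 := intervalIntegral.norm_integral_le_of_norm_le hx (ae_of_all volume fun y _ => hb y)
        (hci.intervalIntegrable _ _)
      refine h1.trans (le_of_eq ?_)
      have h2 := intervalIntegral.integral_comp_neg (a := 0) (b := -x)
        (fun y : ℝ => |y| ^ n / (n.factorial : ℝ))
      simp only [abs_neg, neg_neg, neg_zero] at h2
      exact h2.symm

/-- The truncated moment series of a real random variable. -/
noncomputable def momentTrunc (c : ℕ → ℝ) (n : ℕ) : ℂ :=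
  ∑ k ∈ Finset.range n, Complex.I ^ k * (c k : ℂ) / (k.factorial : ℂ)

/-- Truncation at an even order makes the remainder a genuine moment, without absolute values. -/
lemma norm_integral_exp_sub_momentTrunc_le {Ω : Type*} [MeasurableSpace Ω] {P : Measure Ω}
    [IsProbabilityMeasure P] {T : Ω → ℝ} (hT : AEMeasurable T P)
    (hi : ∀ k, Integrable (fun ω => T ω ^ k) P) (K : ℕ) :
    ‖∫ ω, Complex.exp (Complex.I * T ω) ∂P - momentTrunc (fun k => ∫ ω, T ω ^ k ∂P) (2 * K)‖ ≤
      (∫ ω, T ω ^ (2 * K) ∂P) / ((2 * K).factorial : ℝ) := by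
  have h1 : momentTrunc (fun k => ∫ ω, T ω ^ k ∂P) (2 * K) =
      ∫ ω, expTrunc (2 * K) (T ω) ∂P := by
    simp only [momentTrunc, expTrunc]
    rw [integral_finsetSum]
    · refine Finset.sum_congr rfl fun k _ => ?_
      rw [integral_div, ← integral_complex_ofReal, ← integral_const_mul]
      simp only [mul_pow, Complex.ofReal_pow]
    · intro k _
      refine (((hi k).ofReal (𝕜 := ℂ)).const_mul (Complex.I ^ k)).div_const (k.factorial : ℂ) |>.congr
        (ae_of_all _ fun ω => ?_)
      simp [mul_pow]
  have hexp : Integrable (fun ω => Complex.exp (Complex.I * T ω)) P := by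
    refine (integrable_const (1 : ℝ)).mono' ?_ (ae_of_all _ fun ω => ?_)
    · exact (Complex.continuous_exp.comp (by fun_prop : Continuous fun x : ℝ => Complex.I * x)
        |>.measurable.comp_aemeasurable hT).aestronglyMeasurable
    · rw [mul_comm, Complex.norm_exp_ofReal_mul_I]
  have htr : Integrable (fun ω => expTrunc (2 * K) (T ω)) P := by
    simp only [expTrunc]
    refine integrable_finsetSum _ fun k _ => ?_
    refine (((hi k).ofReal (𝕜 := ℂ)).const_mul (Complex.I ^ k)).div_const (k.factorial : ℂ) |>.congr
        (ae_of_all _ fun ω => ?_)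
    simp [mul_pow]
  rw [h1, ← integral_sub hexp htr, ← integral_div]
  refine norm_integral_le_of_norm_le ((hi _).div_const _) (ae_of_all _ fun ω => ?_)
  have := norm_exp_sub_expTrunc_le (2 * K) (T ω)
  rwa [(even_two_mul K).pow_abs] at this

/-- An exponential moment of the limit makes its Taylor remainders vanish as the order grows. At a
fixed even order the remainder of `T n` is controlled by a moment that converges to that of the
limit, so the truncated series can be compared. -/
lemma tendsto_integral_exp_of_moments {Ω Ω' : Type*} [MeasurableSpace Ω] [MeasurableSpace Ω']
    {P : Measure Ω} [IsProbabilityMeasure P] {Q : Measure Ω'} [IsProbabilityMeasure Q]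
    {T : ℕ → Ω → ℝ} {Z : Ω' → ℝ} (hT : ∀ n, AEMeasurable (T n) P) (hZ : AEMeasurable Z Q)
    (hi : ∀ n k, Integrable (fun ω => T n ω ^ k) P) (hiZ : ∀ k, Integrable (fun ω => Z ω ^ k) Q)
    (hZe : Integrable (fun ω => Real.exp |Z ω|) Q)
    (h : ∀ k, Tendsto (fun n => ∫ ω, T n ω ^ k ∂P) atTop (𝓝 (∫ ω, Z ω ^ k ∂Q))) :
    Tendsto (fun n => ∫ ω, Complex.exp (Complex.I * T n ω) ∂P) atTop
      (𝓝 (∫ ω, Complex.exp (Complex.I * Z ω) ∂Q)) := by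
  have hdec : Tendsto (fun K : ℕ => (∫ ω, Z ω ^ (2 * K) ∂Q) / ((2 * K).factorial : ℝ)) atTop
      (𝓝 0) := by
    have h1 : Tendsto (fun k : ℕ => ∫ ω, Z ω ^ k / (k.factorial : ℝ) ∂Q) atTop
        (𝓝 (∫ _, (0 : ℝ) ∂Q)) := by
      refine tendsto_integral_of_dominated_convergence (fun ω => Real.exp |Z ω|)
        (fun k => ((hiZ k).div_const _).aestronglyMeasurable) hZe
        (fun k => ae_of_all _ fun ω => ?_) (ae_of_all _ fun ω => ?_)
      · rw [norm_div, norm_pow, Real.norm_eq_abs, Real.norm_natCast]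
        exact Real.pow_div_factorial_le_exp _ (abs_nonneg _) k
      · exact FloorSemiring.tendsto_pow_div_factorial_atTop (Z ω)
    rw [integral_zero] at h1
    have h2 := h1.comp (tendsto_id.const_mul_atTop' (r := 2) (by norm_num) :
      Tendsto (fun K : ℕ => 2 * K) atTop atTop)
    simpa only [Function.comp_def, integral_div] using h2
  have hmt : ∀ K, Tendsto (fun n => momentTrunc (fun k => ∫ ω, T n ω ^ k ∂P) K) atTop
      (𝓝 (momentTrunc (fun k => ∫ ω, Z ω ^ k ∂Q) K)) := fun K => by
    unfold momentTrunc
    refine tendsto_finsetSum _ fun k _ => ((Tendsto.const_mul _ ?_).div_const _)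
    exact (Complex.continuous_ofReal.tendsto _).comp (h k)
  rw [Metric.tendsto_atTop]
  intro ε hε
  -- Three errors below `ε / 4` suffice: the two Taylor remainders and the difference of the
  -- truncated series.
  obtain ⟨K, hK⟩ := (hdec.eventually (gt_mem_nhds (show 0 < ε / 4 by positivity))).exists
  have e1 := ((h (2 * K)).div_const ((2 * K).factorial : ℝ)).eventually (gt_mem_nhds hK)
  have e2 := Metric.tendsto_atTop.mp (hmt (2 * K)) (ε / 4) (by positivity)
  obtain ⟨N₁, hN₁⟩ := eventually_atTop.mp e1
  obtain ⟨N₂, hN₂⟩ := e2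
  refine ⟨max N₁ N₂, fun n hn => ?_⟩
  have b1 := norm_integral_exp_sub_momentTrunc_le (hT n) (hi n) K
  have b2 := norm_integral_exp_sub_momentTrunc_le hZ hiZ K
  have b3 := hN₁ n ((le_max_left _ _).trans hn)
  have b4 := hN₂ n ((le_max_right _ _).trans hn)
  rw [← dist_eq_norm] at b1 b2
  have b5 := dist_triangle4 (∫ ω, Complex.exp (Complex.I * T n ω) ∂P)
    (momentTrunc (fun k => ∫ ω, T n ω ^ k ∂P) (2 * K))
    (momentTrunc (fun k => ∫ ω, Z ω ^ k ∂Q) (2 * K)) (∫ ω, Complex.exp (Complex.I * Z ω) ∂Q)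
  rw [dist_comm] at b2
  linarith

lemma integral_linear_comb_pow {Ω : Type*} [MeasurableSpace Ω] {P : Measure Ω} {s u : Ω → ℝ}
    (hi : ∀ a b : ℕ, Integrable (fun ω => s ω ^ a * u ω ^ b) P) (x y : ℝ) (k : ℕ) :
    Integrable (fun ω => (x * s ω + y * u ω) ^ k) P ∧
    ∫ ω, (x * s ω + y * u ω) ^ k ∂P =
      ∑ m ∈ Finset.range (k + 1), (x ^ m * y ^ (k - m) * k.choose m) *
        ∫ ω, s ω ^ m * u ω ^ (k - m) ∂P := by
  have h1 : ∀ ω, (x * s ω + y * u ω) ^ k = ∑ m ∈ Finset.range (k + 1),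
      (x ^ m * y ^ (k - m) * k.choose m) * (s ω ^ m * u ω ^ (k - m)) := fun ω => by
    rw [add_pow]
    exact Finset.sum_congr rfl fun m _ => by rw [mul_pow, mul_pow]; ring
  simp only [h1]
  refine ⟨integrable_finsetSum _ fun m _ => (hi _ _).const_mul _, ?_⟩
  rw [integral_finsetSum _ fun m _ => (hi _ _).const_mul _]
  simp only [integral_const_mul]

/-- The method of moments for convergence to the standard normal law of the plane. -/
theorem tendstoInDistribution_of_moments {Ω : Type*} [MeasurableSpace Ω] {P : Measure Ω}
    [IsProbabilityMeasure P] {s u : ℕ → Ω → ℝ} (hs : ∀ n, AEMeasurable (s n) P)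
    (hu : ∀ n, AEMeasurable (u n) P)
    (hi : ∀ n (a b : ℕ), Integrable (fun ω => s n ω ^ a * u n ω ^ b) P)
    (h : ∀ a b : ℕ, Tendsto (fun n => ∫ ω, s n ω ^ a * u n ω ^ b ∂P) atTop
      (𝓝 (normalMoment a * normalMoment b))) :
    TendstoInDistribution (fun n ω => !₂[s n ω, u n ω]) atTop
      (id : EuclideanSpace ℝ (Fin 2) → EuclideanSpace ℝ (Fin 2)) (fun _ => P)
      (stdGaussian (EuclideanSpace ℝ (Fin 2))) := by
  have hm : ∀ n, AEMeasurable (fun ω => !₂[s n ω, u n ω]) P := fun n => by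
    have h1 : AEMeasurable (fun ω => ![s n ω, u n ω]) P := by
      rw [aemeasurable_pi_iff]
      intro i
      fin_cases i
      · simpa using hs n
      · simpa using hu n
    exact (WithLp.measurable_toLp 2 _).comp_aemeasurable h1
  refine ⟨hm, by fun_prop, ?_⟩
  set γ := stdGaussian (EuclideanSpace ℝ (Fin 2)) with hγ
  refine ProbabilityMeasure.tendsto_iff_tendsto_charFun.2 fun t => ?_
  -- Cramér–Wold: the characteristic function at `t` is that of the linear combination with
  -- coefficients `t 0`, `t 1`, evaluated at frequency one.
  have hcf : ∀ n, charFun (P.map fun ω => !₂[s n ω, u n ω]) t =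
      ∫ ω, Complex.exp (Complex.I * ((t 0 * s n ω + t 1 * u n ω : ℝ) : ℂ)) ∂P := fun n => by
    rw [charFun_apply, integral_map (hm n) (by fun_prop)]
    refine integral_congr_ae (ae_of_all _ fun ω => ?_)
    simp [PiLp.inner_apply, Fin.sum_univ_two, mul_comm]
  have hcz : charFun (γ.map id) t =
      ∫ x : EuclideanSpace ℝ (Fin 2),
        Complex.exp (Complex.I * ((t 0 * x 0 + t 1 * x 1 : ℝ) : ℂ)) ∂γ := by
    rw [Measure.map_id, charFun_apply]
    refine integral_congr_ae (ae_of_all _ fun ω => ?_)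
    simp [PiLp.inner_apply, Fin.sum_univ_two, mul_comm]
  simp only [ProbabilityMeasure.coe_mk, hcf]
  change Tendsto _ _ (𝓝 (charFun (γ.map id) t))
  rw [hcz]
  have hLp : ∀ (i : Fin 2) (p : ℕ), MemLp (fun x : EuclideanSpace ℝ (Fin 2) => x i) p γ :=
    fun i p => IsGaussian.memLp_dual γ (EuclideanSpace.proj i) p (by simp)
  have hiZ : ∀ a b : ℕ, Integrable (fun x : EuclideanSpace ℝ (Fin 2) => x 0 ^ a * x 1 ^ b) γ := by
    intro a b
    have hsq : ∀ (i : Fin 2) (a : ℕ), MemLp (fun x : EuclideanSpace ℝ (Fin 2) => x i ^ a) 2 γ := by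
      intro i a
      rw [memLp_two_iff_integrable_sq (by fun_prop)]
      simp only [← pow_mul]
      refine ((hLp i (a * 2)).integrable_norm_pow').mono' (by fun_prop) (ae_of_all _ fun x => ?_)
      rw [norm_pow]
    exact (hsq 0 a).integrable_mul (hsq 1 b)
  have hexp : Integrable (fun x : EuclideanSpace ℝ (Fin 2) =>
      Real.exp |t 0 * x 0 + t 1 * x 1|) γ := by
    let L : EuclideanSpace ℝ (Fin 2) →L[ℝ] ℝ :=
      t 0 • EuclideanSpace.proj (𝕜 := ℝ) (0 : Fin 2) + t 1 • EuclideanSpace.proj (𝕜 := ℝ) (1 : Fin 2)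
    have hL : ∀ x, L x = t 0 * x 0 + t 1 * x 1 := fun x => rfl
    have hlaw := IsGaussian.map_eq_gaussianReal (μ := γ) L
    have hE : ∀ c : ℝ, Integrable (fun x => Real.exp (c * L x)) γ := fun c => by
      have h1 := integrable_exp_mul_gaussianReal (μ := γ[L]) (v := Var[L; γ].toNNReal) c
      rw [← hlaw, integrable_map_measure (by fun_prop) (by fun_prop)] at h1
      exact h1
    refine ((hE 1).add (hE (-1))).mono' (by fun_prop) (ae_of_all _ fun x => ?_)
    rw [Real.norm_of_nonneg (Real.exp_pos _).le, ← hL]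
    simp only [Pi.add_apply, one_mul, neg_one_mul]
    rcases abs_cases (L x) with h1 | h1 <;> rw [h1.1] <;>
      linarith [Real.exp_pos (L x), Real.exp_pos (-L x)]
  refine tendsto_integral_exp_of_moments (T := fun n ω => t 0 * s n ω + t 1 * u n ω) (fun n => ((hs n).const_mul _).add ((hu n).const_mul _))
    (by fun_prop) (fun n k => (integral_linear_comb_pow (hi n) _ _ k).1)
    (fun k => (integral_linear_comb_pow hiZ _ _ k).1) hexp fun k => ?_
  rw [(integral_linear_comb_pow hiZ _ _ k).2]
  simp only [fun n => (integral_linear_comb_pow (hi n) (t 0) (t 1) k).2]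
  refine tendsto_finsetSum _ fun m _ => Tendsto.const_mul _ ?_
  rw [hγ, integral_pow_mul_pow_stdGaussian]
  exact h _ _

end MethodOfMoments

end TorusNeedlet

namespace TorusNeedlet

/-! ### Covariances of the field and of the sampled coefficients -/

section Covariance

lemma sum_exp_root (M : ℕ) (hM : M ≠ 0) (j : ℤ) :
    ∑ m ∈ Finset.range M, Complex.exp (Complex.I * (j * (2 * Real.pi * m / M))) =
      if (M : ℤ) ∣ j then (M : ℂ) else 0 := by
  have hM' : (M : ℂ) ≠ 0 := by exact_mod_cast hM
  set ζ := Complex.exp (2 * Real.pi * Complex.I * (j / M)) with hζ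
  have hpow : ∀ m : ℕ, Complex.exp (Complex.I * (j * (2 * Real.pi * m / M))) = ζ ^ m := fun m => by
    rw [hζ, ← Complex.exp_nat_mul]
    congr 1
    field_simp
  simp only [hpow]
  have hζM : ζ ^ M = 1 := by
    rw [hζ, ← Complex.exp_nat_mul, Complex.exp_eq_one_iff]
    exact ⟨j, by field_simp⟩
  by_cases hd : (M : ℤ) ∣ j
  · obtain ⟨c, rfl⟩ := hd
    have h1 : ζ = 1 := by
      rw [hζ, Complex.exp_eq_one_iff]
      exact ⟨c, by push_cast; field_simp⟩
    simp [h1]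
  · rw [if_neg hd]
    have h1 : ζ ≠ 1 := by
      intro h
      rw [hζ, Complex.exp_eq_one_iff] at h
      obtain ⟨c, hc⟩ := h
      refine hd ⟨c, ?_⟩
      have h2 : (2 * Real.pi * Complex.I : ℂ) ≠ 0 := Complex.two_pi_I_ne_zero
      have h3 : (j : ℂ) / M = c := by
        apply mul_left_cancel₀ h2
        rw [hc]; ring
      rw [div_eq_iff hM'] at h3
      have h4 : (j : ℂ) = ((M * c : ℤ) : ℂ) := by push_cast; rw [h3]; ring
      exact_mod_cast h4
    rw [geom_sum_eq h1, hζM, sub_self, zero_div]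

/-- Continuity of the inner product of `L²(P)`. -/
lemma tendsto_integral_mul_conj {Ω : Type*} [MeasurableSpace Ω] {P : Measure Ω}
    {f g : ℕ → Ω → ℂ} {F G : Ω → ℂ} (hf : ∀ n, MemLp (f n) 2 P) (hg : ∀ n, MemLp (g n) 2 P)
    (hF : MemLp F 2 P) (hG : MemLp G 2 P)
    (hfF : Tendsto (fun n => eLpNorm (fun ω => F ω - f n ω) 2 P) atTop (𝓝 0))
    (hgG : Tendsto (fun n => eLpNorm (fun ω => G ω - g n ω) 2 P) atTop (𝓝 0)) :
    Tendsto (fun n => ∫ ω, f n ω * (starRingEnd ℂ) (g n ω) ∂P) atTop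
      (𝓝 (∫ ω, F ω * (starRingEnd ℂ) (G ω) ∂P)) := by
  have key : ∀ {h : ℕ → Ω → ℂ} {H : Ω → ℂ} (hh : ∀ n, MemLp (h n) 2 P) (hH : MemLp H 2 P),
      Tendsto (fun n => eLpNorm (fun ω => H ω - h n ω) 2 P) atTop (𝓝 0) →
      Tendsto (fun n => (hh n).toLp (h n)) atTop (𝓝 (hH.toLp H)) := by
    intro h H hh hH hlim
    rw [Lp.tendsto_Lp_iff_tendsto_eLpNorm'' _ hh _ hH]
    refine hlim.congr fun n => ?_
    rw [← eLpNorm_neg]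
    congr 1
    ext ω
    simp
  have h1 := (key hg hG hgG).inner (𝕜 := ℂ) (key hf hF hfF)
  have h2 : ∀ {h k : Ω → ℂ} (hh : MemLp h 2 P) (hk : MemLp k 2 P),
      inner ℂ (hk.toLp k) (hh.toLp h) = ∫ ω, h ω * (starRingEnd ℂ) (k ω) ∂P := by
    intro h k hh hk
    rw [L2.inner_def]
    refine integral_congr_ae ?_
    filter_upwards [hh.coeFn_toLp, hk.coeFn_toLp] with ω e1 e2
    rw [e1, e2]
    simp
  simpa only [h2] using h1

variable {Ω : Type*} [MeasurableSpace Ω] {P : Measure Ω} {C : ℕ → ℝ}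
  {w : ℤ → Ω → ℂ} {X : ℝ → Ω → ℝ}

namespace IsSpectralField

/-- Partial sums of the spectral series. -/
noncomputable def partialSum (w : ℤ → Ω → ℂ) (n : ℕ) (ϑ : ℝ) (ω : Ω) : ℂ :=
  ∑ l ∈ Finset.Icc (-(n : ℤ)) n, w l ω * Complex.exp (Complex.I * l * ϑ)

lemma spectrum_nonneg (hX : IsSpectralField P C w X) (l : ℤ) : 0 ≤ C l.natAbs := by
  rw [← hX.power l]
  exact integral_nonneg fun ω => by positivity

lemma memLp_partialSum (hX : IsSpectralField P C w X) (n : ℕ) (ϑ : ℝ) :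
    MemLp (partialSum w n ϑ) 2 P :=
  memLp_finsetSum _ fun l _ => (hX.memLp l).mul_const _

lemma memLp_field (hX : IsSpectralField P C w X) (ϑ : ℝ) : MemLp (fun ω => (X ϑ ω : ℂ)) 2 P := by
  have hm : AEStronglyMeasurable (fun ω => (X ϑ ω : ℂ)) P :=
    (Complex.measurable_ofReal.comp_aemeasurable (hX.aemeasurable ϑ)).aestronglyMeasurable
  -- Some partial sum lies at finite `L²` distance from the field and is itself square integrable.
  obtain ⟨n, hn⟩ := ((hX.series ϑ).eventually (gt_mem_nhds (zero_lt_one))).exists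
  have h1 : MemLp (fun ω => (X ϑ ω : ℂ) - partialSum w n ϑ ω) 2 P :=
    ⟨hm.sub (hX.memLp_partialSum n ϑ).1, hn.trans ENNReal.one_lt_top⟩
  exact (memLp_congr_ae (ae_of_all _ fun ω => by simp)).mp (h1.add (hX.memLp_partialSum n ϑ))

lemma integral_partialSum_mul_conj (hX : IsSpectralField P C w X) (n : ℕ) (s t : ℝ) :
    ∫ ω, partialSum w n s ω * (starRingEnd ℂ) (partialSum w n t ω) ∂P =
      ∑ l ∈ Finset.Icc (-(n : ℤ)) n, (C l.natAbs : ℂ) *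
        (Complex.exp (Complex.I * l * s) * (starRingEnd ℂ) (Complex.exp (Complex.I * l * t))) := by
  have hi : ∀ l m, Integrable (fun ω => w l ω * (starRingEnd ℂ) (w m ω)) P := fun l m =>
    (hX.memLp l).integrable_mul (hX.memLp m).star
  have hv : ∀ l m, ∫ ω, w l ω * (starRingEnd ℂ) (w m ω) ∂P =
      if l = m then (C l.natAbs : ℂ) else 0 := by
    intro l m
    by_cases h : l = m
    · subst h
      rw [if_pos rfl, ← hX.power l, ← integral_complex_ofReal]
      refine integral_congr_ae (ae_of_all _ fun ω => ?_)
      simp [Complex.mul_conj, Complex.normSq_eq_norm_sq]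
    · rw [if_neg h, hX.uncorrelated l m h]
  have he : ∀ ω, partialSum w n s ω * (starRingEnd ℂ) (partialSum w n t ω) =
      ∑ l ∈ Finset.Icc (-(n : ℤ)) n, ∑ m ∈ Finset.Icc (-(n : ℤ)) n,
        (w l ω * (starRingEnd ℂ) (w m ω)) * (Complex.exp (Complex.I * l * s) *
          (starRingEnd ℂ) (Complex.exp (Complex.I * m * t))) := fun ω => by
    simp only [partialSum, map_sum, map_mul, Finset.sum_mul_sum]
    exact Finset.sum_congr rfl fun l _ => Finset.sum_congr rfl fun m _ => by ring
  simp only [he]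
  rw [integral_finsetSum _ fun l _ => integrable_finsetSum _ fun m _ => (hi l m).mul_const _]
  refine Finset.sum_congr rfl fun l hl => ?_
  rw [integral_finsetSum _ fun m _ => (hi l m).mul_const _]
  simp only [integral_mul_const, hv, ite_mul, zero_mul]
  rw [Finset.sum_ite_eq, if_pos hl]

lemma tendsto_covariance (hX : IsSpectralField P C w X) (s t : ℝ) :
    Tendsto (fun n : ℕ => ∑ l ∈ Finset.Icc (-(n : ℤ)) n, (C l.natAbs : ℂ) *
        (Complex.exp (Complex.I * l * s) * (starRingEnd ℂ) (Complex.exp (Complex.I * l * t))))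
      atTop (𝓝 ((∫ ω, X s ω * X t ω ∂P : ℝ) : ℂ)) := by
  have h := tendsto_integral_mul_conj (fun n => hX.memLp_partialSum n s)
    (fun n => hX.memLp_partialSum n t) (hX.memLp_field s) (hX.memLp_field t) (hX.series s)
    (hX.series t)
  simp only [hX.integral_partialSum_mul_conj] at h
  convert h using 2
  rw [← integral_complex_ofReal]
  simp

lemma integrable_field_mul (hX : IsSpectralField P C w X) (s t : ℝ) :
    Integrable (fun ω => X s ω * X t ω) P := by
  have h := (hX.memLp_field s).integrable_mul (hX.memLp_field t)
  refine h.re.congr (ae_of_all _ fun ω => ?_)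
  simp

variable [IsProbabilityMeasure P]

/-- The mean is the `L²` pairing with the constant `1`, so it is the limit of the zero means of the
partial sums. -/
lemma integral_field (hX : IsSpectralField P C w X) (ϑ : ℝ) : ∫ ω, X ϑ ω ∂P = 0 := by
  have h := tendsto_integral_mul_conj (g := fun _ _ => 1) (G := fun _ => 1)
    (fun n => hX.memLp_partialSum n ϑ) (fun _ => memLp_const 1) (hX.memLp_field ϑ) (memLp_const 1)
    (hX.series ϑ) (by simp)
  have h0 : ∀ n, ∫ ω, partialSum w n ϑ ω * (starRingEnd ℂ) 1 ∂P = 0 := fun n => by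
    simp only [map_one, mul_one, partialSum]
    rw [integral_finsetSum _ fun l _ => ((hX.memLp l).integrable one_le_two).mul_const _]
    simp [integral_mul_const, hX.mean]
  simp only [h0] at h
  simp only [map_one, mul_one, integral_complex_ofReal] at h
  exact_mod_cast (tendsto_nhds_unique tendsto_const_nhds h).symm

lemma integrable_field (hX : IsSpectralField P C w X) (s : ℝ) : Integrable (X s) P := by
  refine ((hX.memLp_field s).integrable one_le_two).re.congr (ae_of_all _ fun ω => ?_)
  simp

end IsSpectralField

/-- The discrete Fourier coefficient of the sampled needlet. -/
noncomputable def aliasCoeff (a : ℝ → ℝ) (M N k : ℕ) (l : ℤ) : ℂ :=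
  (1 / M : ℝ) * ∑ m ∈ Finset.range M,
    (psi a N (2 * Real.pi * m / M - k * (2 * Real.pi / N)) : ℂ) *
      Complex.exp (Complex.I * l * ((2 * Real.pi * m / M : ℝ) : ℂ))

namespace IsSpectralField

lemma integral_sampledCoeff [IsProbabilityMeasure P] (hX : IsSpectralField P C w X) (a : ℝ → ℝ) (M N k : ℕ) :
    ∫ ω, sampledCoeff a X M N k ω ∂P = 0 := by
  simp only [sampledCoeff]
  rw [integral_const_mul, integral_finsetSum _ fun m _ => (hX.integrable_field _).mul_const _]
  simp [integral_mul_const, hX.integral_field]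

/-- Formally, a sampled coefficient is `∑_l w_l` times its alias coefficient, and the `w_l` are
uncorrelated. The limit is taken at the finitely many pairs of sampling points, so no infinite sums
have to be interchanged. -/
lemma tendsto_covariance_sampledCoeff (hX : IsSpectralField P C w X) (a : ℝ → ℝ) (M N k k' : ℕ) :
    Tendsto (fun n : ℕ => ∑ l ∈ Finset.Icc (-(n : ℤ)) n, (C l.natAbs : ℂ) *
        (aliasCoeff a M N k l * (starRingEnd ℂ) (aliasCoeff a M N k' l)))
      atTop (𝓝 ((∫ ω, sampledCoeff a X M N k ω * sampledCoeff a X M N k' ω ∂P : ℝ) : ℂ)) := by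
  set t : ℕ → ℝ := fun m => 2 * Real.pi * m / M with ht
  set p : ℕ → ℕ → ℝ := fun k m => psi a N (t m - k * (2 * Real.pi / N)) with hp
  have hR : ∫ ω, sampledCoeff a X M N k ω * sampledCoeff a X M N k' ω ∂P =
      ∑ m ∈ Finset.range M, ∑ m' ∈ Finset.range M,
        ((1 / M : ℝ) ^ 2 * (p k m * p k' m')) * ∫ ω, X (t m) ω * X (t m') ω ∂P := by
    have e : ∀ ω, sampledCoeff a X M N k ω * sampledCoeff a X M N k' ω =
        ∑ m ∈ Finset.range M, ∑ m' ∈ Finset.range M,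
          ((1 / M : ℝ) ^ 2 * (p k m * p k' m')) * (X (t m) ω * X (t m') ω) := fun ω => by
      simp only [sampledCoeff]
      rw [mul_mul_mul_comm, Finset.sum_mul_sum, Finset.mul_sum]
      refine Finset.sum_congr rfl fun m _ => ?_
      rw [Finset.mul_sum]
      exact Finset.sum_congr rfl fun m' _ => by simp only [hp, ht]; ring
    simp only [e]
    rw [integral_finsetSum _ fun m _ => integrable_finsetSum _ fun m' _ =>
      (hX.integrable_field_mul _ _).const_mul _]
    refine Finset.sum_congr rfl fun m _ => ?_
    rw [integral_finsetSum _ fun m' _ => (hX.integrable_field_mul _ _).const_mul _]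
    simp only [integral_const_mul]
  rw [hR]
  push_cast
  have h := tendsto_finsetSum (Finset.range M) fun m _ => tendsto_finsetSum (Finset.range M)
    fun m' _ => (hX.tendsto_covariance (t m) (t m')).const_mul
      ((1 / M : ℂ) ^ 2 * ((p k m : ℂ) * (p k' m' : ℂ)))
  refine h.congr fun n => ?_
  simp only [Finset.mul_sum]
  have h1 : ∀ l : ℤ, (C l.natAbs : ℂ) *
      (aliasCoeff a M N k l * (starRingEnd ℂ) (aliasCoeff a M N k' l)) =
      ∑ m ∈ Finset.range M, ∑ m' ∈ Finset.range M,
        ((1 / M : ℂ) ^ 2 * ((p k m : ℂ) * (p k' m' : ℂ))) * ((C l.natAbs : ℂ) *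
        (Complex.exp (Complex.I * l * t m) *
          (starRingEnd ℂ) (Complex.exp (Complex.I * l * t m')))) := by
    intro l
    simp only [aliasCoeff]
    rw [map_mul, map_sum, mul_mul_mul_comm, Finset.sum_mul_sum, Finset.mul_sum, Finset.mul_sum]
    refine Finset.sum_congr rfl fun m _ => ?_
    rw [Finset.mul_sum, Finset.mul_sum]
    refine Finset.sum_congr rfl fun m' _ => ?_
    simp only [map_mul, Complex.conj_ofReal, hp, ht]
    push_cast
    ring
  simp only [h1]
  rw [Finset.sum_comm (s := Finset.Icc (-(n : ℤ)) n)]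
  exact Finset.sum_congr rfl fun m _ => Finset.sum_comm.symm

end IsSpectralField

end Covariance

end TorusNeedlet

namespace TorusNeedlet

/-! ### Aliasing: zero sums, stationarity and the size of the error -/

section Aliasing

variable {a : ℝ → ℝ} {C : ℕ → ℝ} {α : ℝ}

lemma IsWindow.sq_le_one (ha : IsWindow a) (x : ℝ) : a x ^ 2 ≤ 1 := by
  obtain ⟨-, -, φ, -, h01, -, -, hφ⟩ := ha
  rw [hφ]
  linarith [(h01 (x / 2)).2, (h01 x).1]

lemma sum_exp_root_Icc (N : ℕ) (hN : N ≠ 0) (l : ℤ) :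
    ∑ k ∈ Finset.Icc 1 N, Complex.exp (Complex.I * (l * (2 * Real.pi * k / N))) =
      if (N : ℤ) ∣ l then (N : ℂ) else 0 := by
  have hN' : (N : ℂ) ≠ 0 := by exact_mod_cast hN
  have h := sum_exp_root N hN l
  have e : ∀ k : ℕ, Complex.exp (Complex.I * (l * (2 * Real.pi * (1 + k : ℕ) / N))) =
      Complex.exp (Complex.I * (l * (2 * Real.pi / N))) *
        Complex.exp (Complex.I * (l * (2 * Real.pi * k / N))) := fun k => by
    rw [← Complex.exp_add]
    congr 1
    push_cast
    ring
  have hI : Finset.Icc 1 N = Finset.Ico 1 (N + 1) := by ext; simp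
  rw [hI, Finset.sum_Ico_eq_sum_range, Nat.add_sub_cancel]
  simp only [e]
  rw [← Finset.mul_sum, h]
  split_ifs with hd
  · obtain ⟨c, rfl⟩ := hd
    have : Complex.exp (Complex.I * (((N * c : ℤ) : ℂ) * (2 * Real.pi / N))) = 1 := by
      rw [Complex.exp_eq_one_iff]
      exact ⟨c, by push_cast; field_simp⟩
    rw [this, one_mul]
  · simp

lemma psiC_shift (N k : ℕ) (t : ℝ) : psiC a N (t - k * (2 * Real.pi / N)) =
    (1 / Real.sqrt N : ℝ) * ∑ l ∈ freq N, (a (4 * l / N) : ℂ) *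
      Complex.exp (Complex.I * ((-l : ℤ) * (2 * Real.pi * k / N))) *
        Complex.exp (Complex.I * l * t) := by
  unfold psiC
  congr 1
  refine Finset.sum_congr rfl fun l _ => ?_
  conv_rhs => rw [mul_assoc, ← Complex.exp_add]
  congr 2
  push_cast
  ring

/-- Summation over the `N` centres keeps only frequencies divisible by `N`. This is the source of
the zero row sums of the covariance matrix. -/
lemma sum_psi_shift_eq_zero (ha : IsWindow a) (N : ℕ) (hN : N ≠ 0) (t : ℝ) :
    ∑ k ∈ Finset.Icc 1 N, psi a N (t - k * (2 * Real.pi / N)) = 0 := by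
  have hN' : (0 : ℝ) < N := by exact_mod_cast Nat.pos_of_ne_zero hN
  have h : ∑ k ∈ Finset.Icc 1 N, psiC a N (t - k * (2 * Real.pi / N)) = 0 := by
    simp only [psiC_shift]
    rw [← Finset.mul_sum, Finset.sum_comm]
    refine mul_eq_zero_of_right _ (Finset.sum_eq_zero fun l hl => ?_)
    rw [← Finset.sum_mul, ← Finset.mul_sum, sum_exp_root_Icc N hN]
    split_ifs with hd
    · suffices a (4 * l / N) = 0 by simp [this]
      -- At `l = N c` the window is evaluated at `4c`, which is `0` or at least `4` in absolute
      -- value, outside its support.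
      refine ha.eq_zero ?_
      obtain ⟨c, hc⟩ := (dvd_neg.mp hd)
      by_cases hc0 : c = 0
      · left; simp [hc, hc0]
      · right
        rw [hc]
        push_cast
        rw [show (4 * (N * c) / N : ℝ) = 4 * c by field_simp, abs_mul]
        have : (1 : ℝ) ≤ |(c : ℝ)| := by exact_mod_cast Int.one_le_abs hc0
        rw [abs_of_pos (by norm_num : (0 : ℝ) < 4)]
        linarith
    · simp
  simp only [psi]
  rw [← Complex.re_sum, h, Complex.zero_re]

lemma sum_sampledCoeff_eq_zero {Ω : Type*} (ha : IsWindow a) (X : ℝ → Ω → ℝ) (M N : ℕ)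
    (hN : N ≠ 0) (ω : Ω) : ∑ k ∈ Finset.Icc 1 N, sampledCoeff a X M N k ω = 0 := by
  unfold sampledCoeff
  rw [← Finset.mul_sum, Finset.sum_comm]
  simp [← Finset.mul_sum, sum_psi_shift_eq_zero ha N hN]

/-- Orthogonality of the `M`-th roots of unity: sampling identifies frequencies modulo `M`. -/
lemma aliasCoeff_eq (ha : IsWindow a) {M : ℕ} (hM : M ≠ 0) (N k : ℕ) (l : ℤ) :
    aliasCoeff a M N k l = (1 / Real.sqrt N : ℝ) * ∑ l' ∈ freq N,
      if (M : ℤ) ∣ l + l' then (a (4 * l' / N) : ℂ) *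
        Complex.exp (Complex.I * ((-l' : ℤ) * (2 * Real.pi * k / N))) else 0 := by
  have hM' : (M : ℂ) ≠ 0 := by exact_mod_cast hM
  unfold aliasCoeff
  simp only [ofReal_psi ha.2.1, psiC_shift]
  have e : ∀ m : ℕ, (((1 / Real.sqrt N : ℝ) : ℂ) * ∑ l' ∈ freq N, (a (4 * l' / N) : ℂ) *
      Complex.exp (Complex.I * ((-l' : ℤ) * (2 * Real.pi * k / N))) *
        Complex.exp (Complex.I * l' * ((2 * Real.pi * m / M : ℝ) : ℂ))) *
        Complex.exp (Complex.I * l * ((2 * Real.pi * m / M : ℝ) : ℂ)) =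
      ((1 / Real.sqrt N : ℝ) : ℂ) * ∑ l' ∈ freq N, ((a (4 * l' / N) : ℂ) *
      Complex.exp (Complex.I * ((-l' : ℤ) * (2 * Real.pi * k / N)))) *
        Complex.exp (Complex.I * ((l + l' : ℤ) * (2 * Real.pi * m / M))) := fun m => by
    rw [mul_assoc, Finset.sum_mul]
    congr 1
    refine Finset.sum_congr rfl fun l' _ => ?_
    rw [mul_assoc, ← Complex.exp_add]
    congr 2
    push_cast
    ring
  simp only [e]
  rw [← Finset.mul_sum, Finset.sum_comm, mul_left_comm]
  congr 1
  rw [Finset.mul_sum]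
  refine Finset.sum_congr rfl fun l' _ => ?_
  rw [← Finset.mul_sum, sum_exp_root M hM]
  split_ifs
  · push_cast
    field_simp
  · simp

/-- A residue class modulo `M` contains at most one frequency of `[-N, N]`, so no cross terms
survive and the product depends on the two centres only through `k' - k`. -/
lemma aliasCoeff_mul_conj (ha : IsWindow a) {M N : ℕ} (hMN : 2 * N < M) (k k' : ℕ) (l : ℤ) :
    aliasCoeff a M N k l * (starRingEnd ℂ) (aliasCoeff a M N k' l) =
      (1 / N : ℝ) * ∑ l' ∈ freq N, if (M : ℤ) ∣ l + l' then ((a (4 * l' / N) ^ 2 : ℝ) : ℂ) *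
        Complex.exp (Complex.I * (l' * (((k' : ℝ) - k) * (2 * Real.pi / N) : ℝ))) else 0 := by
  have hM : M ≠ 0 := by omega
  have hs : ((1 / Real.sqrt N : ℝ) : ℂ) * ((1 / Real.sqrt N : ℝ) : ℂ) = ((1 / N : ℝ) : ℂ) := by
    rw [← Complex.ofReal_mul]
    congr 1
    rw [div_mul_div_comm, Real.mul_self_sqrt (Nat.cast_nonneg N), one_mul]
  rw [aliasCoeff_eq ha hM, aliasCoeff_eq ha hM, map_mul, Complex.conj_ofReal, mul_mul_mul_comm, hs,
    map_sum, Finset.sum_mul_sum]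
  congr 1
  refine Finset.sum_congr rfl fun l' hl' => ?_
  rw [Finset.sum_eq_single l']
  · split_ifs
    · rw [map_mul, Complex.conj_ofReal, ← Complex.exp_conj, mul_mul_mul_comm, ← Complex.exp_add]
      congr 1
      · push_cast; ring
      · congr 1
        simp only [map_mul, Complex.conj_I, map_div₀, Complex.conj_ofReal, map_natCast, map_intCast,
          map_ofNat]
        push_cast
        ring
    · simp
  · intro l'' hl'' hne
    by_cases h1 : (M : ℤ) ∣ l + l'
    · by_cases h2 : (M : ℤ) ∣ l + l''
      · exfalso
        -- Two such frequencies would differ by a multiple of `M` that is at most `2N < M` in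
        -- absolute value.
        have h3 : (M : ℤ) ∣ l' - l'' := by
          have := dvd_sub h1 h2
          rwa [add_sub_add_left_eq_sub] at this
        simp only [freq, Finset.mem_Icc] at hl' hl''
        have h4 := Int.eq_zero_of_abs_lt_dvd h3 (by rw [abs_lt]; omega)
        omega
      · simp [h2]
    · simp [h1]
  · exact fun h => absurd hl' h

/-- The folded spectrum seen by `M` samples, from the frequencies in `[-n, n]`. -/
noncomputable def foldedSpectrum (C : ℕ → ℝ) (M n : ℕ) (l' : ℤ) : ℝ :=
  ∑ l ∈ Finset.Icc (-(n : ℤ)) n, if (M : ℤ) ∣ l + l' then C l.natAbs else 0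

/-- The term `l = -l'` reproduces the original spectrum. The others are `l = M j - l'` with `j ≠ 0`,
hence `|l| ≥ M|j|/2`, and their spectrum sums to order `M^{-α}` since `α > 1`. -/
lemma abs_foldedSpectrum_sub_le (hα : 1 < α) {c : ℝ} (hc : 0 ≤ c)
    (hC0 : ∀ l, 0 ≤ C l) (hC : ∀ l : ℕ, 1 ≤ l → C l ≤ c * (l : ℝ) ^ (-α)) {M N n : ℕ}
    (hMN : 2 * N < M) (hn : N ≤ n) {l' : ℤ} (hl' : l' ∈ freq N) :
    |foldedSpectrum C M n l' - C l'.natAbs| ≤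
      c * 2 ^ α * (∑' j : ℤ, |(j : ℝ)| ^ (-α)) * (M : ℝ) ^ (-α) := by
  have hM : (0 : ℝ) < M := by exact_mod_cast (by omega : 0 < M)
  simp only [freq, Finset.mem_Icc] at hl'
  have hmem : -l' ∈ (Finset.Icc (-(n : ℤ)) n) := by
    simp only [Finset.mem_Icc]; omega
  have e1 : foldedSpectrum C M n l' - C l'.natAbs =
      ∑ l ∈ ((Finset.Icc (-(n : ℤ)) n).erase (-l')).filter (fun l => (M : ℤ) ∣ l + l'),
        C l.natAbs := by
    unfold foldedSpectrum
    rw [Finset.sum_filter, ← Finset.add_sum_erase _ _ hmem]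
    simp
  set s := ((Finset.Icc (-(n : ℤ)) n).erase (-l')).filter (fun l => (M : ℤ) ∣ l + l') with hs
  have hsum : Summable fun j : ℤ => |(j : ℝ)| ^ (-α) := Real.summable_abs_int_rpow hα
  rw [e1, abs_of_nonneg (Finset.sum_nonneg fun _ _ => hC0 _)]
  have hterm : ∀ l ∈ s, C l.natAbs ≤
      c * 2 ^ α * (M : ℝ) ^ (-α) * |(((l + l') / M : ℤ) : ℝ)| ^ (-α) := by
    intro l hl
    simp only [hs, Finset.mem_filter, Finset.mem_erase] at hl
    obtain ⟨⟨hne, -⟩, j, hj⟩ := hl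
    have hMZ : (M : ℤ) ≠ 0 := by exact_mod_cast hM.ne'
    have hj0 : j ≠ 0 := by
      rintro rfl
      apply hne
      omega
    rw [hj, Int.mul_ediv_cancel_left _ hMZ]
    have hj1 : (1 : ℝ) ≤ |(j : ℝ)| := by exact_mod_cast Int.one_le_abs hj0
    have hl'R : |(l' : ℝ)| ≤ N := by
      rw [abs_le]; constructor <;> [exact_mod_cast hl'.1; exact_mod_cast hl'.2]
    have hMNR : 2 * (N : ℝ) < M := by exact_mod_cast hMN
    have hlR : (l : ℝ) = M * j - l' := by
      have : l = M * j - l' := by omega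
      rw [this]; push_cast; ring
    have hlow : M * |(j : ℝ)| / 2 ≤ |(l : ℝ)| := by
      have h1 : |(M * j : ℝ)| - |(l' : ℝ)| ≤ |(l : ℝ)| := by
        rw [hlR]; exact abs_sub_abs_le_abs_sub _ _
      rw [abs_mul, abs_of_pos hM] at h1
      nlinarith
    have hpos : 0 < M * |(j : ℝ)| / 2 := by positivity
    have hl1 : 1 ≤ l.natAbs := by
      rw [Nat.one_le_iff_ne_zero, Int.natAbs_ne_zero]
      rintro rfl
      simp only [Int.cast_zero, abs_zero] at hlow
      linarith
    have hcast : (l.natAbs : ℝ) = |(l : ℝ)| := by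
      rw [Nat.cast_natAbs, Int.cast_abs]
    refine (hC _ hl1).trans ?_
    rw [hcast]
    have h2 : |(l : ℝ)| ^ (-α) ≤ (M * |(j : ℝ)| / 2) ^ (-α) :=
      Real.rpow_le_rpow_of_nonpos hpos hlow (by linarith)
    have h3 : (M * |(j : ℝ)| / 2) ^ (-α) = 2 ^ α * (M : ℝ) ^ (-α) * |(j : ℝ)| ^ (-α) := by
      rw [Real.div_rpow (by positivity) (by norm_num), Real.mul_rpow hM.le (abs_nonneg _),
        Real.rpow_neg (by norm_num : (0 : ℝ) ≤ 2) α, div_inv_eq_mul]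
      ring
    calc c * |(l : ℝ)| ^ (-α) ≤ c * (2 ^ α * (M : ℝ) ^ (-α) * |(j : ℝ)| ^ (-α)) := by
          rw [← h3]; exact mul_le_mul_of_nonneg_left h2 hc
      _ = _ := by ring
  have hinj : Set.InjOn (fun l : ℤ => (l + l') / (M : ℤ)) s := by
    intro x hx y hy hxy
    simp only [hs, Finset.coe_filter, Set.mem_ofPred_eq] at hx hy
    have h1 := Int.ediv_mul_cancel hx.2
    have h2 := Int.ediv_mul_cancel hy.2
    simp only at hxy
    rw [hxy, h2] at h1
    omega
  calc ∑ l ∈ s, C l.natAbs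
      ≤ ∑ l ∈ s, c * 2 ^ α * (M : ℝ) ^ (-α) * |(((l + l') / M : ℤ) : ℝ)| ^ (-α) :=
        Finset.sum_le_sum hterm
    _ = c * 2 ^ α * (M : ℝ) ^ (-α) *
        ∑ j ∈ s.image (fun l : ℤ => (l + l') / (M : ℤ)), |(j : ℝ)| ^ (-α) := by
        rw [Finset.sum_image hinj, Finset.mul_sum]
    -- The quotients `j` are distinct, so the sum is part of the nonnegative series over all
    -- integers.
    _ ≤ c * 2 ^ α * (M : ℝ) ^ (-α) * ∑' j : ℤ, |(j : ℝ)| ^ (-α) := by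
        refine mul_le_mul_of_nonneg_left (hsum.sum_le_tsum _ fun j _ => by positivity)
          (by positivity)
    _ = _ := by ring

/-- The covariance of the needlet coefficients at the `k`-th and `k'`-th centres. -/
noncomputable def specCov (a : ℝ → ℝ) (C : ℕ → ℝ) (N k k' : ℕ) : ℝ :=
  (1 / N : ℝ) * ∑ l ∈ freq N, specWeight a C N l *
    Real.cos (l * (((k' : ℝ) - k) * (2 * Real.pi / N)))

lemma specWeight_neg (ha : IsWindow a) (N : ℕ) (l : ℤ) :
    specWeight a C N (-l) = specWeight a C N l := by
  unfold specWeight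
  rw [Int.natAbs_neg, show (4 * ((-l : ℤ) : ℝ) / N) = -(4 * (l : ℝ) / N) by push_cast; ring, ha.2.1]

lemma sum_freq_comp_neg {E : Type*} [AddCommMonoid E] (N : ℕ) (F : ℤ → E) :
    ∑ l ∈ freq N, F (-l) = ∑ l ∈ freq N, F l := by
  refine Finset.sum_nbij' (fun l => -l) (fun l => -l) ?_ ?_ ?_ ?_ ?_ <;> simp [freq] <;> omega

lemma sum_specWeight_mul_exp (ha : IsWindow a) (N : ℕ) (θ : ℝ) :
    ∑ l ∈ freq N, (specWeight a C N l : ℂ) * Complex.exp (Complex.I * (l * θ)) =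
      ((∑ l ∈ freq N, specWeight a C N l * Real.cos (l * θ) : ℝ) : ℂ) := by
  have hsin : ∑ l ∈ freq N, specWeight a C N l * Real.sin (l * θ) = 0 := by
    have h := sum_freq_comp_neg N fun l : ℤ => specWeight a C N l * Real.sin (l * θ)
    simp only [specWeight_neg ha, Int.cast_neg, neg_mul, Real.sin_neg, mul_neg,
      Finset.sum_neg_distrib] at h
    linarith
  have e : ∀ l : ℤ, (specWeight a C N l : ℂ) * Complex.exp (Complex.I * (l * θ)) =
      ((specWeight a C N l * Real.cos (l * θ) : ℝ) : ℂ) +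
        ((specWeight a C N l * Real.sin (l * θ) : ℝ) : ℂ) * Complex.I := fun l => by
    rw [mul_comm Complex.I, Complex.exp_mul_I]
    push_cast
    ring
  rw [Finset.sum_congr rfl fun l _ => e l, Finset.sum_add_distrib, ← Finset.sum_mul,
    ← Complex.ofReal_sum, ← Complex.ofReal_sum, hsin]
  simp

lemma ofReal_specCov (ha : IsWindow a) (N k k' : ℕ) : (specCov a C N k k' : ℂ) =
    (1 / N : ℝ) * ∑ l ∈ freq N, (specWeight a C N l : ℂ) *
      Complex.exp (Complex.I * (l * (((k' : ℝ) - k) * (2 * Real.pi / N) : ℝ))) := by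
  rw [sum_specWeight_mul_exp ha, specCov, Complex.ofReal_mul]

lemma specCov_self (N k : ℕ) : specCov a C N k k = sigmaSq a C N := by
  simp [specCov, sigmaSq]

namespace IsSpectralField

variable {Ω : Type*} [MeasurableSpace Ω] {P : Measure Ω} {w : ℤ → Ω → ℂ} {X : ℝ → Ω → ℝ}

lemma tendsto_foldedSpectrum (hX : IsSpectralField P C w X) (ha : IsWindow a) {M N : ℕ}
    (hMN : 2 * N < M) (k k' : ℕ) :
    Tendsto (fun n : ℕ => ((1 / N : ℝ) : ℂ) * ∑ l ∈ freq N,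
        ((foldedSpectrum C M n l * a (4 * l / N) ^ 2 : ℝ) : ℂ) *
          Complex.exp (Complex.I * (l * (((k' : ℝ) - k) * (2 * Real.pi / N) : ℝ)))) atTop
      (𝓝 ((∫ ω, sampledCoeff a X M N k ω * sampledCoeff a X M N k' ω ∂P : ℝ) : ℂ)) := by
  refine (hX.tendsto_covariance_sampledCoeff a M N k k').congr fun n => ?_
  simp only [aliasCoeff_mul_conj ha hMN, foldedSpectrum]
  have h : ∀ l : ℤ, (C l.natAbs : ℂ) * (((1 / N : ℝ) : ℂ) * ∑ l' ∈ freq N,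
        if (M : ℤ) ∣ l + l' then ((a (4 * l' / N) ^ 2 : ℝ) : ℂ) *
        Complex.exp (Complex.I * (l' * (((k' : ℝ) - k) * (2 * Real.pi / N) : ℝ))) else 0) =
      ((1 / N : ℝ) : ℂ) * ∑ l' ∈ freq N,
        (((if (M : ℤ) ∣ l + l' then C l.natAbs else 0) : ℝ) : ℂ) * (((a (4 * l' / N) ^ 2 : ℝ) : ℂ) *
        Complex.exp (Complex.I * (l' * (((k' : ℝ) - k) * (2 * Real.pi / N) : ℝ)))) := by
    intro l
    rw [mul_left_comm, Finset.mul_sum]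
    congr 1
    refine Finset.sum_congr rfl fun l' _ => ?_
    split_ifs <;> simp
  simp only [h]
  rw [← Finset.mul_sum, Finset.sum_comm]
  congr 1
  refine Finset.sum_congr rfl fun l' _ => ?_
  rw [← Finset.sum_mul, ← Complex.ofReal_sum, ← mul_assoc, ← Complex.ofReal_mul]

/-- Under aliasing, the variance of a sampled needlet coefficient does not depend on its centre. -/
lemma integral_sampledCoeff_sq_eq (hX : IsSpectralField P C w X) (ha : IsWindow a) {M N : ℕ}
    (hMN : 2 * N < M) (k k' : ℕ) :
    ∫ ω, sampledCoeff a X M N k ω * sampledCoeff a X M N k ω ∂P =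
      ∫ ω, sampledCoeff a X M N k' ω * sampledCoeff a X M N k' ω ∂P := by
  have h1 := hX.tendsto_foldedSpectrum ha hMN k k
  have h2 := hX.tendsto_foldedSpectrum ha hMN k' k'
  simp only [sub_self] at h1 h2
  exact_mod_cast tendsto_nhds_unique h1 h2

/-- Up to aliasing, the sampled covariance is the spectral one; the folded spectrum differs by
`O(M^{-α})` at each frequency. The factor `3` bounds `(2N + 1) / N`. -/
lemma abs_integral_sub_specCov_le (hX : IsSpectralField P C w X) (ha : IsWindow a) (hα : 1 < α)
    {c : ℝ} (hc : 0 ≤ c) (hC : ∀ l : ℕ, 1 ≤ l → C l ≤ c * (l : ℝ) ^ (-α)) {M N : ℕ} (hN : N ≠ 0)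
    (hMN : 2 * N < M) (k k' : ℕ) :
    |∫ ω, sampledCoeff a X M N k ω * sampledCoeff a X M N k' ω ∂P - specCov a C N k k'| ≤
      3 * (c * 2 ^ α * (∑' j : ℤ, |(j : ℝ)| ^ (-α))) * (M : ℝ) ^ (-α) := by
  have hN' : (1 : ℝ) ≤ N := by exact_mod_cast Nat.one_le_iff_ne_zero.mpr hN
  have hC0 : ∀ l, 0 ≤ C l := fun l => by simpa using hX.spectrum_nonneg l
  set B := c * 2 ^ α * (∑' j : ℤ, |(j : ℝ)| ^ (-α)) * (M : ℝ) ^ (-α) with hB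
  have hB0 : 0 ≤ B := by positivity
  have h := ((hX.tendsto_foldedSpectrum ha hMN k k').sub_const (specCov a C N k k' : ℂ)).norm
  rw [← Complex.ofReal_sub, Complex.norm_real, Real.norm_eq_abs] at h
  -- The bound is uniform in the truncation `n` once `n ≥ N`, so it passes to the limit.
  refine le_of_tendsto h ?_
  filter_upwards [eventually_ge_atTop N] with n hn
  rw [ofReal_specCov ha, ← mul_sub, ← Finset.sum_sub_distrib, norm_mul, Complex.norm_real,
    Real.norm_of_nonneg (by positivity)]
  have hle : ∀ l ∈ freq N, ‖((foldedSpectrum C M n l * a (4 * l / N) ^ 2 : ℝ) : ℂ) *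
        Complex.exp (Complex.I * (l * (((k' : ℝ) - k) * (2 * Real.pi / N) : ℝ))) -
      (specWeight a C N l : ℂ) *
        Complex.exp (Complex.I * (l * (((k' : ℝ) - k) * (2 * Real.pi / N) : ℝ)))‖ ≤ B := by
    intro l hl
    have e : ‖Complex.exp (Complex.I * (l * (((k' : ℝ) - k) * (2 * Real.pi / N) : ℝ)))‖ = 1 := by
      rw [mul_comm, show ((l : ℂ) * ((((k' : ℝ) - k) * (2 * Real.pi / N) : ℝ) : ℂ)) =
        ((l * (((k' : ℝ) - k) * (2 * Real.pi / N)) : ℝ) : ℂ) by push_cast; ring,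
        Complex.norm_exp_ofReal_mul_I]
    rw [← sub_mul, norm_mul, e, mul_one, ← Complex.ofReal_sub, Complex.norm_real,
      Real.norm_eq_abs, specWeight, ← sub_mul, abs_mul, abs_of_nonneg (sq_nonneg (a _))]
    calc _ ≤ B * 1 := mul_le_mul (abs_foldedSpectrum_sub_le hα hc hC0 hC hMN hn hl)
          (ha.sq_le_one _) (sq_nonneg _) hB0
      _ = B := mul_one B
  have hcard : ((freq N).card : ℝ) = 2 * N + 1 := by
    have : (freq N).card = 2 * N + 1 := by
      simp only [freq, Int.card_Icc]
      omega
    rw [this]; push_cast; ring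
  calc _ ≤ (1 / N : ℝ) * ((freq N).card * B) := by
        refine mul_le_mul_of_nonneg_left ((norm_sum_le _ _).trans ?_) (by positivity)
        simpa using Finset.sum_le_card_nsmul _ _ _ hle
    _ ≤ 3 * B := by
        rw [hcard, div_mul_eq_mul_div, one_mul, div_le_iff₀ (by linarith)]
        nlinarith
    _ = _ := by rw [hB]; ring

end IsSpectralField

end Aliasing

end TorusNeedlet

namespace TorusNeedlet

/-! ### Normalizing variances as sums of covariance powers, and spectral bounds -/

section SpectralSums

variable {a : ℝ → ℝ} {C : ℕ → ℝ} {α : ℝ}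

lemma ofReal_fejer (N : ℕ) (j : ℤ) : (fejer N (j * (2 * Real.pi / N)) : ℂ) =
    (1 / (2 * Real.pi * N) : ℝ) * ∑ q ∈ Finset.Icc 1 N ×ˢ Finset.Icc 1 N,
      Complex.exp (Complex.I * (j * (((q.2 : ℝ) - q.1) * (2 * Real.pi / N) : ℝ))) := by
  unfold fejer
  rw [Complex.ofReal_mul, Finset.sum_product]
  congr 1
  rw [Complex.ofReal_pow, ← Complex.conj_mul', map_sum, Finset.sum_mul_sum]
  refine Finset.sum_congr rfl fun k _ => Finset.sum_congr rfl fun k' _ => ?_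
  rw [← Complex.exp_conj, ← Complex.exp_add]
  congr 1
  simp only [map_mul, Complex.conj_I, Complex.conj_ofReal, map_natCast]
  push_cast
  ring

lemma fejer_nonneg (N : ℕ) (t : ℝ) : 0 ≤ fejer N t := by
  unfold fejer
  positivity

lemma fejer_zero {N : ℕ} (hN : N ≠ 0) : fejer N 0 = N / (2 * Real.pi) := by
  have : (N : ℝ) ≠ 0 := by exact_mod_cast hN
  have hpi := Real.pi_ne_zero
  simp [fejer]
  field_simp

lemma specWeight_nonneg (hC : ∀ l, 0 ≤ C l) (N : ℕ) (l : ℤ) : 0 ≤ specWeight a C N l :=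
  mul_nonneg (hC _) (sq_nonneg _)

lemma sigmaSq_nonneg (hC : ∀ l, 0 ≤ C l) (N : ℕ) : 0 ≤ sigmaSq a C N :=
  mul_nonneg (by positivity) (Finset.sum_nonneg fun _ _ => specWeight_nonneg hC _ _)

lemma sigma_sq (hC : ∀ l, 0 ≤ C l) (N : ℕ) : sigma a C N ^ 2 = sigmaSq a C N :=
  Real.sq_sqrt (sigmaSq_nonneg hC N)

lemma abs_specCov_le (hC : ∀ l, 0 ≤ C l) (N k k' : ℕ) :
    |specCov a C N k k'| ≤ sigmaSq a C N := by
  unfold specCov sigmaSq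
  rw [abs_mul, abs_of_nonneg (by positivity : (0 : ℝ) ≤ 1 / N)]
  refine mul_le_mul_of_nonneg_left ((Finset.abs_sum_le_sum_abs _ _).trans
    (Finset.sum_le_sum fun l _ => ?_)) (by positivity)
  rw [abs_mul, abs_of_nonneg (specWeight_nonneg hC _ _)]
  exact mul_le_of_le_one_right (specWeight_nonneg hC _ _) (Real.abs_cos_le_one _)

lemma sum_exp_eq_specCov (ha : IsWindow a) {N : ℕ} (hN : N ≠ 0) (k k' : ℕ) :
    ∑ l ∈ freq N, (specWeight a C N l : ℂ) *
      Complex.exp (Complex.I * (l * (((k' : ℝ) - k) * (2 * Real.pi / N) : ℝ))) =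
      N * specCov a C N k k' := by
  have : (N : ℂ) ≠ 0 := by exact_mod_cast hN
  rw [ofReal_specCov ha, ← mul_assoc, Complex.ofReal_div, Complex.ofReal_one,
    Complex.ofReal_natCast, mul_one_div_cancel this, one_mul]

lemma sum_pow_two {ι : Type*} (s : Finset ι) (g : ι → ℂ) :
    (∑ i ∈ s, g i) ^ 2 = ∑ i ∈ s, ∑ j ∈ s, g i * g j := by
  rw [pow_two, Finset.sum_mul_sum]

lemma sum_pow_three {ι : Type*} (s : Finset ι) (g : ι → ℂ) :
    (∑ i ∈ s, g i) ^ 3 = ∑ i ∈ s, ∑ j ∈ s, ∑ k ∈ s, g i * g j * g k := by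
  rw [pow_succ, sum_pow_two, Finset.sum_mul]
  simp only [Finset.sum_mul_sum]

lemma sum_pow_four {ι : Type*} (s : Finset ι) (g : ι → ℂ) :
    (∑ i ∈ s, g i) ^ 4 = ∑ i ∈ s, ∑ j ∈ s, ∑ k ∈ s, ∑ l ∈ s, g i * g j * g k * g l := by
  rw [pow_succ, sum_pow_three, Finset.sum_mul]
  refine Finset.sum_congr rfl fun i _ => ?_
  rw [Finset.sum_mul]
  refine Finset.sum_congr rfl fun j _ => ?_
  rw [Finset.sum_mul_sum]

/-- Fejér's kernel is a double sum of exponentials over pairs of centres. Exchanging sums, the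
frequency sum factorizes into a power of `N` times the covariance; the cases of three and four
frequencies are the same. -/
lemma sum_two_fejer (ha : IsWindow a) {N : ℕ} (hN : N ≠ 0) :
    ∑ l₁ ∈ freq N, ∑ l₂ ∈ freq N,
      specWeight a C N l₁ * specWeight a C N l₂ *
        fejer N ((l₁ + l₂) * (2 * Real.pi / N)) =
    1 / (2 * Real.pi * N) * ∑ k ∈ Finset.Icc 1 N, ∑ k' ∈ Finset.Icc 1 N,
      (N * specCov a C N k k') ^ 2 := by
  rw [← Complex.ofReal_inj, ← Finset.sum_product' (Finset.Icc 1 N) (Finset.Icc 1 N)]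
  simp only [Complex.ofReal_sum, Complex.ofReal_mul, Complex.ofReal_pow, Complex.ofReal_natCast,
    ← sum_exp_eq_specCov ha hN, ← Int.cast_add, ofReal_fejer]
  simp only [sum_pow_two, Finset.mul_sum]
  rw [Finset.sum_comm (s := Finset.Icc 1 N ×ˢ Finset.Icc 1 N)]
  refine Finset.sum_congr rfl fun l₁ _ => ?_
  rw [Finset.sum_comm (s := Finset.Icc 1 N ×ˢ Finset.Icc 1 N)]
  refine Finset.sum_congr rfl fun l₂ _ => ?_
  refine Finset.sum_congr rfl fun q _ => ?_
  simp only [Int.cast_add, add_mul, mul_add, Complex.exp_add]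
  ring

lemma sum_three_fejer (ha : IsWindow a) {N : ℕ} (hN : N ≠ 0) :
    ∑ l₁ ∈ freq N, ∑ l₂ ∈ freq N, ∑ l₃ ∈ freq N,
      specWeight a C N l₁ * specWeight a C N l₂ * specWeight a C N l₃ *
        fejer N ((l₁ + l₂ + l₃) * (2 * Real.pi / N)) =
    1 / (2 * Real.pi * N) * ∑ k ∈ Finset.Icc 1 N, ∑ k' ∈ Finset.Icc 1 N,
      (N * specCov a C N k k') ^ 3 := by
  rw [← Complex.ofReal_inj, ← Finset.sum_product' (Finset.Icc 1 N) (Finset.Icc 1 N)]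
  simp only [Complex.ofReal_sum, Complex.ofReal_mul, Complex.ofReal_pow, Complex.ofReal_natCast,
    ← sum_exp_eq_specCov ha hN, ← Int.cast_add, ofReal_fejer]
  simp only [sum_pow_three, Finset.mul_sum]
  rw [Finset.sum_comm (s := Finset.Icc 1 N ×ˢ Finset.Icc 1 N)]
  refine Finset.sum_congr rfl fun l₁ _ => ?_
  rw [Finset.sum_comm (s := Finset.Icc 1 N ×ˢ Finset.Icc 1 N)]
  refine Finset.sum_congr rfl fun l₂ _ => ?_
  rw [Finset.sum_comm (s := Finset.Icc 1 N ×ˢ Finset.Icc 1 N)]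
  refine Finset.sum_congr rfl fun l₃ _ => ?_
  refine Finset.sum_congr rfl fun q _ => ?_
  simp only [Int.cast_add, add_mul, mul_add, Complex.exp_add]
  ring

lemma sum_four_fejer (ha : IsWindow a) {N : ℕ} (hN : N ≠ 0) :
    ∑ l₁ ∈ freq N, ∑ l₂ ∈ freq N, ∑ l₃ ∈ freq N, ∑ l₄ ∈ freq N,
      specWeight a C N l₁ * specWeight a C N l₂ * specWeight a C N l₃ * specWeight a C N l₄ *
        fejer N ((l₁ + l₂ + l₃ + l₄) * (2 * Real.pi / N)) =
    1 / (2 * Real.pi * N) * ∑ k ∈ Finset.Icc 1 N, ∑ k' ∈ Finset.Icc 1 N,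
      (N * specCov a C N k k') ^ 4 := by
  rw [← Complex.ofReal_inj, ← Finset.sum_product' (Finset.Icc 1 N) (Finset.Icc 1 N)]
  simp only [Complex.ofReal_sum, Complex.ofReal_mul, Complex.ofReal_pow, Complex.ofReal_natCast,
    ← sum_exp_eq_specCov ha hN, ← Int.cast_add, ofReal_fejer]
  simp only [sum_pow_four, Finset.mul_sum]
  rw [Finset.sum_comm (s := Finset.Icc 1 N ×ˢ Finset.Icc 1 N)]
  refine Finset.sum_congr rfl fun l₁ _ => ?_
  rw [Finset.sum_comm (s := Finset.Icc 1 N ×ˢ Finset.Icc 1 N)]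
  refine Finset.sum_congr rfl fun l₂ _ => ?_
  rw [Finset.sum_comm (s := Finset.Icc 1 N ×ˢ Finset.Icc 1 N)]
  refine Finset.sum_congr rfl fun l₃ _ => ?_
  rw [Finset.sum_comm (s := Finset.Icc 1 N ×ˢ Finset.Icc 1 N)]
  refine Finset.sum_congr rfl fun l₄ _ => ?_
  refine Finset.sum_congr rfl fun q _ => ?_
  simp only [Int.cast_add, add_mul, mul_add, Complex.exp_add]
  ring

lemma sigmaSSq_eq (ha : IsWindow a) (hC : ∀ l, 0 ≤ C l) {N : ℕ} (hN : N ≠ 0) :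
    sigmaSSq a C N = 6 / N * ∑ k ∈ Finset.Icc 1 N, ∑ k' ∈ Finset.Icc 1 N,
      (specCov a C N k k' / sigmaSq a C N) ^ 3 := by
  have hN' : (N : ℝ) ≠ 0 := by exact_mod_cast hN
  have h6 : sigma a C N ^ 6 = sigmaSq a C N ^ 3 := by rw [← sigma_sq hC]; ring
  rw [sigmaSSq, sum_three_fejer ha hN, h6]
  simp only [div_pow, mul_pow, ← Finset.mul_sum, ← Finset.sum_div]
  by_cases hs : sigmaSq a C N = 0
  · simp [hs]
  · field_simp
    ring

lemma sigmaU1Sq_eq (ha : IsWindow a) (hC : ∀ l, 0 ≤ C l) {N : ℕ} (hN : N ≠ 0) :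
    sigmaU1Sq a C N = 72 / N * ∑ k ∈ Finset.Icc 1 N, ∑ k' ∈ Finset.Icc 1 N,
      (specCov a C N k k' / sigmaSq a C N) ^ 2 := by
  have hN' : (N : ℝ) ≠ 0 := by exact_mod_cast hN
  have h4 : sigma a C N ^ 4 = sigmaSq a C N ^ 2 := by rw [← sigma_sq hC]; ring
  rw [sigmaU1Sq, sum_two_fejer ha hN, h4]
  simp only [div_pow, mul_pow, ← Finset.mul_sum, ← Finset.sum_div]
  by_cases hs : sigmaSq a C N = 0
  · simp [hs]
  · field_simp

lemma sigmaU2Sq_eq (ha : IsWindow a) (hC : ∀ l, 0 ≤ C l) {N : ℕ} (hN : N ≠ 0) :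
    sigmaU2Sq a C N = 24 / N * ∑ k ∈ Finset.Icc 1 N, ∑ k' ∈ Finset.Icc 1 N,
      (specCov a C N k k' / sigmaSq a C N) ^ 4 := by
  have hN' : (N : ℝ) ≠ 0 := by exact_mod_cast hN
  have h8 : sigma a C N ^ 8 = sigmaSq a C N ^ 4 := by rw [← sigma_sq hC]; ring
  rw [sigmaU2Sq, sum_four_fejer ha hN, h8]
  simp only [div_pow, mul_pow, ← Finset.mul_sum, ← Finset.sum_div]
  by_cases hs : sigmaSq a C N = 0
  · simp [hs]
  · field_simp

/-- Even powers are nonnegative, and the `N` diagonal correlations equal to one already contribute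
`72`. -/
lemma le_sigmaUSq (ha : IsWindow a) (hC : ∀ l, 0 ≤ C l) {N : ℕ} (hN : N ≠ 0)
    (hs : 0 < sigmaSq a C N) : 72 ≤ sigmaU1Sq a C N + sigmaU2Sq a C N := by
  have hN' : (0 : ℝ) < N := by exact_mod_cast Nat.pos_of_ne_zero hN
  have h2 : 0 ≤ sigmaU2Sq a C N := by
    rw [sigmaU2Sq_eq ha hC hN]
    exact mul_nonneg (by positivity) (Finset.sum_nonneg fun _ _ => Finset.sum_nonneg fun _ _ =>
      Even.pow_nonneg (by decide) _)
  have h1 : (N : ℝ) ≤ ∑ k ∈ Finset.Icc 1 N, ∑ k' ∈ Finset.Icc 1 N,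
      (specCov a C N k k' / sigmaSq a C N) ^ 2 := by
    calc (N : ℝ) = ∑ k ∈ Finset.Icc 1 N, (1 : ℝ) := by simp
      _ ≤ _ := Finset.sum_le_sum fun k hk => by
        have := Finset.single_le_sum (f := fun k' => (specCov a C N k k' / sigmaSq a C N) ^ 2)
          (fun _ _ => sq_nonneg _) hk
        simpa [specCov_self, hs.ne'] using this
  have h3 : 72 ≤ sigmaU1Sq a C N := by
    rw [sigmaU1Sq_eq ha hC hN, div_mul_eq_mul_div, le_div_iff₀ hN']
    linarith
  linarith

lemma card_freq (N : ℕ) : ((freq N).card : ℝ) = 2 * N + 1 := by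
  have : (freq N).card = 2 * N + 1 := by
    simp only [freq, Int.card_Icc]
    omega
  rw [this]; push_cast; ring

lemma natAbs_cast_real (l : ℤ) : (l.natAbs : ℝ) = |(l : ℝ)| := by
  rw [Nat.cast_natAbs, Int.cast_abs]

lemma specWeight_le (ha : IsWindow a) (hα : 0 < α) {c : ℝ} (hc : 0 ≤ c)
    (hC : ∀ l : ℕ, 1 ≤ l → C l ≤ c * (l : ℝ) ^ (-α)) {N : ℕ} (hN : N ≠ 0) (l : ℤ) :
    specWeight a C N l ≤ c * 8 ^ α * (N : ℝ) ^ (-α) := by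
  have hN' : (0 : ℝ) < N := by exact_mod_cast Nat.pos_of_ne_zero hN
  unfold specWeight
  by_cases hl : |(4 * l / N : ℝ)| ≤ 1 / 2
  · rw [ha.eq_zero (Or.inl hl)]
    simp only [ne_eq, OfNat.ofNat_ne_zero, not_false_eq_true, zero_pow, mul_zero]
    positivity
  · rw [abs_div, abs_mul, abs_of_pos hN', abs_of_pos (by norm_num : (0 : ℝ) < 4), not_le,
      lt_div_iff₀ hN'] at hl
    -- The window vanishes for `|4l/N| ≤ 1/2`, so only `|l| ≥ N/8` matters; this is the origin of `8
    -- ^ α`.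
    have h1 : (N : ℝ) / 8 ≤ |(l : ℝ)| := by linarith
    have hl1 : 1 ≤ l.natAbs := by
      rw [Nat.one_le_iff_ne_zero, Int.natAbs_ne_zero]
      rintro rfl
      simp only [Int.cast_zero, abs_zero] at h1
      linarith
    have h2 : |(l : ℝ)| ^ (-α) ≤ ((N : ℝ) / 8) ^ (-α) :=
      Real.rpow_le_rpow_of_nonpos (by positivity) h1 (by linarith)
    have h3 : ((N : ℝ) / 8) ^ (-α) = 8 ^ α * (N : ℝ) ^ (-α) := by
      rw [Real.div_rpow hN'.le (by norm_num), Real.rpow_neg (by norm_num : (0 : ℝ) ≤ 8) α,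
        div_inv_eq_mul, mul_comm]
    have h4 := hC _ hl1
    rw [natAbs_cast_real] at h4
    calc C l.natAbs * a (4 * l / N) ^ 2 ≤ (c * |(l : ℝ)| ^ (-α)) * 1 :=
          mul_le_mul h4 (ha.sq_le_one _) (sq_nonneg _) (by positivity)
      _ ≤ c * (8 ^ α * (N : ℝ) ^ (-α)) := by
          rw [mul_one, ← h3]
          exact mul_le_mul_of_nonneg_left h2 hc
      _ = _ := by ring

lemma sigmaSq_le {N : ℕ} (hN : N ≠ 0) {B : ℝ} (hB : 0 ≤ B)
    (h : ∀ l, specWeight a C N l ≤ B) : sigmaSq a C N ≤ 3 * B := by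
  have hN' : (1 : ℝ) ≤ N := by exact_mod_cast Nat.one_le_iff_ne_zero.mpr hN
  unfold sigmaSq
  have h1 : ∑ l ∈ freq N, specWeight a C N l ≤ (2 * N + 1) * B := by
    rw [← card_freq]
    simpa using Finset.sum_le_card_nsmul (freq N) _ _ fun l _ => h l
  rw [div_mul_eq_mul_div, one_mul, div_le_iff₀ (by linarith)]
  nlinarith

lemma le_specWeight (hα : 0 < α) {c : ℝ} (hc : 0 ≤ c)
    (hC : ∀ l : ℕ, 1 ≤ l → c * (l : ℝ) ^ (-α) ≤ C l) {N : ℕ} {l : ℤ}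
    (hl : l ∈ freq N) (hl0 : l ≠ 0) (hal : 1 / 4 ≤ a (4 * l / N) ^ 2) :
    c / 4 * (N : ℝ) ^ (-α) ≤ specWeight a C N l := by
  have hlN : |(l : ℝ)| ≤ N := by
    simp only [freq, Finset.mem_Icc] at hl
    rw [abs_le]; constructor <;> [exact_mod_cast hl.1; exact_mod_cast hl.2]
  have h1 := hC _ (Nat.one_le_iff_ne_zero.mpr (Int.natAbs_ne_zero.mpr hl0))
  rw [natAbs_cast_real] at h1
  have h2 : (N : ℝ) ^ (-α) ≤ |(l : ℝ)| ^ (-α) :=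
    Real.rpow_le_rpow_of_nonpos (abs_pos.mpr (by exact_mod_cast hl0)) hlN (by linarith)
  have h3 : c * (N : ℝ) ^ (-α) ≤ C l.natAbs := (mul_le_mul_of_nonneg_left h2 hc).trans h1
  calc c / 4 * (N : ℝ) ^ (-α) = c * (N : ℝ) ^ (-α) * (1 / 4) := by ring
    _ ≤ _ := mul_le_mul h3 hal (by norm_num) ((by positivity : 0 ≤ c * (N : ℝ) ^ (-α)).trans h3)

/-- At a point where `φ(ξ) = 1/2`, found by the intermediate value theorem, both `a²(ξ) = 1 - φ(ξ)`
and `a²(2ξ) = φ(ξ)` equal `1/2`. Doubling is needed because the sum of two frequencies near `ξ` must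
again carry weight. The cap `δ ≤ 1/4` keeps `ξ - δ` positive and twice the interval within range. -/
lemma IsWindow.exists_interval (ha : IsWindow a) : ∃ ξ δ : ℝ, 1 / 2 < ξ ∧ ξ ≤ 1 ∧ 0 < δ ∧
    δ ≤ 1 / 4 ∧ (∀ x, |x - ξ| ≤ δ → 1 / 4 ≤ a x ^ 2) ∧
      ∀ x, |x - 2 * ξ| ≤ 2 * δ → 1 / 4 ≤ a x ^ 2 := by
  obtain ⟨hs, -, φ, hφs, h01, h1, h0, hφ⟩ := ha
  obtain ⟨ξ, ⟨hξ1, hξ2⟩, hξ⟩ : ∃ ξ ∈ Set.Icc (1 / 2 : ℝ) 2, φ ξ = 1 / 2 := by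
    have h := intermediate_value_Icc' (by norm_num : (1 / 2 : ℝ) ≤ 2) hφs.continuous.continuousOn
    rw [h1 (1 / 2) (by norm_num), h0 2 (by norm_num)] at h
    exact h ⟨by norm_num, by norm_num⟩
  have hξ1' : 1 / 2 < ξ := by
    refine lt_of_le_of_ne hξ1 fun h => ?_
    rw [← h, h1 (1 / 2) (by norm_num)] at hξ
    norm_num at hξ
  have hξ2' : ξ ≤ 1 := by
    by_contra h
    rw [not_le] at h
    rw [h0 ξ (by rwa [abs_of_pos (by linarith)])] at hξ
    norm_num at hξ
  have e1 : a ξ ^ 2 = 1 / 2 := by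
    rw [hφ, hξ, h1 (ξ / 2) (by rw [abs_of_pos] <;> linarith)]
    norm_num
  have e2 : a (2 * ξ) ^ 2 = 1 / 2 := by
    rw [hφ, mul_div_cancel_left₀ ξ two_ne_zero, hξ,
      h0 (2 * ξ) (by rw [abs_of_pos] <;> linarith)]
    norm_num
  have hcont : Continuous fun x => a x ^ 2 := hs.continuous.pow 2
  have key : ∀ y, a y ^ 2 = 1 / 2 → ∃ δ > 0, ∀ x, |x - y| ≤ δ → 1 / 4 ≤ a x ^ 2 := fun y hy => by
    have h : ∀ᶠ x in 𝓝 y, 1 / 4 < a x ^ 2 :=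
      hcont.continuousAt.eventually (lt_mem_nhds (by simp only [hy]; norm_num))
    obtain ⟨ε, hε, hb⟩ := Metric.eventually_nhds_iff.mp h
    exact ⟨ε / 2, by positivity, fun x hx => (hb (by rw [Real.dist_eq]; linarith)).le⟩
  obtain ⟨δ₁, hδ₁, k1⟩ := key ξ e1
  obtain ⟨δ₂, hδ₂, k2⟩ := key (2 * ξ) e2
  refine ⟨ξ, min (min δ₁ (δ₂ / 2)) (1 / 4), hξ1', hξ2', by positivity, min_le_right _ _,
    fun x hx => k1 x (hx.trans ((min_le_left _ _).trans (min_le_left _ _))), fun x hx => k2 x ?_⟩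
  have := (min_le_left (min δ₁ (δ₂ / 2)) (1 / 4)).trans (min_le_right _ _)
  linarith

/-- Cubes of correlations may be negative, so the diagonal gives no lower bound for `σ_{S_N}²`. In
Fejér form every term is nonnegative, and triples with `l₃ = -(l₁ + l₂)` suffice: of order `N²`
triples, each with weight of order `N^{-3α}` and kernel value `N/(2π)`, against `σ_N⁶ N³` of order
`N^{3-3α}`. -/
lemma exists_sigma_lower_bounds (ha : IsWindow a) (hα : 0 < α) (hC0 : ∀ l, 0 ≤ C l) {c₁ c₂ : ℝ}
    (hc₁ : 0 < c₁) (hC₁ : ∀ l : ℕ, 1 ≤ l → c₁ * (l : ℝ) ^ (-α) ≤ C l)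
    (hC₂ : ∀ l : ℕ, 1 ≤ l → C l ≤ c₂ * (l : ℝ) ^ (-α)) :
    ∃ b > 0, ∀ᶠ N : ℕ in atTop, b * (N : ℝ) ^ (-α) ≤ sigmaSq a C N ∧ b ≤ sigmaSSq a C N := by
  obtain ⟨ξ, δ, hξ1, hξ2, hδ, hδ4, k1, k2⟩ := ha.exists_interval
  have hc₂ : 0 < c₂ := by
    have h1 := (hC₁ 1 le_rfl).trans (hC₂ 1 le_rfl)
    simp only [Nat.cast_one, Real.one_rpow, mul_one] at h1
    linarith
  set B := c₂ * 8 ^ α with hB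
  have hB0 : 0 < B := by positivity
  set b₁ := δ / 4 * (c₁ / 4) with hb₁
  set b₂ := 6 * (δ / 4) ^ 2 * (c₁ / 4) ^ 3 / (3 * B) ^ 3 with hb₂
  have hb₁0 : 0 < b₁ := by positivity
  have hb₂0 : 0 < b₂ := by positivity
  refine ⟨min b₁ b₂, lt_min hb₁0 hb₂0, ?_⟩
  have hlarge : ∀ᶠ N : ℕ in atTop, 4 / δ ≤ (N : ℝ) :=
    tendsto_natCast_atTop_atTop.eventually_ge_atTop _
  filter_upwards [hlarge, eventually_ge_atTop 1] with N hNδ hN1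
  have hN0 : N ≠ 0 := by omega
  have hN : (0 : ℝ) < N := by exact_mod_cast hN1
  have hNa : 0 < (N : ℝ) ^ (-α) := Real.rpow_pos_of_pos hN _
  have hNδ' : 4 ≤ N * δ := by rwa [div_le_iff₀ hδ] at hNδ
  -- Frequencies with `4l/N` within `δ` of `ξ`. There are at least `Nδ/2 - 1` of them, hence at
  -- least `Nδ/4` once `Nδ ≥ 4`.
  set J : Finset ℤ := Finset.Icc ⌈N * (ξ - δ) / 4⌉ ⌊N * (ξ + δ) / 4⌋ with hJ
  have hJcard : δ / 4 * N ≤ (J.card : ℝ) := by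
    have h1 : ((⌊N * (ξ + δ) / 4⌋ + 1 - ⌈N * (ξ - δ) / 4⌉ : ℤ) : ℝ) ≤ (J.card : ℝ) := by
      rw [hJ, Int.card_Icc]
      exact_mod_cast Int.self_le_toNat _
    push_cast at h1
    have h2 := Int.lt_floor_add_one (N * (ξ + δ) / 4)
    have h3 := Int.ceil_lt_add_one (N * (ξ - δ) / 4)
    linarith
  have hJmem : ∀ l ∈ J, N * (ξ - δ) / 4 ≤ (l : ℝ) ∧ (l : ℝ) ≤ N * (ξ + δ) / 4 := fun l hl => by
    rw [hJ, Finset.mem_Icc] at hl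
    exact ⟨(Int.le_ceil _).trans (by exact_mod_cast hl.1),
      le_trans (by exact_mod_cast hl.2) (Int.floor_le _)⟩
  have hJpos : 0 < N * (ξ - δ) / 4 := by
    have : 0 < ξ - δ := by linarith
    positivity
  have hfreq : ∀ l : ℤ, |(l : ℝ)| ≤ N → l ∈ freq N := fun l hl => by
    rw [abs_le] at hl
    simp only [freq, Finset.mem_Icc]
    exact ⟨by exact_mod_cast hl.1, by exact_mod_cast hl.2⟩
  have hJfreq : ∀ l ∈ J, l ∈ freq N := fun l hl => by
    obtain ⟨h1, h2⟩ := hJmem l hl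
    refine hfreq l ?_
    rw [abs_of_pos (by linarith)]
    nlinarith
  have hf₁ : ∀ l ∈ J, c₁ / 4 * (N : ℝ) ^ (-α) ≤ specWeight a C N l := fun l hl => by
    obtain ⟨h1, h2⟩ := hJmem l hl
    refine le_specWeight hα hc₁.le hC₁ (hJfreq l hl) ?_ (k1 _ ?_)
    · rintro rfl
      simp only [Int.cast_zero] at h1
      linarith
    · rw [abs_le]
      constructor
      · rw [neg_le_sub_iff_le_add, ← sub_le_iff_le_add, le_div_iff₀ hN]
        linarith
      · rw [sub_le_iff_le_add, div_le_iff₀ hN]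
        linarith
  -- The sum of two frequencies of `J` falls in the interval around `2ξ`, where the window is also
  -- bounded below.
  have hneg : ∀ l ∈ J, ∀ m ∈ J, -(l + m) ∈ freq N ∧
      c₁ / 4 * (N : ℝ) ^ (-α) ≤ specWeight a C N (-(l + m)) := fun l hl m hm => by
    obtain ⟨h1, h2⟩ := hJmem l hl
    obtain ⟨h3, h4⟩ := hJmem m hm
    have hmem : l + m ∈ freq N := by
      refine hfreq _ ?_
      push_cast
      rw [abs_of_pos (by linarith)]
      nlinarith
    refine ⟨by simp only [freq, Finset.mem_Icc] at hmem ⊢; omega, ?_⟩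
    rw [specWeight_neg ha]
    refine le_specWeight hα hc₁.le hC₁ hmem ?_ (k2 _ ?_)
    · intro h0
      have : (l : ℝ) + m = 0 := by exact_mod_cast h0
      linarith
    · push_cast
      rw [abs_le]
      constructor
      · rw [neg_le_sub_iff_le_add, ← sub_le_iff_le_add, le_div_iff₀ hN]
        linarith
      · rw [sub_le_iff_le_add, div_le_iff₀ hN]
        linarith
  have hf0 := fun l => specWeight_nonneg (a := a) hC0 N l
  have hs : b₁ * (N : ℝ) ^ (-α) ≤ sigmaSq a C N := by
    unfold sigmaSq
    have h1 : (J.card : ℝ) * (c₁ / 4 * (N : ℝ) ^ (-α)) ≤ ∑ l ∈ freq N, specWeight a C N l :=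
      calc _ ≤ ∑ l ∈ J, specWeight a C N l := by
            simpa using Finset.card_nsmul_le_sum J _ _ hf₁
        _ ≤ _ := Finset.sum_le_sum_of_subset_of_nonneg hJfreq fun l _ _ => hf0 l
    have h2 : δ / 4 * N * (c₁ / 4 * (N : ℝ) ^ (-α)) ≤ ∑ l ∈ freq N, specWeight a C N l :=
      (mul_le_mul_of_nonneg_right hJcard (by positivity)).trans h1
    rw [div_mul_eq_mul_div, one_mul, le_div_iff₀ hN]
    calc _ = δ / 4 * N * (c₁ / 4 * (N : ℝ) ^ (-α)) := by rw [hb₁]; ring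
      _ ≤ _ := h2
  have hspos : 0 < sigmaSq a C N := lt_of_lt_of_le (by positivity) hs
  refine ⟨(mul_le_mul_of_nonneg_right (min_le_left _ _) hNa.le).trans hs,
    (min_le_right _ _).trans ?_⟩
  have hsup : sigmaSq a C N ≤ 3 * B * (N : ℝ) ^ (-α) := by
    have := sigmaSq_le hN0 (by positivity : 0 ≤ B * (N : ℝ) ^ (-α))
      fun l => specWeight_le ha hα hc₂.le hC₂ hN0 l
    linarith
  set q := c₁ / 4 * (N : ℝ) ^ (-α) with hq
  have hq0 : 0 < q := by positivity
  set T := q ^ 3 * (N / (2 * Real.pi)) with hT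
  have hT0 : 0 < T := by positivity
  have hterm0 : ∀ l₁ l₂ l₃ : ℤ, 0 ≤ specWeight a C N l₁ * specWeight a C N l₂ *
      specWeight a C N l₃ * fejer N ((l₁ + l₂ + l₃) * (2 * Real.pi / N)) := fun l₁ l₂ l₃ =>
    mul_nonneg (mul_nonneg (mul_nonneg (hf0 _) (hf0 _)) (hf0 _)) (fejer_nonneg _ _)
  have h3 : ∀ l₁ ∈ J, ∀ l₂ ∈ J, T ≤ ∑ l₃ ∈ freq N, specWeight a C N l₁ * specWeight a C N l₂ *
      specWeight a C N l₃ * fejer N ((l₁ + l₂ + l₃) * (2 * Real.pi / N)) := fun l₁ h₁ l₂ h₂ => by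
    obtain ⟨hm, hw⟩ := hneg l₁ h₁ l₂ h₂
    refine le_trans ?_ (Finset.single_le_sum (fun l₃ _ => hterm0 l₁ l₂ l₃) hm)
    -- The three frequencies cancel, so Fejér's kernel takes its value at zero.
    rw [show ((l₁ : ℝ) + l₂ + ((-(l₁ + l₂) : ℤ) : ℝ)) * (2 * Real.pi / N) = 0 by push_cast; ring,
      fejer_zero hN0, hT, pow_succ, pow_two]
    refine mul_le_mul_of_nonneg_right ?_ (by positivity)
    exact mul_le_mul (mul_le_mul (hf₁ _ h₁) (hf₁ _ h₂) hq0.le (hf0 _)) hw hq0.le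
      (mul_nonneg (hf0 _) (hf0 _))
  have h2 : ∀ l₁ ∈ J, (J.card : ℝ) * T ≤ ∑ l₂ ∈ freq N, ∑ l₃ ∈ freq N,
      specWeight a C N l₁ * specWeight a C N l₂ * specWeight a C N l₃ *
        fejer N ((l₁ + l₂ + l₃) * (2 * Real.pi / N)) := fun l₁ h₁ =>
    calc _ ≤ ∑ l₂ ∈ J, _ := by simpa using Finset.card_nsmul_le_sum J _ _ (h3 l₁ h₁)
      _ ≤ _ := Finset.sum_le_sum_of_subset_of_nonneg hJfreq fun l₂ _ _ =>
        Finset.sum_nonneg fun l₃ _ => hterm0 l₁ l₂ l₃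
  have h1 : (J.card : ℝ) * ((J.card : ℝ) * T) ≤ ∑ l₁ ∈ freq N, ∑ l₂ ∈ freq N, ∑ l₃ ∈ freq N,
      specWeight a C N l₁ * specWeight a C N l₂ * specWeight a C N l₃ *
        fejer N ((l₁ + l₂ + l₃) * (2 * Real.pi / N)) :=
    calc _ ≤ ∑ l₁ ∈ J, _ := by simpa using Finset.card_nsmul_le_sum J _ _ h2
      _ ≤ _ := Finset.sum_le_sum_of_subset_of_nonneg hJfreq fun l₁ _ _ =>
        Finset.sum_nonneg fun l₂ _ => Finset.sum_nonneg fun l₃ _ => hterm0 l₁ l₂ l₃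
  have h0 : (δ / 4 * N) * ((δ / 4 * N) * T) ≤ (J.card : ℝ) * ((J.card : ℝ) * T) := by gcongr
  have h6 : sigma a C N ^ 6 = sigmaSq a C N ^ 3 := by rw [← sigma_sq hC0]; ring
  unfold sigmaSSq
  rw [h6]
  have hS3 : sigmaSq a C N ^ 3 ≤ (3 * B * (N : ℝ) ^ (-α)) ^ 3 := by gcongr
  calc b₂ = 12 * Real.pi / (3 * B * (N : ℝ) ^ (-α)) ^ 3 * (1 / (N : ℝ) ^ 3) *
        ((δ / 4 * N) * ((δ / 4 * N) * T)) := by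
        rw [hb₂, hT, hq]
        have := Real.pi_ne_zero
        field_simp
        ring
    _ ≤ 12 * Real.pi / sigmaSq a C N ^ 3 * (1 / (N : ℝ) ^ 3) *
        ((δ / 4 * N) * ((δ / 4 * N) * T)) := by gcongr
    _ ≤ _ := mul_le_mul_of_nonneg_left (h0.trans h1) (by positivity)

/-- Parseval's identity for the discrete Fourier transform of length `N`, over three full periods
covering `[-N, N]`. -/
lemma sum_norm_sq_exp_le {N : ℕ} (hN : N ≠ 0) (v : ℕ → ℝ) :
    ∑ l ∈ freq N, ‖∑ k ∈ Finset.Icc 1 N, (v k : ℂ) *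
      Complex.exp (Complex.I * (l * (k * (2 * Real.pi / N))))‖ ^ 2 ≤
      3 * N * ∑ k ∈ Finset.Icc 1 N, v k ^ 2 := by
  have hN' : (N : ℂ) ≠ 0 := by exact_mod_cast hN
  set h : ℤ → ℝ := fun l => ‖∑ k ∈ Finset.Icc 1 N, (v k : ℂ) *
      Complex.exp (Complex.I * (l * (k * (2 * Real.pi / N))))‖ ^ 2 with hh
  have h0 : ∀ l, 0 ≤ h l := fun l => by positivity
  -- The `3N` consecutive integers from `-N` to `2N - 1`.
  have hsub : freq N ⊆ (Finset.range (3 * N)).image fun m : ℕ => (m : ℤ) - N := by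
    intro l hl
    simp only [freq, Finset.mem_Icc] at hl
    rw [Finset.mem_image]
    exact ⟨(l + N).toNat, by rw [Finset.mem_range]; omega, by omega⟩
  have e1 : ∑ l ∈ freq N, h l ≤ ∑ m ∈ Finset.range (3 * N), h ((m : ℤ) - N) := by
    rw [← Finset.sum_image (f := h) (g := fun m : ℕ => (m : ℤ) - N) (s := Finset.range (3 * N))
      (fun x _ y _ hxy => by simpa using hxy)]
    exact Finset.sum_le_sum_of_subset_of_nonneg hsub fun l _ _ => h0 l
  refine e1.trans (le_of_eq ?_)
  rw [← Complex.ofReal_inj]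
  simp only [hh]
  -- The sum is written with roots of unity of order `3N` and exponents `3(k' - k)`. The shift of
  -- the frequency by `N` changes the phase by a multiple of `2π`.
  have e2 : ∀ m : ℕ, (((‖∑ k ∈ Finset.Icc 1 N, (v k : ℂ) * Complex.exp (Complex.I *
      ((((m : ℤ) - N : ℤ) : ℂ) * (k * (2 * Real.pi / N))))‖ ^ 2 : ℝ)) : ℂ) =
      ∑ k ∈ Finset.Icc 1 N, ∑ k' ∈ Finset.Icc 1 N, ((v k : ℂ) * v k') *
        Complex.exp (Complex.I * ((3 * ((k' : ℤ) - k) : ℤ) *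
          (2 * Real.pi * m / (3 * N : ℕ)))) := by
    intro m
    rw [Complex.ofReal_pow, ← Complex.conj_mul', map_sum, Finset.sum_mul_sum]
    refine Finset.sum_congr rfl fun k _ => Finset.sum_congr rfl fun k' _ => ?_
    rw [map_mul, Complex.conj_ofReal, ← Complex.exp_conj, mul_mul_mul_comm, ← Complex.exp_add]
    congr 1
    rw [Complex.exp_eq_exp_iff_exists_int]
    refine ⟨(k : ℤ) - k', ?_⟩
    simp only [map_mul, map_div₀, Complex.conj_I, Complex.conj_ofReal, map_natCast, map_intCast,
      map_ofNat]
    push_cast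
    field_simp
    ring
  rw [Complex.ofReal_sum]
  simp only [e2]
  rw [Finset.sum_comm]
  push_cast
  rw [Finset.mul_sum]
  refine Finset.sum_congr rfl fun k hk => ?_
  rw [Finset.sum_comm, Finset.sum_eq_single k]
  · rw [← Finset.mul_sum]
    have := sum_exp_root (3 * N) (by omega) (3 * ((k : ℤ) - k))
    push_cast at this
    rw [this]
    simp
    ring
  · intro k' hk' hne
    rw [← Finset.mul_sum]
    have := sum_exp_root (3 * N) (by omega) (3 * ((k' : ℤ) - k))
    rw [if_neg] at this
    · push_cast at this
      rw [this, mul_zero]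
    · intro hd
      push_cast at hd
      have h3 : (N : ℤ) ∣ (k' : ℤ) - k := Int.dvd_of_mul_dvd_mul_left (by norm_num) hd
      rw [Finset.mem_Icc] at hk hk'
      have h4 := Int.eq_zero_of_abs_lt_dvd h3 (by rw [abs_lt]; omega)
      omega
  · exact fun h => absurd hk h

/-- The covariance form is `1/N` times the sum of the spectral weights against the squared Fourier
transform of `v`, so a bound on the weights bounds the form. -/
lemma specCov_quadratic_le (ha : IsWindow a) {N : ℕ} (hN : N ≠ 0) {B : ℝ} (hB0 : 0 ≤ B)
    (hB : ∀ l, specWeight a C N l ≤ B) (v : ℕ → ℝ) :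
    ∑ k ∈ Finset.Icc 1 N, ∑ k' ∈ Finset.Icc 1 N, specCov a C N k k' * v k * v k' ≤
      3 * B * ∑ k ∈ Finset.Icc 1 N, v k ^ 2 := by
  have hN' : (0 : ℝ) < N := by exact_mod_cast Nat.pos_of_ne_zero hN
  have e : ∑ k ∈ Finset.Icc 1 N, ∑ k' ∈ Finset.Icc 1 N, specCov a C N k k' * v k * v k' =
      (1 / N : ℝ) * ∑ l ∈ freq N, specWeight a C N l * ‖∑ k ∈ Finset.Icc 1 N, (v k : ℂ) *
        Complex.exp (Complex.I * (l * (k * (2 * Real.pi / N))))‖ ^ 2 := by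
    rw [← Complex.ofReal_inj]
    simp only [Complex.ofReal_sum, Complex.ofReal_mul, ofReal_specCov ha, Complex.ofReal_pow]
    have e2 : ∀ l : ℤ, (specWeight a C N l : ℂ) * (‖∑ k ∈ Finset.Icc 1 N, (v k : ℂ) *
        Complex.exp (Complex.I * (l * (k * (2 * Real.pi / N))))‖ : ℂ) ^ 2 =
        ∑ k ∈ Finset.Icc 1 N, ∑ k' ∈ Finset.Icc 1 N, (specWeight a C N l : ℂ) *
          Complex.exp (Complex.I * (l * (((k' : ℝ) - k) * (2 * Real.pi / N) : ℝ))) *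
            v k * v k' := by
      intro l
      rw [← Complex.conj_mul', map_sum, Finset.sum_mul_sum, Finset.mul_sum]
      refine Finset.sum_congr rfl fun k _ => ?_
      rw [Finset.mul_sum]
      refine Finset.sum_congr rfl fun k' _ => ?_
      have e3 : Complex.exp (Complex.I * (l * (((k' : ℝ) - k) * (2 * Real.pi / N) : ℝ))) =
          (starRingEnd ℂ) (Complex.exp (Complex.I * (l * (k * (2 * Real.pi / N))))) *
            Complex.exp (Complex.I * (l * (k' * (2 * Real.pi / N)))) := by
        rw [← Complex.exp_conj, ← Complex.exp_add]
        congr 1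
        simp only [map_mul, map_div₀, Complex.conj_I, Complex.conj_ofReal, map_natCast,
          map_intCast, map_ofNat]
        push_cast
        ring
      rw [e3, map_mul, Complex.conj_ofReal]
      ring
    simp only [e2]
    rw [Finset.sum_comm (s := freq N), Finset.mul_sum]
    refine Finset.sum_congr rfl fun k _ => ?_
    rw [Finset.sum_comm (s := freq N), Finset.mul_sum]
    refine Finset.sum_congr rfl fun k' _ => ?_
    simp only [Finset.mul_sum, Finset.sum_mul, mul_assoc, Complex.ofReal_mul]
  rw [e]
  calc _ ≤ (1 / N : ℝ) * ∑ l ∈ freq N, B * ‖∑ k ∈ Finset.Icc 1 N, (v k : ℂ) *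
        Complex.exp (Complex.I * (l * (k * (2 * Real.pi / N))))‖ ^ 2 := by
        gcongr with l _
        exact hB l
    _ ≤ (1 / N : ℝ) * (B * (3 * N * ∑ k ∈ Finset.Icc 1 N, v k ^ 2)) := by
        rw [← Finset.mul_sum]
        have := sum_norm_sq_exp_le hN v
        gcongr
    _ = _ := by field_simp

end SpectralSums

end TorusNeedlet

namespace TorusNeedlet

/-! ### The Gaussian law of the scaled coefficients and the normalized statistics -/

section SampleLaw

variable {Ω : Type*} [MeasurableSpace Ω] {P : Measure Ω} {b : ℕ → Ω → ℝ}

/-- Each coefficient is a linear combination of finitely many values of the field. -/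
lemma isGaussianProcess_sampledCoeff {X : ℝ → Ω → ℝ} (hB : IsGaussianProcess X P) (a : ℝ → ℝ)
    (M N : ℕ) : IsGaussianProcess (sampledCoeff a X M N) P := by
  classical
  refine hB.of_isGaussianProcess fun k =>
    ⟨(Finset.range M).image fun m : ℕ => 2 * Real.pi * m / M,
      (1 / M : ℝ) • ∑ m ∈ (Finset.range M).attach,
        psi a N (2 * Real.pi * m / M - k * (2 * Real.pi / N)) •
          (ContinuousLinearMap.proj (R := ℝ) (φ := fun _ => ℝ)
            ⟨2 * Real.pi * m / M, Finset.mem_image_of_mem _ m.2⟩), fun ω => ?_⟩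
  simp only [sampledCoeff, smul_eq_mul, mul_comm (psi _ _ _), _root_.smul_apply,
    _root_.sum_apply, ContinuousLinearMap.proj_apply, Finset.restrict]
  rw [← Finset.sum_attach]

/-- The law of the coefficients with indices in `s`, divided by `√v`. -/
noncomputable def scaledLaw (P : Measure Ω) (b : ℕ → Ω → ℝ) (s : Finset ℕ) (v : ℝ) :
    Measure (s → ℝ) :=
  P.map fun ω k => b k ω / Real.sqrt v

lemma hasGaussianLaw_scaled (hb : IsGaussianProcess b P) (s : Finset ℕ) (v : ℝ) :
    HasGaussianLaw (fun ω (k : s) => b k ω / Real.sqrt v) P := by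
  have h := (hb.hasGaussianLaw s).fun_smul (Real.sqrt v)⁻¹
  have e : (fun ω (k : s) => b k ω / Real.sqrt v) =
      fun ω => (Real.sqrt v)⁻¹ • s.restrict (b · ω) := by
    ext ω k
    simp [div_eq_inv_mul]
  rwa [e]

lemma integral_scaledLaw (hb : IsGaussianProcess b P) (s : Finset ℕ) (v : ℝ)
    (p : MvPolynomial s ℝ) : ∫ x, MvPolynomial.eval x p ∂(scaledLaw P b s v) =
      ∫ ω, MvPolynomial.eval (fun k : s => b k ω / Real.sqrt v) p ∂P :=
  integral_map (hasGaussianLaw_scaled hb s v).aemeasurable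
    (MvPolynomial.continuous_eval p).aestronglyMeasurable

lemma integrable_eval_scaled (hb : IsGaussianProcess b P) (s : Finset ℕ) (v : ℝ)
    (p : MvPolynomial s ℝ) :
    Integrable (fun ω => MvPolynomial.eval (fun k : s => b k ω / Real.sqrt v) p) P := by
  have hg : IsGaussian (scaledLaw P b s v) := (hasGaussianLaw_scaled hb s v).isGaussian_map
  exact (integrable_map_measure (MvPolynomial.continuous_eval p).aestronglyMeasurable
    (hasGaussianLaw_scaled hb s v).aemeasurable).mp (integrable_eval (scaledLaw P b s v) p)

lemma covMat_scaledLaw (hb : IsGaussianProcess b P) (s : Finset ℕ) {v : ℝ} (hv : 0 < v)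
    (k k' : s) : covMat (scaledLaw P b s v) k k' = (∫ ω, b k ω * b k' ω ∂P) / v := by
  have h := integral_scaledLaw hb s v (MvPolynomial.X k * MvPolynomial.X k')
  simp only [map_mul, MvPolynomial.eval_X] at h
  rw [covMat, h, ← integral_div]
  congr 1
  ext ω
  rw [div_mul_div_comm, Real.mul_self_sqrt hv.le]

lemma isUnitGaussian_scaledLaw (hb : IsGaussianProcess b P) (s : Finset ℕ)
    (hmean : ∀ k, ∫ ω, b k ω ∂P = 0) {v Λ : ℝ} (hv : 0 < v)
    (hvar : ∀ k ∈ s, ∫ ω, b k ω * b k ω ∂P = v) (hrow : ∀ ω, ∑ k ∈ s, b k ω = 0) (hΛ : 0 ≤ Λ)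
    (hbound : ∀ u : ℕ → ℝ, ∑ k ∈ s, ∑ k' ∈ s, (∫ ω, b k ω * b k' ω ∂P) * u k * u k' ≤
      Λ * v * ∑ k ∈ s, u k ^ 2) : IsUnitGaussian (scaledLaw P b s v) Λ where
  gaussian := (hasGaussianLaw_scaled hb s v).isGaussian_map
  mean := by
    have hg : IsGaussian (scaledLaw P b s v) := (hasGaussianLaw_scaled hb s v).isGaussian_map
    ext k
    rw [eval_integral fun i => integrable_of_eval (MvPolynomial.X i) fun x => by simp]
    have h := integral_scaledLaw hb s v (MvPolynomial.X k)
    simp only [MvPolynomial.eval_X] at h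
    rw [h, integral_div, hmean, zero_div, Pi.zero_apply]
  unit k := by rw [covMat_scaledLaw hb s hv, hvar k k.2, div_self hv.ne']
  row k := by
    have hm : ∀ k' : s, Integrable (fun ω => b k ω * b k' ω) P := fun k' =>
      ((hb.hasGaussianLaw_eval k).memLp_two).integrable_mul (hb.hasGaussianLaw_eval k').memLp_two
    simp only [covMat_scaledLaw hb s hv]
    rw [← Finset.sum_div, ← integral_finsetSum _ fun k' _ => hm k']
    simp only [← Finset.mul_sum]
    have : ∀ ω, ∑ k' : s, b k' ω = 0 := fun ω => by
      rw [Finset.sum_coe_sort s fun k' => b k' ω, hrow]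
    simp only [this, mul_zero, integral_zero, zero_div]
  nonneg := hΛ
  bound u := by
    -- Extension by zero, to pass from vectors indexed by `s` to sequences.
    set u' : ℕ → ℝ := fun k => if h : k ∈ s then u ⟨k, h⟩ else 0 with hu'
    have hu : ∀ k : s, u k = u' k := fun k => by simp [hu']
    have h := hbound u'
    simp only [covMat_scaledLaw hb s hv, hu]
    rw [Finset.sum_coe_sort s fun k => u' k ^ 2]
    have e : ∑ i : s, ∑ j : s, (∫ ω, b i ω * b j ω ∂P) / v * u' i * u' j =
        (∑ k ∈ s, ∑ k' ∈ s, (∫ ω, b k ω * b k' ω ∂P) * u' k * u' k') / v := by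
      rw [← Finset.sum_coe_sort s, Finset.sum_div]
      refine Finset.sum_congr rfl fun k _ => ?_
      rw [← Finset.sum_coe_sort s, Finset.sum_div]
      exact Finset.sum_congr rfl fun k' _ => by ring
    rw [e, div_le_iff₀ hv]
    linarith

end SampleLaw

section Normalized

variable {Ω : Type*}

/-- The scale `v > 0` is free, as it cancels. The value `1` serves for integrability and the true
variance of the coefficients for the limit. -/
lemma normSkewness_eq_eval (a : ℝ → ℝ) (C : ℕ → ℝ) (X : ℝ → Ω → ℝ) (M N : ℕ) {v : ℝ} (hv : 0 < v)
    (ω : Ω) : normSkewness a C X M N ω =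
      MvPolynomial.eval (fun k : Finset.Icc 1 N => sampledCoeff a X M N k ω / Real.sqrt v)
        (cubeSum _ (Real.sqrt v ^ 3 / (sigma a C N ^ 3 * Real.sqrt N * sigmaS a C N))) := by
  have hs : Real.sqrt v ≠ 0 := (Real.sqrt_pos.mpr hv).ne'
  rw [cubeSum, eval_linStat, normSkewness, skewness, ← Finset.sum_coe_sort, Finset.mul_sum,
    Finset.sum_div]
  refine Finset.sum_congr rfl fun k _ => ?_
  simp only [Polynomial.eval_pow, Polynomial.eval_X, div_pow]
  rw [div_mul_div_comm, div_mul_div_comm, div_div, mul_comm (Real.sqrt v ^ 3),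
    mul_div_mul_right _ _ (pow_ne_zero 3 hs)]
  ring

/-- Here the scale does not cancel in the centring: `quartSum` subtracts `3` after division by `√v`,
the kurtosis after division by `σ_N`. The shift is the difference of the two centrings. -/
lemma normKurtosis_eq_eval (a : ℝ → ℝ) (C : ℕ → ℝ) (X : ℝ → Ω → ℝ) (M N : ℕ) {v : ℝ} (hv : 0 < v)
    (ω : Ω) : normKurtosis a C X M N ω =
      MvPolynomial.eval (fun k : Finset.Icc 1 N => sampledCoeff a X M N k ω / Real.sqrt v)
        (quartSum _ (v ^ 2 / (sigma a C N ^ 4 * Real.sqrt N * sigmaU a C N))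
          (3 * N * (v ^ 2 / (sigma a C N ^ 4 * Real.sqrt N * sigmaU a C N) -
            1 / (Real.sqrt N * sigmaU a C N)))) := by
  have hs : Real.sqrt v ≠ 0 := (Real.sqrt_pos.mpr hv).ne'
  have hv4 : v ^ 2 = Real.sqrt v ^ 4 := by
    rw [show Real.sqrt v ^ 4 = (Real.sqrt v ^ 2) ^ 2 by ring, Real.sq_sqrt hv.le]
  rw [quartSum, map_add, MvPolynomial.eval_C, eval_linStat, normKurtosis, kurtosis,
    ← Finset.sum_coe_sort]
  simp only [Polynomial.eval_pow, Polynomial.eval_X, Polynomial.eval_sub, Polynomial.eval_C,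
    mul_sub, Finset.sum_sub_distrib, Finset.sum_const, Finset.card_univ, Fintype.card_coe,
    Nat.card_Icc, Nat.add_sub_cancel, nsmul_eq_mul, sub_div, Finset.mul_sum, Finset.sum_div]
  have h1 : ∀ k : Finset.Icc 1 N, v ^ 2 / (sigma a C N ^ 4 * Real.sqrt N * sigmaU a C N) *
      (sampledCoeff a X M N k ω / Real.sqrt v) ^ 4 =
      1 / Real.sqrt N * (sampledCoeff a X M N k ω / sigma a C N) ^ 4 / sigmaU a C N := fun k => by
    rw [div_pow, div_mul_div_comm, hv4, mul_comm (Real.sqrt v ^ 4),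
      mul_div_mul_right _ _ (pow_ne_zero 4 hs)]
    ring
  simp only [h1]
  ring

end Normalized

end TorusNeedlet

namespace TorusNeedlet

/-! ### Stability of the normalizing variances under aliasing -/

section Perturbation

/-- The `N²` entrywise errors, divided by `N`, leave one factor `N`; hence `N ε` must vanish, and
not merely `ε`. -/
lemma abs_double_sum_sub_le {N : ℕ} (hN : N ≠ 0) {f h : ℕ → ℕ → ℝ} {t B : ℝ} (ht : 0 ≤ t)
    (hfh : ∀ k k', |f k k' - h k k'| ≤ B) :
    |t / N * ∑ k ∈ Finset.Icc 1 N, ∑ k' ∈ Finset.Icc 1 N, f k k' -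
      t / N * ∑ k ∈ Finset.Icc 1 N, ∑ k' ∈ Finset.Icc 1 N, h k k'| ≤ t * (N * B) := by
  have hN' : (0 : ℝ) < N := by exact_mod_cast Nat.pos_of_ne_zero hN
  have h1 : |∑ k ∈ Finset.Icc 1 N, ∑ k' ∈ Finset.Icc 1 N, (f k k' - h k k')| ≤ N * (N * B) := by
    calc _ ≤ ∑ k ∈ Finset.Icc 1 N, ∑ k' ∈ Finset.Icc 1 N, |f k k' - h k k'| :=
          (Finset.abs_sum_le_sum_abs _ _).trans
            (Finset.sum_le_sum fun k _ => Finset.abs_sum_le_sum_abs _ _)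
      _ ≤ ∑ k ∈ Finset.Icc 1 N, ∑ k' ∈ Finset.Icc 1 N, B :=
          Finset.sum_le_sum fun k _ => Finset.sum_le_sum fun k' _ => hfh k k'
      _ = _ := by simp
  simp only [Finset.sum_sub_distrib] at h1
  rw [← mul_sub, abs_mul, abs_of_nonneg (by positivity)]
  calc _ ≤ t / N * (N * (N * B)) := mul_le_mul_of_nonneg_left h1 (by positivity)
    _ = _ := by field_simp

variable {g r ρ ε : ℝ}

lemma abs_cube_sub_le (hε : ε ≤ 1) (hρ : |ρ| ≤ 1) (hg : |g - ρ| ≤ ε) :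
    |g ^ 3 - ρ ^ 3| ≤ 7 * ε := by
  have hε0 : 0 ≤ ε := (abs_nonneg _).trans hg
  have hg2 : |g| ≤ 2 := by
    have := abs_sub_abs_le_abs_sub g ρ
    linarith
  rw [show g ^ 3 - ρ ^ 3 = (g - ρ) * (g ^ 2 + g * ρ + ρ ^ 2) by ring, abs_mul, mul_comm]
  refine mul_le_mul ?_ hg (abs_nonneg _) (by norm_num)
  rw [abs_le] at *
  constructor <;> nlinarith

/-- The factor `r`, later the ratio `v / σ_N²`, appears because squares and fourth powers in the
kurtosis variance share the normalization by the fourth power of this ratio. -/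
lemma abs_sq_sub_le (hε : ε ≤ 1) (hρ : |ρ| ≤ 1) (hr : |r - 1| ≤ ε) (hg : |g - ρ| ≤ ε) :
    |(r * g) ^ 2 - ρ ^ 2| ≤ 15 * ε := by
  have hε0 : 0 ≤ ε := (abs_nonneg _).trans hg
  have hr2 : |r| ≤ 2 := by
    have := abs_sub_abs_le_abs_sub r 1
    rw [abs_one] at this
    linarith
  have hg2 : |g| ≤ 2 := by
    have := abs_sub_abs_le_abs_sub g ρ
    linarith
  have h1 : |r * g - ρ| ≤ 3 * ε := by
    rw [show r * g - ρ = r * (g - ρ) + (r - 1) * ρ by ring]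
    refine (abs_add_le _ _).trans ?_
    rw [abs_mul, abs_mul]
    have h3 : |r| * |g - ρ| ≤ 2 * ε := mul_le_mul hr2 hg (abs_nonneg _) (by norm_num)
    have h4 : |r - 1| * |ρ| ≤ ε * 1 := mul_le_mul hr hρ (abs_nonneg _) hε0
    linarith
  have h2 : |r * g + ρ| ≤ 5 := by
    refine (abs_add_le _ _).trans ?_
    rw [abs_mul]
    have : |r| * |g| ≤ 2 * 2 := mul_le_mul hr2 hg2 (abs_nonneg _) (by norm_num)
    linarith
  rw [sq_sub_sq, abs_mul]
  calc |r * g + ρ| * |r * g - ρ| ≤ 5 * (3 * ε) :=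
        mul_le_mul h2 h1 (abs_nonneg _) (by norm_num)
    _ = 15 * ε := by ring

lemma abs_fourth_sub_le (hε : ε ≤ 1) (hρ : |ρ| ≤ 1) (hg : |g - ρ| ≤ ε) :
    |g ^ 4 - ρ ^ 4| ≤ 15 * ε := by
  have hε0 : 0 ≤ ε := (abs_nonneg _).trans hg
  have hg2 : |g| ≤ 2 := by
    have := abs_sub_abs_le_abs_sub g ρ
    linarith
  have h1 : |g + ρ| ≤ 3 := (abs_add_le _ _).trans (by linarith)
  have h2 : |g ^ 2 + ρ ^ 2| ≤ 5 := by
    rw [abs_of_nonneg (by positivity), ← sq_abs g, ← sq_abs ρ]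
    nlinarith [abs_nonneg g, abs_nonneg ρ]
  rw [show g ^ 4 - ρ ^ 4 = (g ^ 2 + ρ ^ 2) * (g + ρ) * (g - ρ) by ring, abs_mul, abs_mul]
  calc _ ≤ 5 * 3 * ε := mul_le_mul (mul_le_mul h2 h1 (abs_nonneg _) (by norm_num)) hg
        (abs_nonneg _) (by norm_num)
    _ = 15 * ε := by ring

end Perturbation

section Sampled

variable {Ω : Type*} [MeasurableSpace Ω] {P : Measure Ω} [IsProbabilityMeasure P] {a : ℝ → ℝ}
  {C : ℕ → ℝ} {α : ℝ} {w : ℤ → Ω → ℂ} {X : ℝ → Ω → ℝ}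

/-- The covariances of the sampled needlet coefficients. -/
noncomputable def sampledCov (P : Measure Ω) (a : ℝ → ℝ) (X : ℝ → Ω → ℝ) (M N k k' : ℕ) : ℝ :=
  ∫ ω, sampledCoeff a X M N k ω * sampledCoeff a X M N k' ω ∂P

/-- The normalized sampled needlet coefficients form a unit Gaussian vector. -/
lemma isUnitGaussian_sampled (hX : IsSpectralField P C w X) (ha : IsWindow a)
    (hB : IsGaussianProcess X P) {M N : ℕ} (hN : N ≠ 0) (hMN : 2 * N < M) {B b ε : ℝ}
    (hb : 0 < b) (hB0 : 0 ≤ B) (hBw : ∀ l, specWeight a C N l ≤ B * b)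
    (hbσ : b ≤ sigmaSq a C N) (hε : N * ε ≤ 1 / 2)
    (hG : ∀ k k', |sampledCov P a X M N k k' - specCov a C N k k'| ≤ ε * b) :
    0 < sampledCov P a X M N 1 1 ∧
    IsUnitGaussian (scaledLaw P (sampledCoeff a X M N) (Finset.Icc 1 N) (sampledCov P a X M N 1 1))
      (6 * B + 1) := by
  have hN' : (1 : ℝ) ≤ N := by exact_mod_cast Nat.one_le_iff_ne_zero.mpr hN
  have hε0 : 0 ≤ ε := by
    have := (abs_nonneg _).trans (hG 1 1)
    exact nonneg_of_mul_nonneg_left this hb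
  have hε1 : ε ≤ 1 / 2 := by nlinarith
  -- The sampled variance differs from `σ_N² ≥ b` by at most `ε b ≤ b/2`.
  have hv : b / 2 ≤ sampledCov P a X M N 1 1 := by
    have h1 := (abs_le.mp (hG 1 1)).1
    rw [specCov_self] at h1
    nlinarith
  have hv0 : 0 < sampledCov P a X M N 1 1 := by linarith
  refine ⟨hv0, isUnitGaussian_scaledLaw (isGaussianProcess_sampledCoeff hB a M N) _
    (fun k => hX.integral_sampledCoeff a M N k) hv0
    (fun k _ => hX.integral_sampledCoeff_sq_eq ha hMN k 1)
    (sum_sampledCoeff_eq_zero ha X M N hN) (by positivity) fun u => ?_⟩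
  have hu0 : 0 ≤ ∑ k ∈ Finset.Icc 1 N, u k ^ 2 := Finset.sum_nonneg fun _ _ => sq_nonneg _
  have h1 := specCov_quadratic_le ha hN (by positivity) hBw u
  -- An `N × N` matrix with entries at most `ε b` has quadratic form at most `N ε b`, by
  -- Cauchy–Schwarz.
  have h2 : ∑ k ∈ Finset.Icc 1 N, ∑ k' ∈ Finset.Icc 1 N,
      (sampledCov P a X M N k k' - specCov a C N k k') * u k * u k' ≤
      ε * b * (N * ∑ k ∈ Finset.Icc 1 N, u k ^ 2) := by
    calc _ ≤ ∑ k ∈ Finset.Icc 1 N, ∑ k' ∈ Finset.Icc 1 N, ε * b * (|u k| * |u k'|) := by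
          refine Finset.sum_le_sum fun k _ => Finset.sum_le_sum fun k' _ => ?_
          refine (le_abs_self _).trans ?_
          rw [mul_assoc, abs_mul, abs_mul]
          exact mul_le_mul_of_nonneg_right (hG k k') (by positivity)
      _ = ε * b * (∑ k ∈ Finset.Icc 1 N, |u k|) ^ 2 := by
          rw [pow_two, Finset.sum_mul_sum, Finset.mul_sum]
          simp only [Finset.mul_sum]
      _ ≤ _ := by
          refine mul_le_mul_of_nonneg_left ?_ (by positivity)
          have := sq_sum_le_card_mul_sum_sq (s := Finset.Icc 1 N) (f := fun k => |u k|)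
          simpa using this
  have h3 : ∑ k ∈ Finset.Icc 1 N, ∑ k' ∈ Finset.Icc 1 N,
      sampledCov P a X M N k k' * u k * u k' ≤
      (3 * (B * b) + N * ε * b) * ∑ k ∈ Finset.Icc 1 N, u k ^ 2 := by
    have e : ∀ k k', (sampledCov P a X M N k k' - specCov a C N k k') * u k * u k' =
        sampledCov P a X M N k k' * u k * u k' - specCov a C N k k' * u k * u k' :=
      fun k k' => by ring
    simp only [e, Finset.sum_sub_distrib] at h2
    linarith
  refine h3.trans (mul_le_mul_of_nonneg_right ?_ hu0)
  -- `3Bb + Nεb ≤ (3B + 1/2) b = (6B + 1) b/2`, which is at most `6B + 1` times the sampled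
  -- variance.
  nlinarith [mul_le_mul_of_nonneg_right hε hb.le,
    mul_le_mul_of_nonneg_left hv (by positivity : 0 ≤ 6 * B + 1)]

/-- The coefficient of the cubes in the normalized skewness. -/
noncomputable def cubeCoeff (a : ℝ → ℝ) (C : ℕ → ℝ) (N : ℕ) (v : ℝ) : ℝ :=
  Real.sqrt v ^ 3 / (sigma a C N ^ 3 * Real.sqrt N * sigmaS a C N)

/-- The coefficient of the fourth powers in the normalized kurtosis. -/
noncomputable def quartCoeff (a : ℝ → ℝ) (C : ℕ → ℝ) (N : ℕ) (v : ℝ) : ℝ :=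
  v ^ 2 / (sigma a C N ^ 4 * Real.sqrt N * sigmaU a C N)

/-- The deterministic shift in the normalized kurtosis. -/
noncomputable def quartShift (a : ℝ → ℝ) (C : ℕ → ℝ) (N : ℕ) (v : ℝ) : ℝ :=
  3 * N * (quartCoeff a C N v - 1 / (Real.sqrt N * sigmaU a C N))

lemma cubeCoeff_sq (hC : ∀ l, 0 ≤ C l) {N : ℕ} {v : ℝ} (hv : 0 ≤ v) (hS : 0 ≤ sigmaSSq a C N) :
    cubeCoeff a C N v ^ 2 = (v / sigmaSq a C N) ^ 3 / (N * sigmaSSq a C N) := by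
  rw [cubeCoeff, div_pow, mul_pow, mul_pow, sigmaS, Real.sq_sqrt hS, Real.sq_sqrt (Nat.cast_nonneg N),
    ← pow_mul, ← pow_mul, mul_comm 3 2, pow_mul, pow_mul, Real.sq_sqrt hv, sigma_sq hC, div_pow,
    div_div, mul_assoc]

lemma quartCoeff_sq (hC : ∀ l, 0 ≤ C l) {N : ℕ} {v : ℝ}
    (hU : 0 ≤ sigmaU1Sq a C N + sigmaU2Sq a C N) : quartCoeff a C N v ^ 2 =
      (v / sigmaSq a C N) ^ 4 / (N * (sigmaU1Sq a C N + sigmaU2Sq a C N)) := by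
  rw [quartCoeff, div_pow, mul_pow, mul_pow, sigmaU, Real.sq_sqrt hU,
    Real.sq_sqrt (Nat.cast_nonneg N), ← pow_mul, ← pow_mul, mul_comm 4 2, pow_mul (sigma a C N),
    sigma_sq hC, div_pow, div_div, mul_assoc]

lemma quartShift_eq (hC : ∀ l, 0 ≤ C l) (N : ℕ) (v : ℝ) :
    quartShift a C N v = 3 * Real.sqrt N * ((v / sigmaSq a C N) ^ 2 - 1) / sigmaU a C N := by
  have h4 : sigma a C N ^ 4 = sigmaSq a C N ^ 2 := by rw [← sigma_sq hC]; ring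
  by_cases hN : (N : ℝ) = 0
  · simp [quartShift, hN]
  have hs : Real.sqrt N ≠ 0 := by
    rw [Real.sqrt_ne_zero']
    positivity
  have hN2 : (N : ℝ) = Real.sqrt N * Real.sqrt N := (Real.mul_self_sqrt (Nat.cast_nonneg N)).symm
  have h1 : (N : ℝ) / Real.sqrt N = Real.sqrt N := Real.div_sqrt
  rw [quartShift, quartCoeff, h4, div_pow]
  calc _ = 3 * ((N : ℝ) / Real.sqrt N) * (v ^ 2 / sigmaSq a C N ^ 2 - 1) / sigmaU a C N := by
        simp only [div_eq_mul_inv, mul_inv]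
        ring
    _ = _ := by rw [h1]

variable {M N : ℕ} {v b ε : ℝ}

/-- The shift is `3√N ((v/σ_N²)² - 1) / σ_{U_N}`. The squared ratio is within `3ε` of one, `σ_{U_N}
≥ 1`, and the crude bound `√N ≤ N` suffices. -/
lemma abs_quartShift_le (hC : ∀ l, 0 ≤ C l) (hN : N ≠ 0) (hε : ε ≤ 1)
    (hU : 72 ≤ sigmaU1Sq a C N + sigmaU2Sq a C N) (hr : |v / sigmaSq a C N - 1| ≤ ε) :
    |quartShift a C N v| ≤ 9 * (N * ε) := by
  have hN' : (1 : ℝ) ≤ N := by exact_mod_cast Nat.one_le_iff_ne_zero.mpr hN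
  have hε0 : 0 ≤ ε := (abs_nonneg _).trans hr
  have h1 : 1 ≤ sigmaU a C N := by
    rw [sigmaU, Real.one_le_sqrt]
    linarith
  have h2 : Real.sqrt N ≤ N := by
    rw [Real.sqrt_le_left (by linarith)]
    nlinarith
  set r := v / sigmaSq a C N with hr'
  have h3 : |r ^ 2 - 1| ≤ 3 * ε := by
    rw [show r ^ 2 - 1 = (r + 1) * (r - 1) by ring, abs_mul]
    refine mul_le_mul ?_ hr (abs_nonneg _) (by norm_num)
    rw [abs_le] at hr ⊢
    constructor <;> linarith
  rw [quartShift_eq hC, abs_div, abs_of_pos (by linarith : 0 < sigmaU a C N), abs_mul,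
    abs_of_nonneg (by positivity : 0 ≤ 3 * Real.sqrt N)]
  refine (div_le_self (by positivity) h1).trans ?_
  calc 3 * Real.sqrt N * |r ^ 2 - 1| ≤ 3 * N * (3 * ε) := by gcongr
    _ = _ := by ring

lemma card_mul_cubeCoeff_sq_le (hC : ∀ l, 0 ≤ C l) (hN : N ≠ 0) (hε : ε ≤ 1) (hb : 0 < b)
    (hbS : b ≤ sigmaSSq a C N) (hv : 0 < v) (hr : |v / sigmaSq a C N - 1| ≤ ε) :
    (N : ℝ) * cubeCoeff a C N v ^ 2 ≤ 8 / b := by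
  have hN' : (N : ℝ) ≠ 0 := by exact_mod_cast hN
  have hS0 : 0 < sigmaSSq a C N := hb.trans_le hbS
  have h0 : 0 ≤ v / sigmaSq a C N := div_nonneg hv.le (sigmaSq_nonneg hC N)
  have h2 : v / sigmaSq a C N ≤ 2 := by
    have := (abs_le.mp hr).2
    linarith
  rw [cubeCoeff_sq hC hv.le hS0.le]
  calc _ = (v / sigmaSq a C N) ^ 3 / sigmaSSq a C N := by
        rw [mul_div_assoc', mul_div_mul_left _ _ hN']
    _ ≤ 2 ^ 3 / b := by gcongr
    _ = 8 / b := by norm_num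

lemma card_mul_quartCoeff_sq_le (hC : ∀ l, 0 ≤ C l) (hN : N ≠ 0) (hε : ε ≤ 1)
    (hU : 72 ≤ sigmaU1Sq a C N + sigmaU2Sq a C N) (hv : 0 < v)
    (hr : |v / sigmaSq a C N - 1| ≤ ε) : (N : ℝ) * quartCoeff a C N v ^ 2 ≤ 1 := by
  have hN' : (N : ℝ) ≠ 0 := by exact_mod_cast hN
  have h0 : 0 ≤ v / sigmaSq a C N := div_nonneg hv.le (sigmaSq_nonneg hC N)
  have h2 : v / sigmaSq a C N ≤ 2 := by
    have := (abs_le.mp hr).2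
    linarith
  rw [quartCoeff_sq hC (by linarith)]
  calc _ = (v / sigmaSq a C N) ^ 4 / (sigmaU1Sq a C N + sigmaU2Sq a C N) := by
        rw [mul_div_assoc', mul_div_mul_left _ _ hN']
    _ ≤ 2 ^ 4 / 72 := by gcongr
    _ ≤ 1 := by norm_num

/-- The scale `v` cancels, leaving the relative error between the cubic sums of sampled and spectral
correlations. Each cube moves by at most `7ε`, and `42 = 6 · 7`. -/
lemma abs_cubeCoeff_variance_sub_le (ha : IsWindow a) (hC : ∀ l, 0 ≤ C l) (hN : N ≠ 0)
    (hε : ε ≤ 1) (hb : 0 < b) (hbS : b ≤ sigmaSSq a C N) (hv : 0 < v) (hs : 0 < sigmaSq a C N)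
    {G : ℕ → ℕ → ℝ} (hG : ∀ k k', |G k k' / sigmaSq a C N -
      specCov a C N k k' / sigmaSq a C N| ≤ ε) :
    |cubeCoeff a C N v ^ 2 * (6 * ∑ k : Finset.Icc 1 N, ∑ j : Finset.Icc 1 N, (G k j / v) ^ 3) -
      1| ≤ 42 / b * (N * ε) := by
  have hN' : (0 : ℝ) < N := by exact_mod_cast Nat.pos_of_ne_zero hN
  have hε0 : 0 ≤ ε := (abs_nonneg _).trans (hG 1 1)
  have hS0 : 0 < sigmaSSq a C N := hb.trans_le hbS
  have hρ : ∀ k k', |specCov a C N k k' / sigmaSq a C N| ≤ 1 := fun k k' => by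
    rw [abs_div, abs_of_pos hs, div_le_one hs]
    exact abs_specCov_le hC N k k'
  have h1 := abs_double_sum_sub_le hN (by norm_num : (0 : ℝ) ≤ 6)
    fun k k' => abs_cube_sub_le hε (hρ k k') (hG k k')
  rw [← sigmaSSq_eq ha hC hN] at h1
  have e1 : ∑ k : Finset.Icc 1 N, ∑ j : Finset.Icc 1 N, (G k j / v) ^ 3 =
      ∑ k ∈ Finset.Icc 1 N, ∑ j ∈ Finset.Icc 1 N, (G k j / v) ^ 3 := by
    rw [← Finset.sum_coe_sort (Finset.Icc 1 N)]
    exact Finset.sum_congr rfl fun k _ => Finset.sum_coe_sort _ fun j => (G k j / v) ^ 3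
  have e2 : ∀ k j, (G k j / v) ^ 3 =
      (sigmaSq a C N / v) ^ 3 * (G k j / sigmaSq a C N) ^ 3 := fun k j => by
    field_simp
  rw [cubeCoeff_sq hC hv.le hS0.le, e1]
  simp only [e2, ← Finset.mul_sum]
  set A := ∑ k ∈ Finset.Icc 1 N, ∑ j ∈ Finset.Icc 1 N, (G k j / sigmaSq a C N) ^ 3 with hA
  have e3 : (v / sigmaSq a C N) ^ 3 / (N * sigmaSSq a C N) *
      (6 * ((sigmaSq a C N / v) ^ 3 * A)) - 1 = (6 / N * A - sigmaSSq a C N) / sigmaSSq a C N := by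
    field_simp
  rw [e3, abs_div, abs_of_pos hS0]
  calc _ ≤ 6 * (N * (7 * ε)) / b := by gcongr
    _ = _ := by ring

lemma abs_quartCoeff_variance_sub_le (ha : IsWindow a) (hC : ∀ l, 0 ≤ C l) (hN : N ≠ 0)
    (hε : ε ≤ 1) (hv : 0 < v) (hs : 0 < sigmaSq a C N) (hr : |v / sigmaSq a C N - 1| ≤ ε)
    {G : ℕ → ℕ → ℝ} (hG : ∀ k k', |G k k' / sigmaSq a C N -
      specCov a C N k k' / sigmaSq a C N| ≤ ε) :
    |quartCoeff a C N v ^ 2 * (72 * ∑ k : Finset.Icc 1 N, ∑ j : Finset.Icc 1 N, (G k j / v) ^ 2 +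
      24 * ∑ k : Finset.Icc 1 N, ∑ j : Finset.Icc 1 N, (G k j / v) ^ 4) - 1| ≤ 20 * (N * ε) := by
  have hN' : (0 : ℝ) < N := by exact_mod_cast Nat.pos_of_ne_zero hN
  have hε0 : 0 ≤ ε := (abs_nonneg _).trans (hG 1 1)
  have hU := le_sigmaUSq ha hC hN hs
  have hρ : ∀ k k', |specCov a C N k k' / sigmaSq a C N| ≤ 1 := fun k k' => by
    rw [abs_div, abs_of_pos hs, div_le_one hs]
    exact abs_specCov_le hC N k k'
  have h1 := abs_double_sum_sub_le hN (by norm_num : (0 : ℝ) ≤ 72)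
    fun k k' => abs_sq_sub_le hε (hρ k k') hr (hG k k')
  have h2 := abs_double_sum_sub_le hN (by norm_num : (0 : ℝ) ≤ 24)
    fun k k' => abs_fourth_sub_le hε (hρ k k') (hG k k')
  rw [← sigmaU1Sq_eq ha hC hN] at h1
  rw [← sigmaU2Sq_eq ha hC hN] at h2
  have e1 : ∀ p : ℕ, ∑ k : Finset.Icc 1 N, ∑ j : Finset.Icc 1 N, (G k j / v) ^ p =
      ∑ k ∈ Finset.Icc 1 N, ∑ j ∈ Finset.Icc 1 N, (G k j / v) ^ p := fun p => by
    rw [← Finset.sum_coe_sort (Finset.Icc 1 N)]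
    exact Finset.sum_congr rfl fun k _ => Finset.sum_coe_sort _ fun j => (G k j / v) ^ p
  -- The fourth power of `σ_N²/v` is extracted to match the squared coefficient; the spare factor
  -- `v/σ_N²` stays inside the square.
  have e2 : ∀ k j, (G k j / v) ^ 2 =
      (sigmaSq a C N / v) ^ 4 * (v / sigmaSq a C N * (G k j / sigmaSq a C N)) ^ 2 := fun k j => by
    field_simp
  have e4 : ∀ k j, (G k j / v) ^ 4 =
      (sigmaSq a C N / v) ^ 4 * (G k j / sigmaSq a C N) ^ 4 := fun k j => by
    field_simp
  rw [quartCoeff_sq hC (by linarith), e1, e1]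
  simp only [e2, e4, ← Finset.mul_sum]
  set A := ∑ k ∈ Finset.Icc 1 N, ∑ j ∈ Finset.Icc 1 N,
    (v / sigmaSq a C N * (G k j / sigmaSq a C N)) ^ 2 with hA
  set A' := ∑ k ∈ Finset.Icc 1 N, ∑ j ∈ Finset.Icc 1 N, (G k j / sigmaSq a C N) ^ 4 with hA'
  set U := sigmaU1Sq a C N + sigmaU2Sq a C N with hU'
  have hU0 : 0 < U := by linarith
  have e3 : (v / sigmaSq a C N) ^ 4 / (N * U) *
      (72 * ((sigmaSq a C N / v) ^ 4 * A) + 24 * ((sigmaSq a C N / v) ^ 4 * A')) - 1 =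
      ((72 / N * A - sigmaU1Sq a C N) + (24 / N * A' - sigmaU2Sq a C N)) / U := by
    rw [show (72 / N * A - sigmaU1Sq a C N) + (24 / N * A' - sigmaU2Sq a C N) =
      72 / N * A + 24 / N * A' - U by rw [hU']; ring]
    field_simp
  rw [e3, abs_div, abs_of_pos hU0]
  -- `72 · 15 + 24 · 15 = 1440`, and division by the lower bound `72` gives `20`.
  have h3 : |(72 / N * A - sigmaU1Sq a C N) + (24 / N * A' - sigmaU2Sq a C N)| ≤
      1440 * (N * ε) := (abs_add_le _ _).trans (by linarith)
  calc _ ≤ 1440 * (N * ε) / 72 := by gcongr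
    _ = _ := by ring

end Sampled

end TorusNeedlet

namespace TorusNeedlet

/-! ### Consequences of the rate condition -/

section Growth

variable {M N : ℕ → ℕ} {α : ℝ}

lemma tendsto_zero_of_rate (hD : Tendsto (fun n => 1 / (N n : ℝ) +
    (N n : ℝ) / (M n : ℝ) ^ (α / (α + 1))) atTop (𝓝 0)) :
    Tendsto (fun n => 1 / (N n : ℝ)) atTop (𝓝 0) ∧
      Tendsto (fun n => (N n : ℝ) / (M n : ℝ) ^ (α / (α + 1))) atTop (𝓝 0) := by
  have h1 : ∀ n, 0 ≤ 1 / (N n : ℝ) := fun n => by positivity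
  have h2 : ∀ n, 0 ≤ (N n : ℝ) / (M n : ℝ) ^ (α / (α + 1)) := fun n => by positivity
  exact ⟨squeeze_zero h1 (fun n => le_add_of_nonneg_right (h2 n)) hD,
    squeeze_zero h2 (fun n => le_add_of_nonneg_left (h1 n)) hD⟩

lemma tendsto_atTop_of_one_div (hN : ∀ n, N n ≠ 0)
    (h : Tendsto (fun n => 1 / (N n : ℝ)) atTop (𝓝 0)) : Tendsto N atTop atTop := by
  rw [← tendsto_natCast_atTop_iff (R := ℝ)]
  have hpos : ∀ n, (0 : ℝ) < 1 / N n := fun n => by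
    have : (0 : ℝ) < N n := by exact_mod_cast Nat.pos_of_ne_zero (hN n)
    positivity
  have h1 : Tendsto (fun n => 1 / (N n : ℝ)) atTop (𝓝[>] 0) :=
    tendsto_nhdsWithin_iff.mpr ⟨h, Eventually.of_forall hpos⟩
  refine h1.inv_tendsto_nhdsGT_zero.congr fun n => ?_
  simp

lemma eventually_two_mul_lt (hα : 1 < α) (hM : Tendsto M atTop atTop)
    (h : Tendsto (fun n => (N n : ℝ) / (M n : ℝ) ^ (α / (α + 1))) atTop (𝓝 0)) :
    ∀ᶠ n in atTop, 2 * N n < M n := by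
  filter_upwards [h.eventually (gt_mem_nhds (by norm_num : (0 : ℝ) < 1 / 2)),
    hM.eventually_ge_atTop 1] with n hn hM1
  have hM1' : (1 : ℝ) ≤ M n := by exact_mod_cast hM1
  have hp : (0 : ℝ) < (M n : ℝ) ^ (α / (α + 1)) := Real.rpow_pos_of_pos (by linarith) _
  have hle : (M n : ℝ) ^ (α / (α + 1)) ≤ M n := by
    conv_rhs => rw [← Real.rpow_one (M n : ℝ)]
    refine Real.rpow_le_rpow_of_exponent_le hM1' ?_
    rw [div_le_one (by linarith)]
    linarith
  rw [div_lt_iff₀ hp] at hn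
  have : 2 * (N n : ℝ) < M n := by linarith
  exact_mod_cast this

/-- Up to the constant `K / b` the sequence is `N^{α+1} / M^α`, the power `α + 1` of the ratio in
the rate condition. -/
lemma tendsto_mul_aliasing_error (hα : 1 < α) (hN : ∀ n, N n ≠ 0)
    (h : Tendsto (fun n => (N n : ℝ) / (M n : ℝ) ^ (α / (α + 1))) atTop (𝓝 0)) (K b : ℝ) :
    Tendsto (fun n => (N n : ℝ) * (K * (M n : ℝ) ^ (-α) / (b * (N n : ℝ) ^ (-α)))) atTop
      (𝓝 0) := by
  have h1 := (h.rpow_const (p := α + 1) (Or.inr (by linarith))).const_mul (K / b)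
  rw [Real.zero_rpow (by linarith), mul_zero] at h1
  refine h1.congr fun n => ?_
  have hN0 : (0 : ℝ) < N n := by exact_mod_cast Nat.pos_of_ne_zero (hN n)
  have hα1 : α + 1 ≠ 0 := by linarith
  rw [Real.div_rpow hN0.le (by positivity), ← Real.rpow_mul (Nat.cast_nonneg _),
    div_mul_cancel₀ _ hα1, Real.rpow_add hN0, Real.rpow_one, Real.rpow_neg (Nat.cast_nonneg _),
    Real.rpow_neg hN0.le]
  simp only [div_eq_mul_inv, mul_inv, inv_inv]
  ring

end Growth

/-! ### Convergence of the joint moments -/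

section Moments

variable {Ω : Type*} [MeasurableSpace Ω] {P : Measure Ω} {X : ℝ → Ω → ℝ}

/-- The statistics are polynomials in a Gaussian vector. With the scale `1` no positivity of the
true variance is needed, so every `n` is covered. -/
lemma integrable_normSkewness_mul_normKurtosis (hB : IsGaussianProcess X P) (a : ℝ → ℝ) (C : ℕ → ℝ)
    (M N p q : ℕ) :
    Integrable (fun ω => normSkewness a C X M N ω ^ p * normKurtosis a C X M N ω ^ q) P := by
  simp only [normSkewness_eq_eval a C X M N one_pos, normKurtosis_eq_eval a C X M N one_pos,
    ← map_pow, ← map_mul]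
  exact integrable_eval_scaled (isGaussianProcess_sampledCoeff hB a M N) _ _ _

lemma integral_normSkewness_mul_normKurtosis (hB : IsGaussianProcess X P) (a : ℝ → ℝ) (C : ℕ → ℝ)
    (M N p q : ℕ) {v : ℝ} (hv : 0 < v) :
    ∫ ω, normSkewness a C X M N ω ^ p * normKurtosis a C X M N ω ^ q ∂P =
      polyMean (scaledLaw P (sampledCoeff a X M N) (Finset.Icc 1 N) v)
        (cubeSum _ (cubeCoeff a C N v) ^ p *
          quartSum _ (quartCoeff a C N v) (quartShift a C N v) ^ q) := by
  simp only [normSkewness_eq_eval a C X M N hv, normKurtosis_eq_eval a C X M N hv, ← map_pow,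
    ← map_mul]
  exact (integral_scaledLaw (isGaussianProcess_sampledCoeff hB a M N) _ v _).symm

theorem tendsto_integral_normSkewness_mul_normKurtosis [IsProbabilityMeasure P] {a : ℝ → ℝ}
    (ha : IsWindow a) {C : ℕ → ℝ} {α : ℝ} {w : ℤ → Ω → ℂ} (hX : IsSpectralField P C w X)
    (hA1 : IsRegularSpectrum C α) (hB : IsGaussianProcess X P) {M N : ℕ → ℕ} (hN : ∀ n, N n ≠ 0)
    (hM : Tendsto M atTop atTop)
    (hD : Tendsto (fun n => 1 / (N n : ℝ) + (N n : ℝ) / (M n : ℝ) ^ (α / (α + 1)))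
      atTop (𝓝 0)) (p q : ℕ) :
    Tendsto (fun n => ∫ ω, normSkewness a C X (M n) (N n) ω ^ p *
        normKurtosis a C X (M n) (N n) ω ^ q ∂P) atTop
        (𝓝 (normalMoment p * normalMoment q)) := by
  obtain ⟨hα, g, c₁, c₂, hc₁, hg, hCg⟩ := hA1
  have hC0 : ∀ l, 0 ≤ C l := fun l => by simpa using hX.spectrum_nonneg l
  have hc₂ : 0 < c₂ := hc₁.trans_le ((hg 0).1.trans (hg 0).2)
  have hC₁ : ∀ l : ℕ, 1 ≤ l → c₁ * (l : ℝ) ^ (-α) ≤ C l := fun l hl => by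
    rw [hCg l hl]
    exact mul_le_mul_of_nonneg_right (hg l).1 (by positivity)
  have hC₂ : ∀ l : ℕ, 1 ≤ l → C l ≤ c₂ * (l : ℝ) ^ (-α) := fun l hl => by
    rw [hCg l hl]
    exact mul_le_mul_of_nonneg_right (hg l).2 (by positivity)
  have hα0 : 0 < α := by linarith
  obtain ⟨b, hb, hbev⟩ := exists_sigma_lower_bounds ha hα0 hC0 hc₁ hC₁ hC₂
  obtain ⟨hD1, hD2⟩ := tendsto_zero_of_rate hD
  have hNt := tendsto_atTop_of_one_div hN hD1
  set K := 3 * (c₂ * 2 ^ α * (∑' j : ℤ, |(j : ℝ)| ^ (-α))) with hK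
  -- The aliasing error relative to the lower bound for `σ_N²`.
  set ε : ℕ → ℝ := fun n => K * (M n : ℝ) ^ (-α) / (b * (N n : ℝ) ^ (-α)) with hε
  have hNε : Tendsto (fun n => N n * ε n) atTop (𝓝 0) :=
    tendsto_mul_aliasing_error hα hN hD2 K b
  set v : ℕ → ℝ := fun n => sampledCov P a X (M n) (N n) 1 1 with hv
  have hgood : ∀ᶠ n in atTop, 2 * N n < M n ∧ N n * ε n ≤ 1 / 2 ∧
      b * (N n : ℝ) ^ (-α) ≤ sigmaSq a C (N n) ∧ b ≤ sigmaSSq a C (N n) :=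
    (eventually_two_mul_lt hα hM hD2).and ((hNε.eventually_le_const (by norm_num)).and
      (hNt.eventually hbev))
  obtain ⟨n₀, hn₀⟩ := eventually_atTop.mp hgood
  have hgd : ∀ n, _ := fun n => hn₀ (n + n₀) (Nat.le_add_left _ _)
  have hfacts : ∀ n, n₀ ≤ n → ε n ≤ 1 ∧ 0 < sigmaSq a C (N n) ∧ 0 < v n ∧
      IsUnitGaussian (scaledLaw P (sampledCoeff a X (M n) (N n)) (Finset.Icc 1 (N n)) (v n))
        (6 * (c₂ * 8 ^ α / b) + 1) ∧
      |v n / sigmaSq a C (N n) - 1| ≤ ε n ∧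
      ∀ k k', |sampledCov P a X (M n) (N n) k k' / sigmaSq a C (N n) -
        specCov a C (N n) k k' / sigmaSq a C (N n)| ≤ ε n := by
    intro n hn
    obtain ⟨h1, h2, h3, h4⟩ := hn₀ n hn
    have hN1 : (1 : ℝ) ≤ N n := by exact_mod_cast Nat.one_le_iff_ne_zero.mpr (hN n)
    have hNa : 0 < (N n : ℝ) ^ (-α) := Real.rpow_pos_of_pos (by linarith) _
    have hbN : 0 < b * (N n : ℝ) ^ (-α) := mul_pos hb hNa
    have hs : 0 < sigmaSq a C (N n) := hbN.trans_le h3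
    have hεb : ε n * (b * (N n : ℝ) ^ (-α)) = K * (M n : ℝ) ^ (-α) := div_mul_cancel₀ _ hbN.ne'
    have hG : ∀ k k', |sampledCov P a X (M n) (N n) k k' - specCov a C (N n) k k'| ≤
        ε n * (b * (N n : ℝ) ^ (-α)) := fun k k' => by
      rw [hεb]
      exact hX.abs_integral_sub_specCov_le ha hα hc₂.le hC₂ (hN n) h1 k k'
    have hε0 : 0 ≤ ε n := by
      have := (abs_nonneg _).trans (hG 1 1)
      exact nonneg_of_mul_nonneg_left this hbN
    have hBw : ∀ l, specWeight a C (N n) l ≤ c₂ * 8 ^ α / b * (b * (N n : ℝ) ^ (-α)) :=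
      fun l => by
        refine (specWeight_le ha hα0 hc₂.le hC₂ (hN n) l).trans (le_of_eq ?_)
        field_simp
    obtain ⟨hv0, hunit⟩ := isUnitGaussian_sampled hX ha hB (hN n) h1 hbN (by positivity) hBw h3 h2
      hG
    have hdiff : ∀ k k', |sampledCov P a X (M n) (N n) k k' / sigmaSq a C (N n) -
        specCov a C (N n) k k' / sigmaSq a C (N n)| ≤ ε n := fun k k' => by
      rw [← sub_div, abs_div, abs_of_pos hs, div_le_iff₀ hs]
      exact (hG k k').trans (mul_le_mul_of_nonneg_left h3 hε0)
    refine ⟨by nlinarith, hs, hv0, hunit, ?_, hdiff⟩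
    have := hdiff 1 1
    rwa [specCov_self, div_self hs.ne'] at this
  -- The convergence result for power sums asks for its bounds at every index, so the sequence is
  -- started at `n₀`.
  rw [← tendsto_add_atTop_iff_nat n₀]
  have hshift : ∀ {f : ℕ → ℝ} {x : ℝ}, Tendsto f atTop (𝓝 x) →
      Tendsto (fun n => f (n + n₀)) atTop (𝓝 x) := fun hf =>
    hf.comp (tendsto_add_atTop_nat n₀)
  have hf := fun n => hfacts (n + n₀) (Nat.le_add_left _ _)
  have hcov : ∀ n (k j : Finset.Icc 1 (N (n + n₀))),
      covMat (scaledLaw P (sampledCoeff a X (M (n + n₀)) (N (n + n₀)))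
        (Finset.Icc 1 (N (n + n₀))) (v (n + n₀))) k j =
      sampledCov P a X (M (n + n₀)) (N (n + n₀)) k j / v (n + n₀) := fun n k j =>
    covMat_scaledLaw (isGaussianProcess_sampledCoeff hB a _ _) _ (hf n).2.2.1 k j
  have hcard : ∀ n, (Fintype.card (Finset.Icc 1 (N (n + n₀))) : ℝ) = N (n + n₀) := fun n => by
    simp
  have hNε' := hshift hNε
  refine (tendsto_polyMean_cubeSum_quartSum
    (μ := fun n => scaledLaw P (sampledCoeff a X (M (n + n₀)) (N (n + n₀)))
      (Finset.Icc 1 (N (n + n₀))) (v (n + n₀)))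
    (fun n => (hf n).2.2.2.1)
    (c₁ := fun n => cubeCoeff a C (N (n + n₀)) (v (n + n₀)))
    (c₂ := fun n => quartCoeff a C (N (n + n₀)) (v (n + n₀)))
    (δ := fun n => quartShift a C (N (n + n₀)) (v (n + n₀)))
    (K := max (8 / b) 1) ?_ ?_ ?_ ?_ ?_ ?_ p q).congr fun n =>
      (integral_normSkewness_mul_normKurtosis hB a C _ _ p q (hf n).2.2.1).symm
  · intro n
    obtain ⟨h1, h2, h3, -, h5, -⟩ := hf n
    rw [hcard]
    exact (card_mul_cubeCoeff_sq_le hC0 (hN _) h1 hb (hgd n).2.2.2 h3 h5).trans (le_max_left _ _)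
  · intro n
    obtain ⟨h1, h2, h3, -, h5, -⟩ := hf n
    rw [hcard]
    exact (card_mul_quartCoeff_sq_le hC0 (hN _) h1 (le_sigmaUSq ha hC0 (hN _) h2) h3 h5).trans
      (le_max_right _ _)
  · simp only [hcard]
    exact tendsto_natCast_atTop_atTop.comp (hNt.comp (tendsto_add_atTop_nat n₀))
  · rw [tendsto_iff_norm_sub_tendsto_zero]
    refine squeeze_zero (fun n => norm_nonneg _) (fun n => ?_)
      (by simpa only [mul_zero] using hNε'.const_mul (42 / b))
    obtain ⟨h1, h2, h3, -, -, h6⟩ := hf n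
    simp only [hcov]
    exact abs_cubeCoeff_variance_sub_le ha hC0 (hN _) h1 hb (hgd n).2.2.2 h3 h2 h6
  · rw [tendsto_iff_norm_sub_tendsto_zero]
    refine squeeze_zero (fun n => norm_nonneg _) (fun n => ?_)
      (by simpa only [mul_zero] using hNε'.const_mul 20)
    obtain ⟨h1, h2, h3, -, h5, h6⟩ := hf n
    simp only [hcov]
    exact abs_quartCoeff_variance_sub_le ha hC0 (hN _) h1 h3 h2 h5 h6
  · refine squeeze_zero_norm (fun n => ?_)
      (by simpa only [mul_zero] using hNε'.const_mul 9)
    obtain ⟨h1, h2, -, -, h5, -⟩ := hf n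
    exact abs_quartShift_le hC0 (hN _) h1 (le_sigmaUSq ha hC0 (hN _) h2) h5

end Moments

end TorusNeedlet

theorem mainTheorem5 {Ω : Type*} [MeasurableSpace Ω] (P : Measure Ω) [IsProbabilityMeasure P]
    (a : ℝ → ℝ) (ha : IsWindow a)
    (C : ℕ → ℝ) (α : ℝ) (w : ℤ → Ω → ℂ) (X : ℝ → Ω → ℝ)
    (hX : IsSpectralField P C w X)
    (hA1 : IsRegularSpectrum C α)
    (hB : IsGaussianProcess X P)
    (hC : IsRegularlyVaryingSpectrum C α)
    (M N : ℕ → ℕ) (hN : ∀ n, ∃ j : ℕ, N n = 2 ^ (j + 2))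
    (hM : Tendsto M atTop atTop)
    (hD : Tendsto (fun n => 1 / (N n : ℝ) + (N n : ℝ) / (M n : ℝ) ^ (α / (α + 1)))
      atTop (𝓝 0)) :
    (∀ p₁ p₂ : ℕ,
      (∀ n, Integrable (fun ω => normSkewness a C X (M n) (N n) ω ^ p₁ *
        normKurtosis a C X (M n) (N n) ω ^ p₂) P) ∧
      Tendsto (fun n => ∫ ω, normSkewness a C X (M n) (N n) ω ^ p₁ *
        normKurtosis a C X (M n) (N n) ω ^ p₂ ∂P) atTop
        (𝓝 (normalMoment p₁ * normalMoment p₂))) ∧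
    TendstoInDistribution
      (fun n ω => !₂[normSkewness a C X (M n) (N n) ω, normKurtosis a C X (M n) (N n) ω])
      atTop (id : EuclideanSpace ℝ (Fin 2) → EuclideanSpace ℝ (Fin 2)) (fun _ => P)
      (stdGaussian (EuclideanSpace ℝ (Fin 2))) := by 
  have hN0 : ∀ n, N n ≠ 0 := fun n => by
    obtain ⟨j, hj⟩ := hN n
    rw [hj]
    positivity
  have hi : ∀ n (p₁ p₂ : ℕ), Integrable (fun ω => normSkewness a C X (M n) (N n) ω ^ p₁ *
      normKurtosis a C X (M n) (N n) ω ^ p₂) P := fun n =>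
    integrable_normSkewness_mul_normKurtosis hB a C (M n) (N n)
  have hm := tendsto_integral_normSkewness_mul_normKurtosis ha hX hA1 hB hN0 hM hD
  refine ⟨fun p₁ p₂ => ⟨fun n => hi n p₁ p₂, hm p₁ p₂⟩,
    tendstoInDistribution_of_moments (fun n => ?_) (fun n => ?_) hi hm⟩
  -- The orders `(1, 0)` and `(0, 1)` also yield measurability of the two statistics.
  · simpa using (hi n 1 0).aemeasurable
  · simpa using (hi n 0 1).aemeasurable
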